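/- Let $k$ be an algebraically closed field (of any characteristic) and let $X$ be a normal projective variety over $k$ (an integral closed subscheme of some $\mathbb P^N_k$ whose local rings are integrally closed), of dimension $n$. Let $\Delta$ be an $\mathbb R$-divisor on $X$ with coefficients in $[0,1]$ such that $K_X+\Delta$ is $\mathbb R$-Cartier (that is, $(X,\Delta)$ is a log pair), and let $D$ be an $\mathbb R$-Cartier $\mathbb R$-divisor on $X$ such that $$\operatorname{vol}_X(D):=\limsup_{m\to\infty}\frac{n!\,\dim_k H^0(X,\mathcal O_X(\lfloor mD\rfloor))}{m^n}>n^n .$$ Then for every closed point $x\in X$ at which $X$ is smooth over $k$ there is an effective $\mathbb R$-Cartier $\mathbb R$-divisor $\Pi\sim_{\mathbb R}D$ such that $x\in\operatorname{Supp}\Pi$ and the pair $(X,\Delta+\Pi)$ is not klt at $x$, i.e. there are a normal variety $Y$, a birational morphism $f:Y\to X$ over $k$ and a prime divisor $E\subset Y$ such that $x$ lies in the center $\overline{f(E)}$ of $E$ and the discrepancy $a(E,X,\Delta+\Pi)$, the coefficient of $E$ in $K_Y-f^*(K_X+\Delta+\Pi)$ (where $K_X$ and $K_Y$ are the divisors of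 a nonzero rational $n$-form on $X$ and of its pullback to $Y$), is at most $-1$. -/

import Mathlib

open AlgebraicGeometry CategoryTheory

universe u

noncomputable section

namespace BirGeom

/-- A variety over a field `k`: an integral separated scheme of finite type over `k`. -/
structure Variety (k : Type u) [Field k] where
  X : Scheme.{u}
  str : X ⟶ Spec (CommRingCat.of k)
  isIntegral : IsIntegral X
  isSeparated : IsSeparated str
  locallyOfFiniteType : LocallyOfFiniteType str
  quasiCompact : QuasiCompact str

namespace Variety

variable {k : Type u} [Field k] (V : Variety k)

instance instIsIntegral : IsIntegral V.X := V.isIntegral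

instance instIsLocallyNoetherian : IsLocallyNoetherian V.X :=
  haveI := V.locallyOfFiniteType
  LocallyOfFiniteType.isLocallyNoetherian V.str

/-- The ring homomorphism from `k` to the global functions. -/
def constants : k →+* Γ(V.X, ⊤) :=
  ((Scheme.ΓSpecIso (CommRingCat.of k)).inv ≫ V.str.appTop).hom

/-- All local rings are `k`-algebras; this includes the function field, which is the local ring
at the generic point. -/
instance instAlgebraStalk (x : V.X) : Algebra k (V.X.presheaf.stalk x) :=
  ((V.X.presheaf.germ ⊤ x trivial).hom.comp V.constants).toAlgebra

/-- The function field. -/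
abbrev K : Type u := V.X.functionField

/-- A variety is normal if all its local rings are integrally closed domains. -/
class IsNormal : Prop where
  isIntegrallyClosed (x : V.X) : IsIntegrallyClosed (V.X.presheaf.stalk x)

attribute [local instance] MvPolynomial.gradedAlgebra in
/-- Projective space `ℙ^N` over `k`. -/
def projectiveSpace (k : Type u) [Field k] (N : ℕ) : Scheme.{u} :=
  Proj (MvPolynomial.homogeneousSubmodule (Fin (N + 1)) k)

attribute [local instance] MvPolynomial.gradedAlgebra in
/-- The structure morphism of `ℙ^N` over `k`. -/
def projectiveSpaceStr (k : Type u) [Field k] (N : ℕ) :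
    projectiveSpace k N ⟶ Spec (CommRingCat.of k) :=
  Proj.toSpecZero (MvPolynomial.homogeneousSubmodule (Fin (N + 1)) k) ≫
    Spec.map (CommRingCat.ofHom
      (algebraMap k (MvPolynomial.homogeneousSubmodule (Fin (N + 1)) k 0)))

/-- A variety is projective if it is a closed subscheme of some `ℙ^N`, over `k`. -/
def IsProjective : Prop :=
  ∃ (N : ℕ) (i : V.X ⟶ projectiveSpace k N),
    IsClosedImmersion i ∧ i ≫ projectiveSpaceStr k N = V.str

/-- `V` is smooth over `k` at `x`. -/
def IsSmoothAt (x : V.X) : Prop :=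
  ∃ U : V.X.Opens, x ∈ U ∧ Smooth (U.ι ≫ V.str)

/-- Prime divisors, given by their generic points: the points of codimension one.
(In Mathlib's order on the points of a scheme the generic point is the largest.) -/
abbrev PrimeDivisor : Type u := {P : V.X // Order.coheight P = 1}

/-- Weil `ℝ`-divisors. -/
abbrev RDiv : Type u := V.PrimeDivisor →₀ ℝ

/-- The order of vanishing of a rational function along a prime divisor. -/
def ord (f : V.K) (P : V.PrimeDivisor) : ℤ := V.X.ord f P.1

/-- `D` is the divisor of a nonzero rational function. -/
def IsPrincipal (D : V.RDiv) : Prop :=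
  ∃ f : V.K, f ≠ 0 ∧ ∀ P, D P = (V.ord f P : ℝ)

/-- `D` is a Cartier divisor: near every point it is the divisor of a rational function.
(Such a `D` has integral coefficients.) -/
def IsCartier (D : V.RDiv) : Prop :=
  ∀ x : V.X, ∃ U : V.X.Opens, x ∈ U ∧ ∃ f : V.K, f ≠ 0 ∧
    ∀ P : V.PrimeDivisor, P.1 ∈ U → D P = (V.ord f P : ℝ)

/-- `D` is `ℝ`-Cartier: an `ℝ`-linear combination of Cartier divisors. -/
def IsRCartier (D : V.RDiv) : Prop :=
  D ∈ Submodule.span ℝ {C : V.RDiv | V.IsCartier C}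

/-- `ℝ`-linear equivalence: the difference is an `ℝ`-linear combination of principal divisors. -/
def RLinEquiv (D D' : V.RDiv) : Prop :=
  D - D' ∈ Submodule.span ℝ {C : V.RDiv | V.IsPrincipal C}

/-- The point `x` lies in the support of `D`. -/
def PassesThrough (D : V.RDiv) (x : V.X) : Prop :=
  ∃ P : V.PrimeDivisor, D P ≠ 0 ∧ x ∈ closure {P.1}

/-! ### Sections and volume -/

theorem isDiscreteValuationRing_stalk [V.IsNormal] (P : V.PrimeDivisor) :
    IsDiscreteValuationRing (V.X.presheaf.stalk P.1) := by
  have hdim : ringKrullDim (V.X.presheaf.stalk P.1) = 1 := by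
    rw [ringKrullDim_stalk_eq_coheight, P.2]; rfl
  have hF : ¬ IsField (V.X.presheaf.stalk P.1) := by
    intro h
    have := ringKrullDim_eq_zero_of_isField h
    rw [hdim] at this
    exact one_ne_zero this
  have hle : Ring.KrullDimLE 1 (V.X.presheaf.stalk P.1) := krullDimLE_of_coheight_le P.2.le
  have hic := IsNormal.isIntegrallyClosed P.1
  have hmax : IsLocalRing.maximalIdeal (V.X.presheaf.stalk P.1) ≠ ⊥ :=
    fun h => hF (IsLocalRing.isField_iff_maximalIdeal_eq.mpr h)
  have h4 : IsIntegrallyClosed (V.X.presheaf.stalk P.1) ∧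
      ∃! Q : Ideal (V.X.presheaf.stalk P.1), Q ≠ ⊥ ∧ Q.IsPrime := by
    refine ⟨hic, IsLocalRing.maximalIdeal _, ⟨hmax, inferInstance⟩, ?_⟩
    rintro Q ⟨hQ, hQp⟩
    exact IsLocalRing.eq_maximalIdeal (Ring.krullDimLE_one_iff_of_isPrime_bot.mp hle Q hQ hQp)
  exact ((IsDiscreteValuationRing.TFAE _ hF).out 0 3).mpr h4

theorem ord_le_ord_smul {c : k} (hc : c ≠ 0) (f : V.K) (P : V.PrimeDivisor) :
    V.ord f P ≤ V.ord (c • f) P := by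
  have : Nonempty (⊤ : V.X.Opens) := ⟨⟨P.1, trivial⟩⟩
  have hc' : V.constants c ≠ 0 := by
    rwa [ne_eq, map_eq_zero]
  have h := Scheme.ord_le_smul (X := V.X) (x := P.1) (U := ⊤) trivial hc' f
  rw [Algebra.smul_def] at h
  rw [Algebra.smul_def]
  exact h

/-- The space `H⁰(V, 𝒪_V(⌊D⌋))` of all rational functions `f` with `f = 0` or
`div f + ⌊D⌋ ≥ 0`, on a normal variety. -/
def sections [V.IsNormal] (D : V.RDiv) : Submodule k V.K where
  carrier := {f | f = 0 ∨ ∀ P, 0 ≤ V.ord f P + ⌊D P⌋}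
  zero_mem' := Or.inl rfl
  add_mem' := by
    rintro f g (rfl | hf) (rfl | hg)
    · left; simp
    · right; simpa using hg
    · right; simpa using hf
    · by_cases h : f + g = 0
      · exact Or.inl h
      · right
        intro P
        have := V.isDiscreteValuationRing_stalk P
        have h1 := Scheme.ord_add (x := P.1) h
        have h2 := hf P
        have h3 := hg P
        simp only [ord] at h2 h3 ⊢
        rcases min_le_iff.mp h1 with h4 | h4 <;> linarith
  smul_mem' := by
    rintro c f (rfl | hf)
    · left; simp
    · by_cases hc : c = 0
      · left; simp [hc]
      right
      intro P
      have h1 := V.ord_le_ord_smul hc f P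
      have h2 := hf P
      linarith

/-- The volume of `D` on a variety of dimension `n`:
the upper limit of `n! h⁰(⌊mD⌋) / m^n` as `m → ∞`. -/
def vol [V.IsNormal] (n : ℕ) (D : V.RDiv) : EReal :=
  Filter.limsup (fun m : ℕ =>
    (((n.factorial : ℝ) * (Module.finrank k (V.sections ((m : ℝ) • D)) : ℝ) / (m : ℝ) ^ n : ℝ) :
      EReal)) Filter.atTop

/-! ### Canonical divisors -/

/-- `ds₁ ∧ ⋯ ∧ dsₙ` as a rational `n`-form. -/
def wedge {n : ℕ} (s : Fin n → V.K) : ⋀[V.K]^n (Ω[V.K⁄k]) :=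
  exteriorPower.ιMulti V.K n (fun i => KaehlerDifferential.D k V.K (s i))

/-- A nonzero rational `n`-form, written as `g dt₁ ∧ ⋯ ∧ dtₙ`. For `n = dim V` every nonzero
rational `n`-form can be so written, since the top exterior power is one-dimensional and the
differentials of functions span. -/
structure RationalForm (n : ℕ) where
  g : V.K
  t : Fin n → V.K
  ne_zero : g • V.wedge t ≠ 0

/-- The rational `n`-form `g dt₁ ∧ ⋯ ∧ dtₙ` has order `m` along the prime divisor `P`: it equals
`h ds₁ ∧ ⋯ ∧ dsₙ`, where `m = ord_P h` and `ds₁, …, dsₙ` is a basis of the module of differentials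
of the local ring at `P`. -/
def HasFormOrd {n : ℕ} (g : V.K) (t : Fin n → V.K) (P : V.PrimeDivisor) (m : ℤ) : Prop :=
  ∃ (s : Fin n → V.X.presheaf.stalk P.1) (h : V.K),
    LinearIndependent (V.X.presheaf.stalk P.1)
      (fun i => KaehlerDifferential.D k (V.X.presheaf.stalk P.1) (s i)) ∧
    Submodule.span (V.X.presheaf.stalk P.1)
      (Set.range fun i => KaehlerDifferential.D k (V.X.presheaf.stalk P.1) (s i)) = ⊤ ∧
    h ≠ 0 ∧
    g • V.wedge t = h • V.wedge (fun i => algebraMap (V.X.presheaf.stalk P.1) V.K (s i)) ∧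
    V.ord h P = m

/-- `C` is the divisor of the rational form `ω`. -/
def IsDivOfForm {n : ℕ} (ω : V.RationalForm n) (C : V.RDiv) : Prop :=
  ∀ P, ∃ m : ℤ, V.HasFormOrd ω.g ω.t P m ∧ C P = (m : ℝ)

/-- `(V, Δ)` is a log pair, where `dim V = n`: the coefficients of `Δ` lie in `[0, 1]` and
`K_V + Δ` is `ℝ`-Cartier. (The choice of the canonical divisor is immaterial, as any two differ by
a principal divisor.) -/
def IsLogPair (n : ℕ) (Δ : V.RDiv) : Prop :=
  (∀ P, 0 ≤ Δ P ∧ Δ P ≤ 1) ∧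
    ∃ (ω : V.RationalForm n) (C : V.RDiv), V.IsDivOfForm ω C ∧ V.IsRCartier (C + Δ)

/-! ### Discrepancies and klt singularities -/

/-- A prime divisor `E` over `V`: a prime divisor on a normal variety `Y` with a (not necessarily
proper) birational morphism `f : Y ⟶ V` over `k`. A morphism is birational if it sends the generic
point to the generic point and induces an isomorphism of the local rings there. -/
structure DivisorOver where
  Y : Variety k
  isNormal : Y.IsNormal
  f : Y.X ⟶ V.X
  comp_str : f ≫ V.str = Y.str
  map_genericPoint : f (genericPoint Y.X) = genericPoint V.X
  bijective : Function.Bijective (f.stalkMap (genericPoint Y.X)).hom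
  E : Y.PrimeDivisor

namespace DivisorOver

variable {V} (B : V.DivisorOver)

/-- The generic point of the center of `E` on `V`. -/
def centerPoint : V.X := B.f B.E.1

/-- Pullback of rational functions. -/
def pullback : V.K →+* B.Y.K :=
  (V.X.presheaf.stalkSpecializes (specializes_of_eq B.map_genericPoint) ≫
    B.f.stalkMap (genericPoint B.Y.X)).hom

/-- The coefficient of `E` in `f^* D` is `c`: near the center of `E` one has
`D = ∑ rᵢ div(hᵢ)` with real numbers `rᵢ`, and `c = ∑ rᵢ ord_E(f^* hᵢ)`. -/
def HasPullbackCoeff (D : V.RDiv) (c : ℝ) : Prop :=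
  ∃ (U : V.X.Opens) (N : ℕ) (r : Fin N → ℝ) (h : Fin N → V.K),
    B.centerPoint ∈ U ∧ (∀ i, h i ≠ 0) ∧
    (∀ P : V.PrimeDivisor, P.1 ∈ U → D P = ∑ i, r i * (V.ord (h i) P : ℝ)) ∧
    c = ∑ i, r i * (B.Y.ord (B.pullback (h i)) B.E : ℝ)

/-- `a` is the discrepancy `a(E, V, Δ)`, i.e. the coefficient of `E` in `K_Y - f^*(K_V + Δ)`, where
`K_V = div ω` and `K_Y = div f^*ω` for a nonzero rational form `ω` of degree `n = dim V`. -/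
def HasDiscrepancy (n : ℕ) (Δ : V.RDiv) (a : ℝ) : Prop :=
  ∃ (ω : V.RationalForm n) (C : V.RDiv) (m : ℤ) (c : ℝ),
    V.IsDivOfForm ω C ∧
    B.Y.HasFormOrd (B.pullback ω.g) (fun i => B.pullback (ω.t i)) B.E m ∧
    B.HasPullbackCoeff (C + Δ) c ∧
    a = m - c

end DivisorOver

/-- `(V, Δ)`, with `dim V = n` and `K_V + Δ` an `ℝ`-Cartier divisor, is klt at `x`: every prime
divisor `E` over `V` whose center contains `x` has discrepancy greater than `-1`. -/
def IsKltAt (n : ℕ) (Δ : V.RDiv) (x : V.X) : Prop :=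
  ∀ (B : V.DivisorOver) (a : ℝ), x ∈ closure {B.centerPoint} → B.HasDiscrepancy n Δ a → -1 < a

end Variety

end BirGeom

end

open BirGeom

open BirGeom

/-!
Let `t₁, …, tₙ` be coordinates at the smooth point `x` and let `v` be the valuation of the function
field given by the order of vanishing at `x`. It is the order along a prime divisor `E` over `X`,
visible on the chart `k[t₁, t₂ / t₁, …, tₙ / t₁]` of the blow-up of `x`, and the pullback of
`dt₁ ∧ ⋯ ∧ dtₙ` vanishes to order `n - 1` along `E`.

Vanishing to order greater than `M n` at `x` imposes at most `(n + M n choose n) ~ (M n) ^ n / n!`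
conditions, so since `vol D > n ^ n` some `⌊M D⌋` has a nonzero section `f` with this property.
Then `Π = D + M⁻¹ div f` is effective and its pullback has multiplicity greater than `n` along `E`.
As `Δ` is effective, the discrepancy of `E` with respect to `Δ` is at most `n - 1`, hence with
respect to `Δ + Π` it is less than `-1`.
-/

noncomputable section

namespace BirGeom

section RationalApproximation

variable {ι : Type*} [Fintype ι]

theorem exists_rat_mem_of_mem_nhds (r : ι → ℝ) {U : Set (ι → ℝ)} (hU : U ∈ nhds r) :
    ∃ q : ι → ℚ, (fun i => (q i : ℝ)) ∈ U ∧
      ∀ d : ι → ℤ, ∑ i, r i * (d i : ℝ) = 0 → ∑ i, q i * (d i : ℚ) = 0 := by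
  let L : Submodule ℚ ℝ := Submodule.span ℚ (Set.range r)
  have : Module.Finite ℚ L := Module.Finite.span_of_finite ℚ (Set.finite_range r)
  let b := Module.finBasis ℚ L
  let ρ : ι → L := fun i => ⟨r i, Submodule.subset_span ⟨i, rfl⟩⟩
  -- Real points near `r`, parametrized by the images of the basis `b`: those with rational
  -- parameters are rational and satisfy the rational relations between the `r i`.
  let F : (Fin (Module.finrank ℚ L) → ℝ) → ι → ℝ := fun γ i => ∑ j, (b.repr (ρ i) j : ℝ) * γ j
  have hF : Continuous F := by fun_prop
  have hFb : F (fun j => b j) = r := by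
    funext i
    have := congrArg L.subtype (b.sum_repr (ρ i))
    simpa only [map_sum, map_smul, Rat.smul_def, Submodule.subtype_apply] using this
  have hdense : DenseRange (fun (p : Fin (Module.finrank ℚ L) → ℚ) j => (p j : ℝ)) :=
    DenseRange.piMap fun _ => Rat.denseRange_cast
  obtain ⟨p, hp⟩ := hdense.exists_mem_open isOpen_interior
    ⟨_, mem_interior_iff_mem_nhds.mpr (hF.continuousAt.preimage_mem_nhds (hFb.symm ▸ hU))⟩
  refine ⟨fun i => b.constr ℚ p (ρ i), ?_, fun d hd => ?_⟩
  · have := interior_subset hp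
    simpa [F, Module.Basis.constr_apply_fintype] using this
  · have hρ : ∑ i, (d i : ℚ) • ρ i = 0 := by
      apply Subtype.ext
      simpa [ρ, Rat.smul_def, mul_comm] using hd
    simpa [mul_comm] using congrArg (b.constr ℚ p) hρ

variable {S : Type*} (a : S → ι → ℤ) (w : ι → ℤ)

theorem sum_mul_nonneg_of_forall_int_of_rat
    (H : ∀ q : ι → ℤ, (∀ s, 0 ≤ ∑ i, q i * a s i) → 0 ≤ ∑ i, q i * w i)
    (q : ι → ℚ) (hq : ∀ s, 0 ≤ ∑ i, q i * (a s i : ℚ)) : 0 ≤ ∑ i, q i * (w i : ℚ) := by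
  have hdvd : ∀ i, (q i).den ∣ ∏ j, (q j).den := fun i =>
    Finset.dvd_prod_of_mem _ (Finset.mem_univ i)
  choose e he using hdvd
  set N := ∏ j, (q j).den
  have hN : (0 : ℚ) < N := by
    exact_mod_cast Finset.prod_pos fun j _ => (q j).den_pos
  have hz (i : ι) : (((q i).num * e i : ℤ) : ℚ) = N * q i := by
    rw [he i]
    push_cast
    rw [← Rat.mul_den_eq_num]
    ring
  have hsum (d : ι → ℤ) : ((∑ i, (q i).num * e i * d i : ℤ) : ℚ) = N * ∑ i, q i * (d i : ℚ) := by
    rw [Int.cast_sum, Finset.mul_sum]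
    exact Finset.sum_congr rfl fun i _ => by rw [Int.cast_mul, hz, mul_assoc]
  have hw := H (fun i => (q i).num * e i) fun s => by
    have := mul_nonneg hN.le (hq s)
    rw [← hsum] at this
    exact_mod_cast this
  have : (0 : ℚ) ≤ N * ∑ i, q i * (w i : ℚ) := by
    rw [← hsum]
    exact_mod_cast hw
  exact nonneg_of_mul_nonneg_right this hN

theorem sum_mul_nonneg_of_forall_int [Finite S]
    (H : ∀ q : ι → ℤ, (∀ s, 0 ≤ ∑ i, q i * a s i) → 0 ≤ ∑ i, q i * w i)
    (r : ι → ℝ) (hr : ∀ s, 0 ≤ ∑ i, r i * (a s i : ℝ)) : 0 ≤ ∑ i, r i * (w i : ℝ) := by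
  by_contra! hneg
  have hcont (d : ι → ℤ) : Continuous fun γ : ι → ℝ => ∑ i, γ i * (d i : ℝ) := by fun_prop
  have hU : {γ | ∑ i, γ i * (w i : ℝ) < 0} ∩
      ⋂ s, {γ | ∑ i, r i * (a s i : ℝ) = 0 ∨ 0 < ∑ i, γ i * (a s i : ℝ)} ∈ nhds r := by
    refine Filter.inter_mem ((isOpen_lt (hcont w) continuous_const).mem_nhds hneg)
      (Filter.iInter_mem.mpr fun s => ?_)
    rcases (hr s).eq_or_lt with h | h
    · exact Filter.univ_mem' fun γ => Or.inl h.symm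
    · exact Filter.mem_of_superset ((isOpen_lt continuous_const (hcont (a s))).mem_nhds h)
        fun γ hγ => Or.inr hγ
  obtain ⟨q, ⟨hqw, hqa⟩, hrel⟩ := exists_rat_mem_of_mem_nhds r hU
  have hw := sum_mul_nonneg_of_forall_int_of_rat a w H q fun s => by
    rcases Set.mem_iInter.mp hqa s with h | h
    · exact (hrel _ h).ge
    · beta_reduce at h
      exact_mod_cast h.le
  have hqw' : ∑ i, (q i : ℝ) * (w i : ℝ) < 0 := hqw
  exact hqw'.not_ge (by exact_mod_cast hw)

end RationalApproximation

section HeightOne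

variable {A K : Type*} [CommRing A] [IsDomain A] [IsNoetherianRing A] [Field K] [Algebra A K]
  [IsFractionRing A K]

open IsLocalization (IsInteger)

theorem height_eq_one_of_mem_iff_isInteger_smul {p : Ideal A} [p.IsPrime] {z : K}
    (hp : ∀ s, s ∈ p ↔ IsInteger A (s • z)) (hz : ¬ IsIntegral A z) : p.height = 1 := by
  have hp0 : p ≠ ⊥ := by
    obtain ⟨⟨b, hb⟩, hbz⟩ := IsLocalization.exists_integer_multiple (nonZeroDivisors A) z
    exact fun h => nonZeroDivisors.ne_zero hb (by simpa [h] using (hp b).mpr hbz)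
  obtain ⟨q, hq, c, hc, hcp⟩ : ∃ q ∈ p, ∃ c, algebraMap A K c = q • z ∧ c ∉ p := by
    -- Otherwise `z` maps the finitely generated faithful module `p` into itself.
    by_contra! h
    refine hz (isIntegral_of_smul_mem_submodule (Submodule.map (Algebra.linearMap A K) p) ?_
      ((IsNoetherian.noetherian p).map _) z ?_)
    · rwa [Ne, (Submodule.map_injective_of_injective (f := Algebra.linearMap A K)
        (IsFractionRing.injective A K)).eq_iff' (Submodule.map_bot _)]
    · rintro _ ⟨q, hq, rfl⟩
      obtain ⟨c, hc⟩ := (hp q).mp hq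
      exact ⟨c, h q hq c hc, by
        rw [Algebra.linearMap_apply, hc, Algebra.smul_def, Algebra.linearMap_apply, smul_eq_mul,
          mul_comm]⟩
  have hmin : p ∈ (Ideal.span {q}).minimalPrimes := by
    refine ⟨⟨inferInstance, by rwa [Ideal.span_singleton_le_iff_mem]⟩, ?_⟩
    rintro p' ⟨hp', hqp'⟩ hle b hb
    obtain ⟨e, he⟩ := (hp b).mp hb
    have : c * b = q * e := IsFractionRing.injective A K <| by
      rw [map_mul, map_mul, hc, he, Algebra.smul_def, Algebra.smul_def]
      ring
    have hcb : c * b ∈ p' :=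
      this ▸ p'.mul_mem_right _ ((Ideal.span_singleton_le_iff_mem _).mp hqp')
    exact (hp'.mem_or_mem hcb).resolve_left fun h => hcp (hle h)
  refine le_antisymm (Ideal.height_le_one_of_isPrincipal_of_mem_minimalPrimes _ _ hmin)
    (Order.one_le_iff_pos.mpr (pos_iff_ne_zero.mpr ?_))
  rwa [Ne, Ideal.height_eq_zero_iff_eq_bot]

theorem exists_isInteger_smul_of_forall_height_eq_one (m : Ideal A) [m.IsPrime]
    (hm : ∀ z : K, IsIntegral A z → ∃ s ∉ m, IsInteger A (s • z)) (y : K)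
    (hy : ∀ p : Ideal A, p.IsPrime → p ≤ m → p.height = 1 → ∃ s ∉ p, IsInteger A (s • y)) :
    ∃ s ∉ m, IsInteger A (s • y) := by
  have hcolon (s : A) (z : K) : s ∈ (1 : Submodule A K).colon {z} ↔ IsInteger A (s • z) := by
    rw [Submodule.mem_colon_singleton, Submodule.mem_one]
    rfl
  by_contra! hcon
  have hle : (1 : Submodule A K).colon {y} ≤ m := fun s hs => by
    by_contra hsm
    exact hcon s hsm ((hcolon s y).mp hs)
  obtain ⟨p, hp, hpm⟩ := Ideal.exists_minimalPrimes_le hle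
  have : p.IsPrime := hp.1.1
  obtain ⟨z, rfl⟩ := Submodule.exists_eq_colon_of_mem_minimalPrimes hp
  have hz : ¬ IsIntegral A z := fun hz => by
    obtain ⟨s, hs, hsz⟩ := hm z hz
    exact hs (hpm ((hcolon s z).mpr hsz))
  obtain ⟨s, hs, hsy⟩ := hy _ this hpm
    (height_eq_one_of_mem_iff_isInteger_smul (hcolon · z) hz)
  exact hs (hp.1.2 ((hcolon s y).mpr hsy))

end HeightOne

/-! ### Coordinates of smooth local rings -/

section Residue

open IsLocalRing

variable {k O : Type*} [Field k] [CommRing O] [IsLocalRing O] [Algebra k O]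

/-- The value at the closed point of the elements of a local `k`-algebra with residue field `k`. -/
def residueAlgHom (hk : Function.Surjective (algebraMap k (ResidueField O))) : O →ₐ[k] k :=
  (AlgEquiv.ofBijective (Algebra.ofId k (ResidueField O))
      ⟨(algebraMap k (ResidueField O)).injective, hk⟩).symm.toAlgHom.comp
    (IsScalarTower.toAlgHom k O (ResidueField O))

variable (hk : Function.Surjective (algebraMap k (ResidueField O)))

theorem residueAlgHom_eq_zero_iff {a : O} : residueAlgHom hk a = 0 ↔ a ∈ maximalIdeal O := by
  rw [← residue_eq_zero_iff, residueAlgHom, AlgHom.comp_apply]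
  exact map_eq_zero_iff _ (AlgEquiv.injective _)

theorem sub_algebraMap_residueAlgHom_mem_maximalIdeal (a : O) :
    a - algebraMap k O (residueAlgHom hk a) ∈ maximalIdeal O := by
  rw [← residueAlgHom_eq_zero_iff hk, map_sub, AlgHom.commutes, Algebra.algebraMap_self_apply,
    sub_self]

end Residue

section SquareZero

variable {k A B ι : Type*} [CommRing k] [CommRing A] [Algebra k A] [CommRing B] [Algebra k B]

theorem algHom_eq_of_span_D {t : ι → A}
    (ht : Submodule.span A (Set.range fun i => KaehlerDifferential.D k A (t i)) = ⊤)
    {I : Ideal B} (hI : I ^ 2 = ⊥) {f g : A →ₐ[k] B} (hfg : ∀ a, f a - g a ∈ I)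
    (hfgt : ∀ i, f (t i) = g (t i)) : f = g := by
  let _ : Algebra A B := g.toRingHom.toAlgebra
  have : IsScalarTower k A B := .of_algebraMap_eq fun c => (g.commutes c).symm
  let δ : Derivation k A I := derivationToSquareZeroOfLift I hI f <| by
    ext a
    exact Ideal.Quotient.eq.mpr (hfg a)
  have hδ (a : A) : (δ a : B) = f a - g a := derivationToSquareZeroOfLift_apply I hI f _ a
  have hδ0 : δ.liftKaehlerDifferential = 0 := LinearMap.ext_on_range ht fun i => by
    rw [Derivation.liftKaehlerDifferential_comp_D, LinearMap.zero_apply]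
    exact Subtype.ext ((hδ _).trans (sub_eq_zero.mpr (hfgt i)))
  ext a
  rw [← sub_eq_zero, ← hδ, ← Derivation.liftKaehlerDifferential_comp_D, hδ0]
  rfl

theorem exists_algHom_apply_eq_add {t : ι → A}
    (hli : LinearIndependent A (fun i => KaehlerDifferential.D k A (t i)))
    (hspan : Submodule.span A (Set.range fun i => KaehlerDifferential.D k A (t i)) = ⊤)
    {I : Ideal B} (hI : I ^ 2 = ⊥) (g : A →ₐ[k] B) (z : ι → I) :
    ∃ f : A →ₐ[k] B, ∀ i, f (t i) = z i + g (t i) := by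
  let _ : Algebra A B := g.toRingHom.toAlgebra
  have : IsScalarTower k A B := .of_algebraMap_eq fun c => (g.commutes c).symm
  let b := Module.Basis.mk hli hspan.ge
  let δ : Derivation k A I := (b.constr A z).compDer (KaehlerDifferential.D k A)
  have hδ (i : ι) : δ (t i) = z i := by
    rw [← b.constr_basis A z i, Module.Basis.mk_apply]
    rfl
  exact ⟨liftOfDerivationToSquareZero I hI δ, fun i => by rw [← hδ]; rfl⟩

end SquareZero

section Coordinates

open IsLocalRing MvPolynomial

variable {k O ι : Type*} [Field k] [CommRing O] [IsLocalRing O] [Algebra k O]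

theorem span_eq_maximalIdeal_of_span_D [IsNoetherianRing O] {t : ι → O}
    (hk : Function.Surjective (algebraMap k (ResidueField O))) (ht : ∀ i, t i ∈ maximalIdeal O)
    (hspan : Submodule.span O (Set.range fun i => KaehlerDifferential.D k O (t i)) = ⊤) :
    Ideal.span (Set.range t) = maximalIdeal O := by
  set m := maximalIdeal O
  set N := Ideal.span (Set.range t)
  -- The quotient map modulo `N + m²` and the evaluation at the closed point agree on `t`.
  set J : Ideal O := N ⊔ m ^ 2
  have hI : (m.map (Ideal.Quotient.mk J)) ^ 2 = ⊥ := by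
    rw [← Ideal.map_pow, Ideal.map_mk_eq_bot_of_le le_sup_right]
  have heq : Ideal.Quotient.mkₐ k J = (Algebra.ofId k (O ⧸ J)).comp (residueAlgHom hk) := by
    refine algHom_eq_of_span_D hspan hI (fun a => ?_) fun i => ?_
    · exact Ideal.mem_map_of_mem _ (sub_algebraMap_residueAlgHom_mem_maximalIdeal hk a)
    · rw [AlgHom.comp_apply, (residueAlgHom_eq_zero_iff hk).mpr (ht i), map_zero]
      exact Ideal.Quotient.eq_zero_iff_mem.mpr (Ideal.mem_sup_left (Ideal.subset_span ⟨i, rfl⟩))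
  have hmJ : m ≤ J := fun a ha => by
    rw [← Ideal.Quotient.eq_zero_iff_mem]
    calc Ideal.Quotient.mk J a = Algebra.ofId k (O ⧸ J) (residueAlgHom hk a) :=
          DFunLike.congr_fun heq a
      _ = 0 := by rw [(residueAlgHom_eq_zero_iff hk).mpr ha, map_zero]
  refine le_antisymm (Ideal.span_le.mpr (Set.range_subset_iff.mpr ht)) ?_
  refine Submodule.le_of_le_smul_of_le_jacobson_bot (I := m) (IsNoetherian.noetherian m)
    (IsLocalRing.jacobson_eq_maximalIdeal ⊥ bot_ne_top).ge ?_
  rwa [smul_eq_mul, ← pow_two]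

variable (k) in
/-- A coordinate system of a local `k`-algebra with residue field `k` (the local ring of a
`k`-rational point): generators of the maximal ideal whose differentials are a basis of the module
of Kähler differentials. -/
structure IsCoordinateSystem (t : ι → O) : Prop where
  residue_surjective : Function.Surjective (algebraMap k (ResidueField O))
  span_eq : Ideal.span (Set.range t) = maximalIdeal O
  linearIndependent_D : LinearIndependent O fun i => KaehlerDifferential.D k O (t i)
  span_D : Submodule.span O (Set.range fun i => KaehlerDifferential.D k O (t i)) = ⊤

theorem exists_isCoordinateSystem [IsNoetherianRing O] [Algebra.FormallySmooth k O]
    [Algebra.EssFiniteType k O] (hk : Function.Surjective (algebraMap k (ResidueField O))) :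
    ∃ (d : ℕ) (t : Fin d → O), IsCoordinateSystem k t := by
  have hspan : Submodule.span O (Set.range fun a : maximalIdeal O =>
      KaehlerDifferential.D k O (a : O)) = ⊤ := by
    rw [eq_top_iff, ← KaehlerDifferential.span_range_derivation, Submodule.span_le]
    rintro _ ⟨a, rfl⟩
    exact Submodule.subset_span
      ⟨⟨_, sub_algebraMap_residueAlgHom_mem_maximalIdeal hk a⟩, by simp⟩
  have : Module.FinitePresentation O (Ω[O⁄k]) := Module.finitePresentation_of_projective O _
  obtain ⟨κ, a, b, hb⟩ := Module.exists_basis_of_span_of_flat _ hspan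
  have : Finite κ := Module.Finite.finite_basis b
  obtain ⟨d, ⟨e⟩⟩ := Finite.exists_equiv_fin κ
  have hbe : ⇑(b.reindex e) = fun i => KaehlerDifferential.D k O (a (e.symm i) : O) := by
    ext i
    simp [hb]
  have hspan' := (b.reindex e).span_eq
  have hli := (b.reindex e).linearIndependent
  rw [hbe] at hspan' hli
  exact ⟨d, fun i => a (e.symm i), hk,
    span_eq_maximalIdeal_of_span_D hk (fun i => (a (e.symm i)).2) hspan', hli, hspan'⟩

theorem exists_isHomogeneous_aeval_sub_mem_pow [Finite ι] {t : ι → O}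
    (hk : Function.Surjective (algebraMap k (ResidueField O)))
    (ht : Ideal.span (Set.range t) = maximalIdeal O) {r : ℕ} {a : O}
    (ha : a ∈ maximalIdeal O ^ r) :
    ∃ G : MvPolynomial ι k, G.IsHomogeneous r ∧ a - aeval t G ∈ maximalIdeal O ^ (r + 1) := by
  have := Fintype.ofFinite ι
  induction r generalizing a with
  | zero =>
    exact ⟨C (residueAlgHom hk a), isHomogeneous_C _ _, by
      simpa using sub_algebraMap_residueAlgHom_mem_maximalIdeal hk a⟩
  | succ r ih =>
    rw [pow_succ'] at ha
    induction ha using Submodule.mul_induction_on' with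
    | mem_mul_mem x hx y hy =>
      rw [← ht] at hx
      obtain ⟨b, rfl⟩ := (Submodule.mem_span_range_iff_exists_fun O).mp hx
      choose G hG hbG using fun i => ih (Ideal.mul_mem_left _ (b i) hy)
      refine ⟨∑ i, X i * G i, IsHomogeneous.sum _ _ _ fun i _ => ?_, ?_⟩
      · exact add_comm r 1 ▸ (isHomogeneous_X _ _).mul (hG i)
      · have : (∑ i, b i • t i) * y - aeval t (∑ i, X i * G i) =
            ∑ i, t i * (b i * y - aeval t (G i)) := by
          simp only [map_sum, map_mul, aeval_X, Finset.sum_mul, ← Finset.sum_sub_distrib,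
            smul_eq_mul]
          exact Finset.sum_congr rfl fun i _ => by ring
        rw [this, pow_succ' _ (r + 1)]
        exact Ideal.sum_mem _ fun i _ =>
          Ideal.mul_mem_mul (ht ▸ Ideal.subset_span ⟨i, rfl⟩) (hbG i)
    | add x _ y _ hx hy =>
      obtain ⟨F, hF, hxF⟩ := hx
      obtain ⟨G, hG, hyG⟩ := hy
      exact ⟨F + G, hF.add hG, by
        rw [map_add, add_sub_add_comm]
        exact Ideal.add_mem _ hxF hyG⟩

theorem map_sub_map_mem_pow_succ {A B : Type*} [CommRing A] [CommRing B] {f g : A →+* B}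
    {J : Ideal A} {I : Ideal B} (hf : J.map f ≤ I) (hg : J.map g ≤ I) (hfg : ∀ a, f a - g a ∈ I)
    (hfgJ : ∀ a ∈ J, f a - g a ∈ I ^ 2) {e : ℕ} {a : A} (ha : a ∈ J ^ e) :
    f a - g a ∈ I ^ (e + 1) := by
  induction e generalizing a with
  | zero => simpa using hfg a
  | succ e ih =>
    rw [pow_succ'] at ha
    induction ha using Submodule.mul_induction_on' with
    | mem_mul_mem x hx y hy =>
      have hgy : g y ∈ I ^ e :=
        Ideal.pow_right_mono hg e (Ideal.map_pow g J e ▸ Ideal.mem_map_of_mem g hy)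
      have : f (x * y) - g (x * y) = f x * (f y - g y) + (f x - g x) * g y := by
        rw [map_mul, map_mul]
        ring
      rw [this]
      refine Ideal.add_mem _ ?_ ?_
      · exact pow_succ' I (e + 1) ▸ Ideal.mul_mem_mul (hf (Ideal.mem_map_of_mem f hx)) (ih hy)
      · rw [show e + 1 + 1 = 2 + e by ring, pow_add]
        exact Ideal.mul_mem_mul (hfgJ x hx) hgy
    | add x _ y _ hx hy =>
      rw [map_add, map_add, add_sub_add_comm]
      exact Ideal.add_mem _ hx hy

theorem algHom_sub_mem_pow_succ_of_mem_pow_idealOfVars {σ B : Type*} [CommRing B] [Algebra k B]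
    {I : Ideal B} {f g : MvPolynomial σ k →ₐ[k] B} (hf : ∀ i, f (X i) ∈ I)
    (hfg : ∀ i, f (X i) - g (X i) ∈ I ^ 2) {e : ℕ} {p : MvPolynomial σ k}
    (hp : p ∈ idealOfVars σ k ^ e) : f p - g p ∈ I ^ (e + 1) := by
  have hfI : (idealOfVars σ k).map (f : MvPolynomial σ k →+* B) ≤ I := by
    rw [Ideal.map_span, Ideal.span_le]
    rintro _ ⟨_, ⟨i, rfl⟩, rfl⟩
    exact hf i
  have hgI : (idealOfVars σ k).map (g : MvPolynomial σ k →+* B) ≤ I := by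
    rw [Ideal.map_span, Ideal.span_le]
    rintro _ ⟨_, ⟨i, rfl⟩, rfl⟩
    simpa using I.sub_mem (hf i) (Ideal.pow_le_self two_ne_zero (hfg i))
  have hmod (q : MvPolynomial σ k) : f q - g q ∈ I := by
    have : (Ideal.Quotient.mkₐ k I).comp f = (Ideal.Quotient.mkₐ k I).comp g :=
      algHom_ext fun i => Ideal.Quotient.eq.mpr (Ideal.pow_le_self two_ne_zero (hfg i))
    exact Ideal.Quotient.eq.mp (DFunLike.congr_fun this q)
  refine map_sub_map_mem_pow_succ hfI hgI hmod (fun q hq => ?_) hp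
  induction hq using Submodule.span_induction with
  | mem _ hx =>
    obtain ⟨i, rfl⟩ := hx
    exact hfg i
  | zero => simp
  | add x y _ _ hx hy =>
    rw [map_add, map_add, add_sub_add_comm]
    exact Ideal.add_mem _ hx hy
  | smul q x hx hx' =>
    have : f (q • x) - g (q • x) = g q * (f x - g x) + (f q - g q) * f x := by
      rw [smul_eq_mul, map_mul, map_mul]
      ring
    have hfx : f x ∈ I := hfI (Ideal.mem_map_of_mem _ hx)
    exact this ▸ Ideal.add_mem _ (Ideal.mul_mem_left _ _ hx')
      (pow_two I ▸ Ideal.mul_mem_mul (hmod q) hfx)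

namespace IsCoordinateSystem

variable {t : ι → O} (ht : IsCoordinateSystem k t)

include ht

theorem mem_maximalIdeal (i : ι) : t i ∈ maximalIdeal O :=
  ht.span_eq ▸ Ideal.subset_span ⟨i, rfl⟩

/-- The formally smooth algebra `O` maps to every truncation of the polynomial ring in the
coordinates; `t i` goes to a perturbation of `X i`. -/
theorem exists_algHom_quotient_idealOfVars [Algebra.FormallySmooth k O] (e : ℕ) :
    ∃ ψ : O →ₐ[k] MvPolynomial ι k ⧸ idealOfVars ι k ^ (e + 2), ∀ i,
      Ideal.Quotient.mk _ (X i) - ψ (t i) ∈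
        ((idealOfVars ι k).map (Ideal.Quotient.mk (idealOfVars ι k ^ (e + 2)))) ^ 2 := by
  set I := idealOfVars ι k
  have hI : (I.map (Ideal.Quotient.mk (I ^ 2))) ^ 2 = ⊥ := by
    rw [← Ideal.map_pow, Ideal.map_quotient_self]
  obtain ⟨ψ, hψ⟩ := exists_algHom_apply_eq_add ht.linearIndependent_D ht.span_D hI
    ((Algebra.ofId k _).comp (residueAlgHom ht.residue_surjective))
    fun i => ⟨Ideal.Quotient.mk _ (X i), Ideal.mem_map_of_mem _ (Ideal.subset_span ⟨i, rfl⟩)⟩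
  have hle : I ^ (e + 2) ≤ I ^ 2 := Ideal.pow_le_pow_right (Nat.le_add_left 2 e)
  let π := Ideal.Quotient.factorₐ k hle
  have hπker : RingHom.ker (π : MvPolynomial ι k ⧸ I ^ (e + 2) →+* MvPolynomial ι k ⧸ I ^ 2) =
      (I.map (Ideal.Quotient.mk (I ^ (e + 2)))) ^ 2 := by
    rw [← Ideal.map_pow]
    exact Ideal.Quotient.factor_ker hle
  have hπ : IsNilpotent
      (RingHom.ker (π : MvPolynomial ι k ⧸ I ^ (e + 2) →+* MvPolynomial ι k ⧸ I ^ 2)) := by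
    refine ⟨e + 2, ?_⟩
    rw [hπker, ← Ideal.map_pow, ← Ideal.map_pow, ← pow_mul, mul_comm, pow_mul]
    exact Ideal.map_mk_eq_bot_of_le (Ideal.pow_le_self two_ne_zero)
  refine ⟨Algebra.FormallySmooth.liftOfSurjective ψ π (Ideal.Quotient.factor_surjective hle) hπ,
    fun i => ?_⟩
  rw [← hπker, RingHom.mem_ker, map_sub, sub_eq_zero]
  refine Eq.trans ?_ (Algebra.FormallySmooth.liftOfSurjective_apply ψ π
    (Ideal.Quotient.factor_surjective hle) hπ (t i)).symm
  rw [hψ, AlgHom.comp_apply, (residueAlgHom_eq_zero_iff _).mpr (ht.mem_maximalIdeal i), map_zero,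
    add_zero]
  rfl

theorem eq_zero_of_aeval_mem_pow [Algebra.FormallySmooth k O] {e : ℕ} {F : MvPolynomial ι k}
    (hF : F.IsHomogeneous e) (hFt : aeval t F ∈ maximalIdeal O ^ (e + 1)) : F = 0 := by
  let I := idealOfVars ι k
  let mk := Ideal.Quotient.mkₐ k (I ^ (e + 2))
  obtain ⟨ψ, hψ⟩ : ∃ ψ : O →ₐ[k] MvPolynomial ι k ⧸ I ^ (e + 2),
      ∀ i, mk (X i) - ψ (t i) ∈ I.map mk ^ 2 := ht.exists_algHom_quotient_idealOfVars e
  have hX (i : ι) : mk (X i) ∈ I.map mk := Ideal.mem_map_of_mem _ (Ideal.subset_span ⟨i, rfl⟩)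
  have hψm : (maximalIdeal O).map ψ ≤ I.map mk := by
    rw [← ht.span_eq, Ideal.map_span, Ideal.span_le]
    rintro _ ⟨_, ⟨i, rfl⟩, rfl⟩
    simpa using Ideal.sub_mem _ (hX i) (Ideal.pow_le_self two_ne_zero (hψ i))
  have hFI : F ∈ I ^ e := (mem_pow_idealOfVars_iff' e F).mpr fun d hd => hF.coeff_eq_zero hd.ne
  have hψF : ψ (aeval t F) ∈ I.map mk ^ (e + 1) :=
    Ideal.pow_right_mono hψm _ (Ideal.map_pow ψ _ (e + 1) ▸ Ideal.mem_map_of_mem ψ hFt)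
  have hsub : mk F - ψ (aeval t F) ∈ I.map mk ^ (e + 1) :=
    algHom_sub_mem_pow_succ_of_mem_pow_idealOfVars (f := mk) (g := ψ.comp (aeval t)) hX
      (fun i => by simpa using hψ i) hFI
  have hFI' : F ∈ I ^ (e + 1) := by
    have hmkF : mk F ∈ (I ^ (e + 1)).map mk := by
      rw [Ideal.map_pow]
      simpa using Ideal.add_mem _ hsub hψF
    exact (Ideal.comap_map_mk (Ideal.pow_le_pow_right (Nat.le_succ (e + 1)))).le hmkF
  ext d
  by_cases hd : d.degree = e
  · exact (mem_pow_idealOfVars_iff' (e + 1) F).mp hFI' d (by lia)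
  · exact hF.coeff_eq_zero hd

theorem mul_notMem_pow [Finite ι] [Algebra.FormallySmooth k O] {r s : ℕ} {a b : O}
    (ha : a ∈ maximalIdeal O ^ r) (ha' : a ∉ maximalIdeal O ^ (r + 1))
    (hb : b ∈ maximalIdeal O ^ s) (hb' : b ∉ maximalIdeal O ^ (s + 1)) :
    a * b ∉ maximalIdeal O ^ (r + s + 1) := by
  intro hab
  obtain ⟨F, hF, haF⟩ :=
    exists_isHomogeneous_aeval_sub_mem_pow ht.residue_surjective ht.span_eq ha
  obtain ⟨G, hG, hbG⟩ :=
    exists_isHomogeneous_aeval_sub_mem_pow ht.residue_surjective ht.span_eq hb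
  have hF0 : F ≠ 0 := by rintro rfl; exact ha' (by simpa using haF)
  have hG0 : G ≠ 0 := by rintro rfl; exact hb' (by simpa using hbG)
  refine mul_ne_zero hF0 hG0 (ht.eq_zero_of_aeval_mem_pow (hF.mul hG) ?_)
  have hFr : aeval t F ∈ maximalIdeal O ^ r := by
    simpa using Ideal.sub_mem _ ha (Ideal.pow_le_pow_right (Nat.le_succ r) haF)
  have hleft : (a - aeval t F) * b ∈ maximalIdeal O ^ (r + s + 1) := by
    rw [show r + s + 1 = r + 1 + s by ring, pow_add]
    exact Ideal.mul_mem_mul haF hb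
  have hright : aeval t F * (b - aeval t G) ∈ maximalIdeal O ^ (r + s + 1) := by
    rw [add_assoc, pow_add]
    exact Ideal.mul_mem_mul hFr hbG
  have hsum : aeval t (F * G) =
      a * b - ((a - aeval t F) * b + aeval t F * (b - aeval t G)) := by
    rw [map_mul]
    ring
  exact hsum ▸ Ideal.sub_mem _ hab (Ideal.add_mem _ hleft hright)

end IsCoordinateSystem

end Coordinates

section Jets

open IsLocalRing MvPolynomial

theorem card_degree_le_le_choose (ι : Type*) [Fintype ι] (r : ℕ) :
    Nat.card {d : ι →₀ ℕ | d.degree ≤ r} ≤ (Fintype.card ι + r).choose r := by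
  classical
  -- Homogenize: the complement `r - d.degree` becomes the exponent of an additional variable.
  let f (d : {d : ι →₀ ℕ | d.degree ≤ r}) : {P : Option ι → ℕ // ∑ i, P i = r} :=
    ⟨fun o => o.elim (r - d.1.degree) d.1, by
      simpa [Fintype.sum_option, ← Finsupp.degree_eq_sum] using Nat.sub_add_cancel d.2⟩
  have hf : Function.Injective f := fun d d' h =>
    Subtype.ext <| Finsupp.ext fun i => congrFun (congrArg Subtype.val h) (some i)
  refine (Nat.card_le_card_of_injective _
    ((Sym.equivNatSumOfFintype (Option ι) r).symm.injective.comp hf)).trans_eq ?_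
  rw [Nat.card_eq_fintype_card, Sym.card_sym_eq_choose, Fintype.card_option, Nat.add_right_comm,
    Nat.add_sub_cancel]

variable {k O ι : Type*} [Field k] [CommRing O] [IsLocalRing O] [Algebra k O]
  {t : ι → O} (hk : Function.Surjective (algebraMap k (ResidueField O)))
  (ht : Ideal.span (Set.range t) = maximalIdeal O)

include hk ht

theorem exists_totalDegree_le_aeval_sub_mem_pow [Finite ι] (a : O) (r : ℕ) :
    ∃ G : MvPolynomial ι k, G.totalDegree ≤ r ∧ a - aeval t G ∈ maximalIdeal O ^ (r + 1) := by
  induction r with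
  | zero =>
    obtain ⟨G, hG, haG⟩ := exists_isHomogeneous_aeval_sub_mem_pow hk ht (r := 0) (a := a) (by simp)
    exact ⟨G, hG.totalDegree_le, haG⟩
  | succ r ih =>
    obtain ⟨G, hG, haG⟩ := ih
    obtain ⟨H, hH, haH⟩ := exists_isHomogeneous_aeval_sub_mem_pow hk ht haG
    refine ⟨G + H, (totalDegree_add G H).trans (max_le (by lia) hH.totalDegree_le), ?_⟩
    rwa [map_add, ← sub_sub]

variable [Fintype ι]

theorem finite_and_finrank_quotient_maximalIdeal_pow_le (r : ℕ) :
    Module.Finite k (O ⧸ maximalIdeal O ^ (r + 1)) ∧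
      Module.finrank k (O ⧸ maximalIdeal O ^ (r + 1)) ≤ (Fintype.card ι + r).choose r := by
  let π : restrictSupport k {d : ι →₀ ℕ | d.degree ≤ r} →ₗ[k] O ⧸ maximalIdeal O ^ (r + 1) :=
    (Ideal.Quotient.mkₐ k _).toLinearMap ∘ₗ (aeval t).toLinearMap ∘ₗ Submodule.subtype _
  have hπ : Function.Surjective π := fun q => by
    obtain ⟨a, rfl⟩ := Ideal.Quotient.mk_surjective q
    obtain ⟨G, hG, haG⟩ := exists_totalDegree_le_aeval_sub_mem_pow hk ht a r
    exact ⟨⟨G, (mem_restrictTotalDegree ι r G).mpr hG⟩, (Ideal.Quotient.eq.mpr haG).symm⟩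
  have : Finite {d : ι →₀ ℕ | d.degree ≤ r} := Finsupp.finite_of_degree_le r
  have := Module.Finite.of_basis (basisRestrictSupport k {d : ι →₀ ℕ | d.degree ≤ r})
  refine ⟨Module.Finite.of_surjective π hπ,
    (LinearMap.finrank_le_finrank_of_surjective hπ).trans ?_⟩
  rw [Module.finrank_eq_nat_card_basis (basisRestrictSupport k {d : ι →₀ ℕ | d.degree ≤ r})]
  exact card_degree_le_le_choose ι r

theorem exists_ne_zero_mem_maximalIdeal_pow {S : Type*} [AddCommGroup S] [Module k S]
    (φ : S →ₗ[k] O) {r : ℕ} (hS : (Fintype.card ι + r).choose r < Module.finrank k S) :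
    ∃ s ≠ 0, φ s ∈ maximalIdeal O ^ (r + 1) := by
  obtain ⟨_, hfinrank⟩ := finite_and_finrank_quotient_maximalIdeal_pow_le hk ht r
  have : Module.Finite k S := Module.finite_of_finrank_pos (Nat.zero_lt_of_lt hS)
  let ψ := (Ideal.Quotient.mkₐ k (maximalIdeal O ^ (r + 1))).toLinearMap ∘ₗ φ
  have hker : LinearMap.ker ψ ≠ ⊥ := LinearMap.ker_ne_bot_of_finrank_lt (hfinrank.trans_lt hS)
  obtain ⟨s, hs, hs0⟩ := Submodule.exists_mem_ne_zero_of_ne_bot hker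
  exact ⟨s, hs0, Ideal.Quotient.eq_zero_iff_mem.mp hs⟩

end Jets

section OrderValuation

open IsLocalRing WithZero

variable {O : Type*} [CommRing O] [IsLocalRing O]

theorem exists_mem_maximalIdeal_pow_notMem [IsNoetherianRing O] {a : O} (ha : a ≠ 0) :
    ∃ r, a ∈ maximalIdeal O ^ r ∧ a ∉ maximalIdeal O ^ (r + 1) := by
  by_contra! h
  have hpow (r : ℕ) : a ∈ maximalIdeal O ^ r := by
    induction r with
    | zero => simp
    | succ r ih => exact h r ih
  have hbot := Ideal.iInf_pow_eq_bot_of_isLocalRing (maximalIdeal O) (Ideal.IsPrime.ne_top')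
  exact ha (by simpa [hbot] using Ideal.mem_iInf.mpr hpow)

theorem exists_forall_le_iff_mem_maximalIdeal_pow [IsNoetherianRing O] :
    ∃ o : O → ℕ, ∀ a ≠ 0, ∀ r, r ≤ o a ↔ a ∈ maximalIdeal O ^ r := by
  choose! o ho ho' using fun (a : O) (ha : a ≠ 0) => exists_mem_maximalIdeal_pow_notMem ha
  refine ⟨o, fun a ha r => ⟨fun h => Ideal.pow_le_pow_right h (ho a ha), fun h => ?_⟩⟩
  by_contra! hlt
  exact ho' a ha (Ideal.pow_le_pow_right hlt h)

/-- A valuation `v` on the fraction field of a local domain is the order valuation if the elements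
of `O` with `v a ≤ exp (-r)` are those vanishing to order at least `r` at the closed point. -/
def IsOrderValuation (O : Type*) [CommRing O] [IsLocalRing O] {K : Type*} [Field K] [Algebra O K]
    (v : Valuation K (WithZero (Multiplicative ℤ))) : Prop :=
  ∀ (a : O) (r : ℕ), v (algebraMap O K a) ≤ exp (-(r : ℤ)) ↔ a ∈ maximalIdeal O ^ r

variable [IsDomain O]

theorem eq_add_of_forall_le_iff_mem_maximalIdeal_pow {o : O → ℕ}
    (ho : ∀ a ≠ 0, ∀ r, r ≤ o a ↔ a ∈ maximalIdeal O ^ r)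
    (hmul : ∀ {r s : ℕ} {a b : O}, a ∈ maximalIdeal O ^ r → a ∉ maximalIdeal O ^ (r + 1) →
      b ∈ maximalIdeal O ^ s → b ∉ maximalIdeal O ^ (s + 1) →
      a * b ∉ maximalIdeal O ^ (r + s + 1))
    {a b : O} (ha : a ≠ 0) (hb : b ≠ 0) : o (a * b) = o a + o b := by
  have hmem {a : O} (ha : a ≠ 0) : a ∈ maximalIdeal O ^ o a := (ho a ha _).mp le_rfl
  have hnotMem {a : O} (ha : a ≠ 0) : a ∉ maximalIdeal O ^ (o a + 1) :=
    (ho a ha _).not.mp (Nat.not_succ_le_self _)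
  refine le_antisymm ?_ ((ho _ (mul_ne_zero ha hb) _).mpr ?_)
  · by_contra! hlt
    exact hmul (hmem ha) (hnotMem ha) (hmem hb) (hnotMem hb)
      ((ho _ (mul_ne_zero ha hb) _).mp hlt)
  · exact pow_add (maximalIdeal O) _ _ ▸ Ideal.mul_mem_mul (hmem ha) (hmem hb)

variable [IsNoetherianRing O]

theorem exists_valuation_le_exp_neg_iff_mem_pow
    (hmul : ∀ {r s : ℕ} {a b : O}, a ∈ maximalIdeal O ^ r → a ∉ maximalIdeal O ^ (r + 1) →
      b ∈ maximalIdeal O ^ s → b ∉ maximalIdeal O ^ (s + 1) →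
      a * b ∉ maximalIdeal O ^ (r + s + 1)) :
    ∃ w : Valuation O (WithZero (Multiplicative ℤ)), w.supp = ⊥ ∧ ∀ (a : O) (r : ℕ),
      w a ≤ exp (-(r : ℤ)) ↔ a ∈ maximalIdeal O ^ r := by
  classical
  obtain ⟨o, hle⟩ := exists_forall_le_iff_mem_maximalIdeal_pow (O := O)
  have ho_mul {a b : O} (ha : a ≠ 0) (hb : b ≠ 0) : o (a * b) = o a + o b :=
    eq_add_of_forall_le_iff_mem_maximalIdeal_pow hle hmul ha hb
  have ho_one : o 1 = 0 := by simpa using ho_mul one_ne_zero one_ne_zero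
  let f (a : O) : WithZero (Multiplicative ℤ) := if a = 0 then 0 else exp (-(o a : ℤ))
  have hf (a : O) (r : ℕ) : f a ≤ exp (-(r : ℤ)) ↔ a ∈ maximalIdeal O ^ r := by
    by_cases ha : a = 0
    · simp [f, ha]
    · simp only [f, if_neg ha, exp_le_exp, neg_le_neg_iff, Nat.cast_le, hle a ha]
  have hf_add (a b : O) : f (a + b) ≤ max (f a) (f b) := by
    wlog hab : f a ≤ f b generalizing a b
    · rw [add_comm, max_comm]
      exact this b a (le_of_not_ge hab)
    rw [max_eq_right hab]
    by_cases hb : b = 0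
    · have ha : a = 0 := by simpa [f, hb] using hab
      simp [f, ha, hb]
    · have hfb : f b = exp (-(o b : ℤ)) := if_neg hb
      rw [hfb, hf] at hab ⊢
      exact Ideal.add_mem _ hab ((hle b hb _).mp le_rfl)
  refine ⟨⟨⟨⟨f, if_pos rfl⟩, by simp [f, ho_one], fun a b => ?_⟩, hf_add⟩, ?_, hf⟩
  · by_cases ha : a = 0
    · simp [f, ha]
    by_cases hb : b = 0
    · simp [f, hb]
    simp only [f, if_neg ha, if_neg hb, if_neg (mul_ne_zero ha hb), ho_mul ha hb, Nat.cast_add,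
      neg_add, exp_add]
  · refine le_antisymm (fun a (ha : f a = 0) => ?_) bot_le
    simpa [f] using ha

theorem exists_isOrderValuation (K : Type*) [Field K] [Algebra O K] [IsFractionRing O K]
    (hmul : ∀ {r s : ℕ} {a b : O}, a ∈ maximalIdeal O ^ r → a ∉ maximalIdeal O ^ (r + 1) →
      b ∈ maximalIdeal O ^ s → b ∉ maximalIdeal O ^ (s + 1) →
      a * b ∉ maximalIdeal O ^ (r + s + 1)) :
    ∃ v : Valuation K (WithZero (Multiplicative ℤ)), IsOrderValuation O v := by
  obtain ⟨w, hsupp, hw⟩ := exists_valuation_le_exp_neg_iff_mem_pow hmul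
  have hsupp' : nonZeroDivisors O ≤ w.supp.primeCompl := fun a ha hmem => by
    rw [SetLike.mem_coe, hsupp] at hmem
    exact nonZeroDivisors.ne_zero ha hmem
  refine ⟨w.extendToLocalization hsupp' K, fun a r => ?_⟩
  rw [Valuation.extendToLocalization_apply_map_apply]
  exact hw a r

end OrderValuation

/-! ### Centers of valuations on affine charts -/

section Kaehler

open KaehlerDifferential (D)

variable {k A B ι : Type*} [CommRing k] [CommRing A] [CommRing B] [Algebra k A] [Algebra k B]
  [Algebra A B] [IsScalarTower k A B] {t : ι → A}

theorem D_algebraMap_mem_of_span_D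
    (ht : Submodule.span A (Set.range fun i => D k A (t i)) = ⊤) (N : Submodule B (Ω[B⁄k]))
    (hN : ∀ i, D k B (algebraMap A B (t i)) ∈ N) (a : A) : D k B (algebraMap A B a) ∈ N := by
  have hle : ⊤ ≤ (N.restrictScalars A).comap (KaehlerDifferential.map k k A B) := by
    rw [← ht, Submodule.span_le]
    rintro _ ⟨i, rfl⟩
    simpa using hN i
  simpa using hle (Submodule.mem_top (x := D k A a))

theorem formallyUnramified_of_span_D
    (ht : Submodule.span B (Set.range fun i => D k B (algebraMap A B (t i))) = ⊤) :
    Algebra.FormallyUnramified A B := by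
  have hmap : KaehlerDifferential.map k A B B = 0 :=
    LinearMap.ext_on_range ht fun i => by simp
  have hzero (x : Ω[B⁄A]) : x = 0 := by
    obtain ⟨y, rfl⟩ := KaehlerDifferential.map_surjective k A B x
    rw [hmap, LinearMap.zero_apply]
  exact ⟨⟨fun x y => (hzero x).trans (hzero y).symm⟩⟩

theorem span_D_algebraMap [IsFractionRing A B]
    (ht : Submodule.span A (Set.range fun i => D k A (t i)) = ⊤) :
    Submodule.span B (Set.range fun i => D k B (algebraMap A B (t i))) = ⊤ := by
  have := span_eq_top_of_isLocalizedModule B (nonZeroDivisors A)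
    (KaehlerDifferential.map k k A B) ht
  simpa only [← Set.range_comp, Function.comp_def, KaehlerDifferential.map_D] using this

theorem linearIndependent_D_algebraMap [IsFractionRing A B]
    (ht : LinearIndependent A fun i => D k A (t i)) :
    LinearIndependent B fun i => D k B (algebraMap A B (t i)) := by
  have := ht.of_isLocalizedModule B (nonZeroDivisors A) (KaehlerDifferential.map k k A B)
  simpa only [Function.comp_def, KaehlerDifferential.map_D] using this

end Kaehler

section Center

open IsLocalRing

variable {C K Γ : Type*} [CommRing C] [Field K] [Algebra C K] [LinearOrderedCommGroupWithZero Γ]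
  (v : Valuation K Γ)

/-- The center on `Spec C` of a valuation `v` which is nonnegative on `C`: the prime ideal of the
elements of positive valuation. -/
def center (hv : ∀ c, v (algebraMap C K c) ≤ 1) : PrimeSpectrum C :=
  PrimeSpectrum.comap ((algebraMap C K).codRestrict v.valuationSubring.toSubring hv)
    (closedPoint v.valuationSubring)

variable {v}

theorem mem_center {hv : ∀ c, v (algebraMap C K c) ≤ 1} {c : C} :
    c ∈ (center v hv).asIdeal ↔ v (algebraMap C K c) < 1 :=
  Valuation.Integer.not_isUnit_iff_valuation_lt_one (v := v) (x := ⟨_, hv c⟩)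

theorem valuation_eq_one_of_notMem_center {hv : ∀ c, v (algebraMap C K c) ≤ 1} {c : C}
    (hc : c ∉ (center v hv).asIdeal) : v (algebraMap C K c) = 1 :=
  le_antisymm (hv c) (not_lt.mp fun h => hc (mem_center.mpr h))

theorem isDiscreteValuationRing_of_ringKrullDim_eq_one (L : Type*) [CommRing L] [IsDomain L]
    [IsLocalRing L] [IsNoetherianRing L] [IsIntegrallyClosed L] (hL : ringKrullDim L = 1) :
    IsDiscreteValuationRing L := by
  have hfield : ¬ IsField L := fun h => by simp [ringKrullDim_eq_zero_of_isField h] at hL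
  have hle : Ring.KrullDimLE 1 L := Ring.krullDimLE_iff.mpr hL.le
  have hmax : maximalIdeal L ≠ ⊥ := fun h => hfield (isField_iff_maximalIdeal_eq.mpr h)
  have hunique : IsIntegrallyClosed L ∧ ∃! Q : Ideal L, Q ≠ ⊥ ∧ Q.IsPrime :=
    ⟨inferInstance, maximalIdeal L, ⟨hmax, inferInstance⟩, fun Q hQ =>
      eq_maximalIdeal (Ring.krullDimLE_one_iff_of_isPrime_bot.mp hle Q hQ.1 hQ.2)⟩
  exact ((IsDiscreteValuationRing.TFAE L hfield).out 0 3).mpr hunique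

theorem exists_mul_eq_of_height_center_eq_one [IsDomain C] [IsNoetherianRing C]
    [IsIntegrallyClosed C] [IsFractionRing C K] (hv : ∀ c, v (algebraMap C K c) ≤ 1)
    (hheight : (center v hv).asIdeal.height = 1) {y : K} (hy : v y ≤ 1) :
    ∃ c s : C, v (algebraMap C K s) = 1 ∧ y * algebraMap C K s = algebraMap C K c := by
  let E := (center v hv).asIdeal
  have hE : E.primeCompl ≤ nonZeroDivisors C := E.primeCompl_le_nonZeroDivisors
  let L := Localization.subalgebra.ofField K E.primeCompl hE
  have : IsLocalRing L := IsLocalization.AtPrime.isLocalRing L E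
  have : IsNoetherianRing L := IsLocalization.isNoetherianRing E.primeCompl L inferInstance
  have : IsIntegrallyClosed L := isIntegrallyClosed_of_isLocalization L E.primeCompl hE
  have : IsDiscreteValuationRing L := isDiscreteValuationRing_of_ringKrullDim_eq_one L <| by
    rw [IsLocalization.AtPrime.ringKrullDim_eq_height E L, hheight]
    rfl
  have hquot (z : L) : ∃ c s : C, v (algebraMap C K s) = 1 ∧
      (z : K) * algebraMap C K s = algebraMap C K c := by
    obtain ⟨c, s, hs, hz⟩ := z.2
    have hvs := valuation_eq_one_of_notMem_center (v := v) hs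
    have hs0 : algebraMap C K s ≠ 0 := v.ne_zero_iff.mp (hvs ▸ one_ne_zero)
    exact ⟨c, s, hvs, by rw [hz, inv_mul_cancel_right₀ hs0]⟩
  rcases ValuationRing.isInteger_or_isInteger L y with ⟨z, rfl⟩ | ⟨z, hz⟩
  · exact hquot z
  · obtain ⟨c, s, hvs, hcs⟩ := hquot z
    rw [show (z : K) = y⁻¹ from hz] at hcs
    rcases eq_or_ne y 0 with rfl | hy0
    · exact ⟨0, s, hvs, by simp⟩
    refine ⟨s, c, le_antisymm (hv c) ?_, by rw [← hcs, mul_inv_cancel_left₀ hy0]⟩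
    rw [← hcs, map_mul, hvs, mul_one, map_inv₀]
    exact (one_le_inv₀ (pos_iff_ne_zero.mpr (v.ne_zero_iff.mpr hy0))).mpr hy

theorem height_eq_one_of_comap_eq_span_singleton {R : Type*} [CommRing R] [Algebra R C]
    [IsDomain C] [IsNoetherianRing C] [Algebra.IsIntegral R C] {E : Ideal C} [E.IsPrime] {π : R}
    (hπ : algebraMap R C π ≠ 0) (hE : E.comap (algebraMap R C) = Ideal.span {π}) :
    E.height = 1 := by
  have hπE : algebraMap R C π ∈ E := by
    rw [← Ideal.mem_comap, hE]
    exact Ideal.mem_span_singleton_self π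
  refine le_antisymm ?_ (Order.one_le_iff_pos.mpr (pos_iff_ne_zero.mpr ?_))
  · refine Ideal.height_le_one_of_isPrincipal_of_mem_minimalPrimes
      (Ideal.span {algebraMap R C π}) E
      ⟨⟨inferInstance, (Ideal.span_singleton_le_iff_mem _).mpr hπE⟩, ?_⟩
    rintro q ⟨hq, hπq⟩ hqE
    by_contra hnot
    refine (Ideal.IsIntegral.comap_lt_comap (R := R) (lt_of_le_not_ge hqE hnot)).not_ge ?_
    rw [hE, Ideal.span_singleton_le_iff_mem, Ideal.mem_comap]
    exact (Ideal.span_singleton_le_iff_mem _).mp hπq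
  · rw [Ne, Ideal.height_eq_zero_iff_eq_bot]
    exact fun h => hπ (by simpa [h] using hπE)

theorem valuation_le_one_of_isIntegral {R : Type*} [CommRing R] [Algebra R K]
    (hv : ∀ r : R, v (algebraMap R K r) ≤ 1) {y : K} (hy : IsIntegral R y) : v y ≤ 1 := by
  obtain ⟨p, hp, hpy⟩ := hy
  refine (Valuation.integer.integers v).mem_of_integral (x := y)
    ⟨p.map ((algebraMap R K).codRestrict v.integer hv), hp.map _, ?_⟩
  rw [Polynomial.eval₂_map]
  exact hpy

end Center

section AffineModel

variable {k K Γ : Type*} [Field k] [Field K] [Algebra k K] [LinearOrderedCommGroupWithZero Γ]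

/-- `Spec C` is a normal affine variety on which the valuation `v` has a center with local ring
the valuation ring of `v`. Every element of the valuation ring is a fraction of elements of `C`
whose denominator has valuation `1`, so that the fraction field of `C` is all of `K`. -/
structure IsAffineModel (v : Valuation K Γ) (C : Subalgebra k K) : Prop where
  fg : C.FG
  isIntegrallyClosed : IsIntegrallyClosed C
  valuation_le_one : ∀ c ∈ C, v c ≤ 1
  exists_mul_eq : ∀ y, v y ≤ 1 → ∃ c ∈ C, ∃ s ∈ C, v s = 1 ∧ y * s = c

namespace IsAffineModel

variable {v : Valuation K Γ} {C : Subalgebra k K}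

theorem isFractionRing (hC : IsAffineModel v C) : IsFractionRing C K := by
  refine IsFractionRing.of_field C K fun y => ?_
  have hfrac {z : K} (hz : v z ≤ 1) : ∃ c s : C, z = (c : K) / s := by
    obtain ⟨c, hc, s, hs, hvs, hcs⟩ := hC.exists_mul_eq z hz
    exact ⟨⟨c, hc⟩, ⟨s, hs⟩, eq_div_of_mul_eq (v.ne_zero_iff.mp (hvs ▸ one_ne_zero)) hcs⟩
  rcases le_total (v y) 1 with hy | hy
  · obtain ⟨c, s, rfl⟩ := hfrac hy
    exact ⟨c, s, rfl⟩
  · obtain ⟨c, s, hcs⟩ := hfrac (z := y⁻¹) (by rw [map_inv₀]; exact inv_le_one_of_one_le₀ hy)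
    exact ⟨s, c, by rw [← inv_inv y, hcs, inv_div]; rfl⟩

theorem exists_mem_of_valuation_le_one (hC : IsAffineModel v C) {y : K} (hy : v y ≤ 1) :
    ∃ C' : Subalgebra k K, C ≤ C' ∧ y ∈ C' ∧ IsAffineModel v C' := by
  have := hC.isFractionRing
  have := hC.isIntegrallyClosed
  have : Algebra.FiniteType k C := C.fg_iff_finiteType.mp hC.fg
  obtain ⟨c, hc, s, hs, hvs, hcs⟩ := hC.exists_mul_eq y hy
  have hs0 : s ≠ 0 := v.ne_zero_iff.mp (hvs ▸ one_ne_zero)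
  let g : C := ⟨s, hs⟩
  have hg : Submonoid.powers g ≤ nonZeroDivisors C :=
    powers_le_nonZeroDivisors_of_noZeroDivisors (Subtype.coe_ne_coe.mp hs0)
  let L := Localization.subalgebra.ofField K (Submonoid.powers g) hg
  have : IsLocalization.Away g L := inferInstanceAs (IsLocalization (Submonoid.powers g) L)
  have hle : C ≤ L.restrictScalars k := fun a ha => L.algebraMap_mem ⟨a, ha⟩
  refine ⟨L.restrictScalars k, hle, ?_, ?_, isIntegrallyClosed_of_isLocalization L _ hg, ?_, ?_⟩
  · exact ⟨⟨c, hc⟩, g, Submonoid.mem_powers g, (eq_mul_inv_iff_mul_eq₀ hs0).mpr hcs⟩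
  · have hL : Algebra.FiniteType C L :=
      IsLocalization.finiteType_of_monoid_fg (Submonoid.powers g) L
    have hkL : Algebra.FiniteType k L := Algebra.FiniteType.trans ‹Algebra.FiniteType k C› hL
    exact (Subalgebra.fg_iff_finiteType (L.restrictScalars k)).mpr hkL
  · rintro _ ⟨a, _, ⟨m, rfl⟩, rfl⟩
    have hgm : v (algebraMap C K (g ^ m)) = 1 := by
      rw [map_pow, map_pow]
      exact (congrArg (· ^ m) hvs).trans (one_pow m)
    rw [map_mul, map_inv₀, hgm, inv_one, mul_one]
    exact hC.valuation_le_one a a.2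
  · intro z hz
    obtain ⟨a, ha, b, hb, hvb, hab⟩ := hC.exists_mul_eq z hz
    exact ⟨a, hle ha, b, hle hb, hvb, hab⟩

theorem exists_le_of_fg (hC : IsAffineModel v C) {A : Subalgebra k K} (hA : A.FG)
    (hAv : ∀ a ∈ A, v a ≤ 1) : ∃ C' : Subalgebra k K, A ≤ C' ∧ IsAffineModel v C' := by
  classical
  obtain ⟨S, rfl⟩ := hA
  replace hAv : ∀ a ∈ S, v a ≤ 1 := fun a ha => hAv a (Algebra.subset_adjoin ha)
  simp only [Algebra.adjoin_le_iff]
  induction S using Finset.induction_on with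
  | empty => exact ⟨C, by simp, hC⟩
  | insert y S _ ih =>
    obtain ⟨C₁, hS, hC₁⟩ := ih fun a ha => hAv a (Finset.mem_insert_of_mem ha)
    obtain ⟨C₂, hle, hy, hC₂⟩ :=
      hC₁.exists_mem_of_valuation_le_one (hAv y (Finset.mem_insert_self y S))
    refine ⟨C₂, ?_, hC₂⟩
    rw [Finset.coe_insert, Set.insert_subset_iff]
    exact ⟨hy, hS.trans hle⟩

end IsAffineModel

open KaehlerDifferential (D) in
theorem finite_and_isSeparable_of_span_D {ι F : Type*} [Field F] [Algebra k F] [Algebra F K]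
    [IsScalarTower k F K] [Algebra.EssFiniteType k K] {u : ι → F}
    (hu : Submodule.span K (Set.range fun i => D k K (algebraMap F K (u i))) = ⊤) :
    Module.Finite F K ∧ Algebra.IsSeparable F K := by
  have := formallyUnramified_of_span_D hu
  have := Algebra.EssFiniteType.of_comp k F K
  exact ⟨Algebra.FormallyUnramified.finite_of_free F K, Algebra.FormallyUnramified.isSeparable F K⟩

open KaehlerDifferential (D) in
theorem isAffineModel_integralClosure {R ι : Type*} [CommRing R] [IsDomain R] [IsNoetherianRing R]
    [IsIntegrallyClosed R] [Algebra k R] [Algebra.FiniteType k R] [Algebra R K]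
    [IsScalarTower k R K] [FaithfulSMul R K] [Algebra.EssFiniteType k K] {u : ι → R}
    (hu : Submodule.span K (Set.range fun i => D k K (algebraMap R K (u i))) = ⊤)
    {v : Valuation K Γ} (hv : ∀ r : R, v (algebraMap R K r) ≤ 1) {π : R} (hπ : π ≠ 0)
    (hvπ : ∀ r, v (algebraMap R K r) < 1 ↔ π ∣ r) :
    IsAffineModel v ((integralClosure R K).restrictScalars k) := by
  let F := FractionRing R
  let : Algebra F K := FractionRing.liftAlgebra R K
  have : IsScalarTower R F K := inferInstance
  have : IsScalarTower k F K := IsScalarTower.of_algebraMap_eq fun c => by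
    rw [IsScalarTower.algebraMap_apply k R F, ← IsScalarTower.algebraMap_apply R F K,
      ← IsScalarTower.algebraMap_apply k R K]
  have huF : Submodule.span K
      (Set.range fun i => D k K (algebraMap F K (algebraMap R F (u i)))) = ⊤ := by
    simpa only [← IsScalarTower.algebraMap_apply R F K] using hu
  obtain ⟨_, _⟩ := finite_and_isSeparable_of_span_D huF
  let C := integralClosure R K
  have : Module.Finite R C := IsIntegralClosure.finite R F K C
  have hCclosed : IsIntegrallyClosed C := integralClosure.isIntegrallyClosedOfFiniteExtension F
  have : IsFractionRing C K := integralClosure.isFractionRing_of_finite_extension F K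
  have : IsNoetherianRing C := IsNoetherianRing.of_finite R C
  have hC (c : C) : v (algebraMap C K c) ≤ 1 := valuation_le_one_of_isIntegral hv c.2
  have hheight : (center v hC).asIdeal.height = 1 := by
    refine height_eq_one_of_comap_eq_span_singleton (R := R) (π := π) ?_ ?_
    · exact (map_ne_zero_iff _ (FaithfulSMul.algebraMap_injective R C)).mpr hπ
    · ext r
      rw [Ideal.mem_comap, mem_center, Ideal.mem_span_singleton, ← hvπ]
      rfl
  refine ⟨?_, hCclosed, fun c hc => hC ⟨c, hc⟩, fun y hy => ?_⟩
  · have hkC : Algebra.FiniteType k C :=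
      Algebra.FiniteType.trans (S := R) inferInstance inferInstance
    exact (Subalgebra.fg_iff_finiteType (C.restrictScalars k)).mpr hkC
  · obtain ⟨c, s, hvs, hcs⟩ := exists_mul_eq_of_height_center_eq_one hC hheight hy
    exact ⟨c, c.2, s, s.2, hvs, hcs⟩

end AffineModel

section PolynomialEvaluation

variable {B K Γ : Type*} [CommRing B] [Field K] [LinearOrderedCommGroupWithZero Γ]
  {v : Valuation K Γ} {φ : B →+* K} {τ : K}

open Polynomial

theorem valuation_eval₂_le_one (hφ : ∀ b, v (φ b) ≤ 1) (hτ : v τ ≤ 1) (P : B[X]) :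
    v (P.eval₂ φ τ) ≤ 1 := by
  rw [eval₂_eq_sum_range]
  refine v.map_sum_le fun i _ => ?_
  rw [map_mul, map_pow]
  exact mul_le_one' (hφ _) (pow_le_one' hτ _)

theorem valuation_le_one_of_forall_ne_zero (hφ : ∀ b ≠ 0, v (φ b) = 1) (b : B) : v (φ b) ≤ 1 := by
  rcases eq_or_ne b 0 with rfl | hb
  · simp
  · exact (hφ b hb).le

theorem valuation_eval₂_lt_one_iff (hφ : ∀ b ≠ 0, v (φ b) = 1) (hτ : v τ < 1) {P : B[X]} :
    v (P.eval₂ φ τ) < 1 ↔ X ∣ P := by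
  have hlt : v (P.divX.eval₂ φ τ * τ) < 1 := by
    rw [map_mul]
    exact mul_lt_one_of_nonneg_of_lt_one_right
      (valuation_eval₂_le_one (valuation_le_one_of_forall_ne_zero hφ) hτ.le _) zero_le hτ
  have hP : P.eval₂ φ τ = φ (P.coeff 0) + P.divX.eval₂ φ τ * τ := by
    conv_lhs => rw [← P.divX_mul_X_add]
    simp [add_comm]
  rw [X_dvd_iff, hP]
  refine ⟨fun h => ?_, fun h => by simpa [h] using hlt⟩
  by_contra h0
  rw [v.map_add_eq_of_lt_left (by rwa [hφ _ h0]), hφ _ h0] at h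
  exact h.false

theorem eval₂RingHom_injective (hφ : ∀ b ≠ 0, v (φ b) = 1) (hτ0 : τ ≠ 0) (hτ : v τ < 1) :
    Function.Injective (eval₂RingHom φ τ) := by
  refine (injective_iff_map_eq_zero _).mpr fun P hP0 => ?_
  by_contra hP
  have : Nontrivial B := Polynomial.nontrivial_iff.mp ⟨P, 0, hP⟩
  obtain ⟨Q, hPQ, hQ⟩ := P.exists_eq_pow_rootMultiplicity_mul_and_not_dvd hP 0
  rw [C_0, sub_zero] at hPQ hQ
  rw [hPQ, map_mul, map_pow, coe_eval₂RingHom, eval₂_X] at hP0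
  refine hQ ((valuation_eval₂_lt_one_iff hφ hτ).mp ?_)
  rw [(mul_eq_zero.mp hP0).resolve_left (pow_ne_zero _ hτ0), map_zero]
  exact zero_lt_one

end PolynomialEvaluation

/-! ### The chart of the blow-up of a point -/

section Homogenization

open MvPolynomial

variable {k A : Type*} [CommRing k] [CommRing A] [Algebra k A]

theorem aeval_mul_of_isHomogeneous {σ : Type*} {F : MvPolynomial σ k} {e : ℕ}
    (hF : F.IsHomogeneous e) (c : A) (w : σ → A) :
    aeval (fun i => c * w i) F = c ^ e * aeval w F := by
  simp only [aeval_def, eval₂_eq, Finset.mul_sum]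
  refine Finset.sum_congr rfl fun m hm => ?_
  have hdeg : ∑ i ∈ m.support, m i = e := (hF.degree_eq_sum_deg_support hm).symm
  simp only [mul_pow, Finset.prod_mul_distrib, Finset.prod_pow_eq_pow_sum, hdeg]
  ring

/-- The homogenization of a polynomial by a new variable `X 0`. -/
def homogenization {d : ℕ} (Q : MvPolynomial (Fin d) k) : MvPolynomial (Fin (d + 1)) k :=
  ∑ j ∈ Finset.range (Q.totalDegree + 1),
    X 0 ^ (Q.totalDegree - j) * rename Fin.succ (homogeneousComponent j Q)

variable {d : ℕ} (Q : MvPolynomial (Fin d) k)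

theorem isHomogeneous_homogenization : (homogenization Q).IsHomogeneous Q.totalDegree := by
  refine IsHomogeneous.sum _ _ _ fun j hj => ?_
  have hX : (X 0 : MvPolynomial (Fin (d + 1)) k).IsHomogeneous 1 := isHomogeneous_X k 0
  have hj : Q.totalDegree - j + j = Q.totalDegree := Nat.sub_add_cancel (by simpa using hj)
  simpa [hj] using (hX.pow (Q.totalDegree - j)).mul
    ((homogeneousComponent_isHomogeneous j Q).rename_isHomogeneous (f := Fin.succ))

theorem aeval_homogenization (c : A) (w : Fin d → A) :
    aeval (Fin.cons c fun i => c * w i : Fin (d + 1) → A) (homogenization Q) =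
      c ^ Q.totalDegree * aeval w Q := by
  have hQ : aeval w Q = ∑ j ∈ Finset.range (Q.totalDegree + 1),
      aeval w (homogeneousComponent j Q) := by
    rw [← map_sum, sum_homogeneousComponent]
  rw [homogenization, map_sum, hQ, Finset.mul_sum]
  refine Finset.sum_congr rfl fun j hj => ?_
  rw [map_mul, map_pow, aeval_X, aeval_rename, Fin.cons_zero]
  change c ^ (Q.totalDegree - j) * aeval (fun i => c * w i) _ = _
  rw [aeval_mul_of_isHomogeneous (homogeneousComponent_isHomogeneous j Q), ← mul_assoc,
    ← pow_add, Nat.sub_add_cancel (by simpa using hj)]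

theorem homogenization_ne_zero {Q : MvPolynomial (Fin d) k} (hQ : Q ≠ 0) :
    homogenization Q ≠ 0 := fun h => hQ <| by
  simpa [h] using (aeval_homogenization Q (1 : MvPolynomial (Fin d) k) X).symm

end Homogenization

section BlowupCoordinates

variable {K : Type*} [Field K]

/-- The functions `t₀, t₁ / t₀, …, t_d / t₀`, coordinates on a chart of the blow-up of the point
`t₀ = ⋯ = t_d = 0`. The exceptional divisor is `t₀ = 0`. -/
def blowupCoordinates {d : ℕ} (t : Fin (d + 1) → K) : Fin (d + 1) → K :=
  Fin.cons (t 0) fun i => t i.succ / t 0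

variable {d : ℕ} {t : Fin (d + 1) → K}

theorem cons_mul_blowupCoordinates (h0 : t 0 ≠ 0) :
    (Fin.cons (t 0) fun i => t 0 * blowupCoordinates t i.succ : Fin (d + 1) → K) = t := by
  refine funext (Fin.cases rfl fun i => ?_)
  simp only [blowupCoordinates, Fin.cons_succ]
  exact mul_div_cancel₀ _ h0

theorem eq_mul_blowupCoordinates (h0 : t 0 ≠ 0) (i : Fin d) :
    t i.succ = t 0 * blowupCoordinates t i.succ :=
  (congrFun (cons_mul_blowupCoordinates h0) i.succ).symm

open KaehlerDifferential (D) in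
theorem span_D_blowupCoordinates {k : Type*} [CommRing k] [Algebra k K] (h0 : t 0 ≠ 0)
    (ht : Submodule.span K (Set.range fun i => D k K (t i)) = ⊤) :
    Submodule.span K (Set.range fun i => D k K (blowupCoordinates t i)) = ⊤ := by
  rw [← top_le_iff, ← ht, Submodule.span_le]
  have hs (i) : D k K (blowupCoordinates t i) ∈
      Submodule.span K (Set.range fun i => D k K (blowupCoordinates t i)) :=
    Submodule.subset_span ⟨i, rfl⟩
  rintro _ ⟨i, rfl⟩
  refine Fin.cases (hs 0) (fun j => ?_) i
  change D k K (t j.succ) ∈ _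
  rw [eq_mul_blowupCoordinates h0, Derivation.leibniz]
  exact add_mem (Submodule.smul_mem _ _ (hs j.succ)) (Submodule.smul_mem _ _ (hs 0))

end BlowupCoordinates

section AffineModelOfCoordinates

variable {k K Γ : Type*} [Field k] [Field K] [Algebra k K] [LinearOrderedCommGroupWithZero Γ]

open KaehlerDifferential (D) in
theorem exists_isAffineModel [Algebra.EssFiniteType k K] {d : ℕ} {s : Fin (d + 1) → K}
    (hs : Submodule.span K (Set.range fun i => D k K (s i)) = ⊤) {v : Valuation K Γ}
    (hs0 : s 0 ≠ 0) (hvs : v (s 0) < 1)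
    (hv : ∀ Q : MvPolynomial (Fin d) k, Q ≠ 0 → v (MvPolynomial.aeval (Fin.tail s) Q) = 1) :
    ∃ C : Subalgebra k K, IsAffineModel v C := by
  let φ : MvPolynomial (Fin d) k →+* K := (MvPolynomial.aeval (Fin.tail s)).toRingHom
  let R := Polynomial (MvPolynomial (Fin d) k)
  let : Algebra R K := (Polynomial.eval₂RingHom φ (s 0)).toAlgebra
  have : IsScalarTower k R K := IsScalarTower.of_algebraMap_eq fun c => by
    change _ = Polynomial.eval₂ φ (s 0) (Polynomial.C (MvPolynomial.C c))
    rw [Polynomial.eval₂_C]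
    exact (MvPolynomial.aeval_C _ c).symm
  have : FaithfulSMul R K :=
    (faithfulSMul_iff_algebraMap_injective R K).mpr (eval₂RingHom_injective hv hs0 hvs)
  let u : Fin (d + 1) → R := Fin.cons Polynomial.X fun i => Polynomial.C (MvPolynomial.X i)
  have hu (i) : algebraMap R K (u i) = s i := by
    refine Fin.cases (Polynomial.eval₂_X φ (s 0)) (fun j => ?_) i
    exact (Polynomial.eval₂_C φ (s 0)).trans (MvPolynomial.aeval_X _ j)
  exact ⟨_, isAffineModel_integralClosure (u := u) (by simpa only [hu] using hs)
    (fun P => valuation_eval₂_le_one (valuation_le_one_of_forall_ne_zero hv) hvs.le P)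
    Polynomial.X_ne_zero fun P => valuation_eval₂_lt_one_iff hv hvs⟩

end AffineModelOfCoordinates

section OrderOfCoordinates

open IsLocalRing WithZero

theorem lt_exp_iff_le_exp_sub_one {a : WithZero (Multiplicative ℤ)} {m : ℤ} :
    a < exp m ↔ a ≤ exp (m - 1) := by
  rw [← lt_mul_exp_iff_le exp_ne_zero, ← exp_add, sub_add_cancel]

variable {k O K ι : Type*} [Field k] [CommRing O] [IsLocalRing O] [Algebra k O] [Field K]
  [Algebra O K] {v : Valuation K (WithZero (Multiplicative ℤ))}

namespace IsOrderValuation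

variable (hv : IsOrderValuation O v) {a : O}

include hv

theorem le_one (a : O) : v (algebraMap O K a) ≤ 1 := by
  simpa using (hv a 0).mpr

theorem lt_one_iff : v (algebraMap O K a) < 1 ↔ a ∈ maximalIdeal O := by
  rw [← exp_zero, lt_exp_iff_le_exp_sub_one]
  simpa using hv a 1

theorem eq_exp_neg {r : ℕ} (har : a ∈ maximalIdeal O ^ r) (har' : a ∉ maximalIdeal O ^ (r + 1)) :
    v (algebraMap O K a) = exp (-(r : ℤ)) := by
  rw [← hv] at har har'
  refine le_antisymm har (not_lt.mp fun h => har' ?_)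
  have hr : -((r + 1 : ℕ) : ℤ) = -(r : ℤ) - 1 := by push_cast; ring
  rwa [hr, ← lt_exp_iff_le_exp_sub_one]

end IsOrderValuation

variable [Algebra.FormallySmooth k O] {t : ι → O} (ht : IsCoordinateSystem k t)
  (hv : IsOrderValuation O v)

include ht hv

theorem valuation_aeval_eq_exp_neg {e : ℕ} {F : MvPolynomial ι k} (hF : F.IsHomogeneous e)
    (hF0 : F ≠ 0) : v (algebraMap O K (MvPolynomial.aeval t F)) = exp (-(e : ℤ)) := by
  refine hv.eq_exp_neg ?_ fun h => hF0 (ht.eq_zero_of_aeval_mem_pow hF h)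
  rw [MvPolynomial.aeval_def, MvPolynomial.eval₂_eq]
  refine Ideal.sum_mem _ fun m hm => Ideal.mul_mem_left _ _ ?_
  rw [hF.degree_eq_sum_deg_support hm, ← Finset.prod_pow_eq_pow_sum]
  exact Ideal.prod_mem_prod fun i _ => Ideal.pow_mem_pow (ht.mem_maximalIdeal i) _

theorem valuation_coordinate (i : ι) : v (algebraMap O K (t i)) = exp (-1) := by
  simpa using valuation_aeval_eq_exp_neg ht hv (MvPolynomial.isHomogeneous_X k i)
    (MvPolynomial.X_ne_zero i)

theorem algebraMap_coordinate_ne_zero (i : ι) : algebraMap O K (t i) ≠ 0 :=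
  v.ne_zero_iff.mp (valuation_coordinate ht hv i ▸ exp_ne_zero)

end OrderOfCoordinates

section Exceptional

open IsLocalRing WithZero

variable {k O K : Type*} [Field k] [CommRing O] [IsLocalRing O] [Algebra k O] [Field K]
  [Algebra O K] {v : Valuation K (WithZero (Multiplicative ℤ))} [Algebra.FormallySmooth k O] {d : ℕ}
  {t : Fin (d + 1) → O} (ht : IsCoordinateSystem k t) (hv : IsOrderValuation O v)

include ht hv

theorem valuation_blowupCoordinates_le_one (i : Fin (d + 1)) :
    v (blowupCoordinates (algebraMap O K ∘ t) i) ≤ 1 := by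
  refine Fin.cases (hv.le_one _) (fun j => ?_) i
  simp only [blowupCoordinates, Fin.cons_succ, Function.comp_apply, map_div₀,
    valuation_coordinate ht hv]
  exact (div_self (exp_ne_zero (a := -1))).le

theorem valuation_aeval_blowupCoordinates_eq_one [Algebra k K] [IsScalarTower k O K]
    {Q : MvPolynomial (Fin d) k} (hQ : Q ≠ 0) :
    v (MvPolynomial.aeval (Fin.tail (blowupCoordinates (algebraMap O K ∘ t))) Q) = 1 := by
  have h0 : algebraMap O K (t 0) ≠ 0 := algebraMap_coordinate_ne_zero ht hv 0
  have hF : MvPolynomial.aeval (algebraMap O K ∘ t) (homogenization Q) =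
      algebraMap O K (t 0) ^ Q.totalDegree *
        MvPolynomial.aeval (Fin.tail (blowupCoordinates (algebraMap O K ∘ t))) Q := by
    rw [← aeval_homogenization]
    congr 2
    exact (cons_mul_blowupCoordinates (t := algebraMap O K ∘ t) h0).symm
  have hexp := valuation_aeval_eq_exp_neg ht hv (isHomogeneous_homogenization Q)
    (homogenization_ne_zero hQ)
  rw [← MvPolynomial.aeval_algebraMap_apply, hF, map_mul, map_pow, valuation_coordinate ht hv,
    ← exp_nsmul] at hexp
  simpa [exp_ne_zero] using hexp

end Exceptional

section ExceptionalValuationRing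

open IsLocalRing WithZero

open KaehlerDifferential (D)

section SubalgebraOfSubmodule

variable {k L : Type*} [CommRing k] [CommRing L] [Algebra k L] (N : Submodule L (Ω[L⁄k]))

/-- The functions whose differential lies in a given submodule `N` of the differentials; by the
Leibniz rule they form a subalgebra. -/
def subalgebraOfDMem : Subalgebra k L where
  carrier := {l | D k L l ∈ N}
  mul_mem' {a b} ha hb := by
    rw [Set.mem_ofPred_eq, Derivation.leibniz]
    exact add_mem (N.smul_mem a hb) (N.smul_mem b ha)
  add_mem' ha hb := by
    rw [Set.mem_ofPred_eq, map_add]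
    exact add_mem ha hb
  algebraMap_mem' c := by
    rw [Set.mem_ofPred_eq, Derivation.map_algebraMap]
    exact N.zero_mem

variable {N}

theorem mem_subalgebraOfDMem {l : L} : l ∈ subalgebraOfDMem N ↔ D k L l ∈ N :=
  Iff.rfl

theorem mem_subalgebraOfDMem_of_mul_mem {y b : L} (hb : IsUnit b) (hbN : b ∈ subalgebraOfDMem N)
    (hybN : y * b ∈ subalgebraOfDMem N) : y ∈ subalgebraOfDMem N := by
  rw [mem_subalgebraOfDMem, Derivation.leibniz,
    N.add_mem_iff_right (N.smul_mem y (mem_subalgebraOfDMem.mp hbN))] at hybN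
  exact (N.smul_mem_iff_of_isUnit hb).mp hybN

end SubalgebraOfSubmodule

theorem exists_algHom_of_integers {k A L K Γ : Type*} [CommRing k] [CommRing A] [CommRing L]
    [Field K] [Algebra k A] [Algebra k L] [Algebra k K] [Algebra A K] [Algebra L K]
    [IsScalarTower k A K] [IsScalarTower k L K] [LinearOrderedCommGroupWithZero Γ]
    {v : Valuation K Γ} (hL : v.Integers L) (hA : ∀ a : A, v (algebraMap A K a) ≤ 1) :
    ∃ ι : A →ₐ[k] L, ∀ a, algebraMap L K (ι a) = algebraMap A K a := by
  let e := AlgEquiv.ofInjective (IsScalarTower.toAlgHom k L K) hL.hom_inj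
  let f : A →ₐ[k] (IsScalarTower.toAlgHom k L K).range :=
    (IsScalarTower.toAlgHom k A K).codRestrict _ fun a => hL.exists_of_le_one (hA a)
  exact ⟨e.symm.toAlgHom.comp f, fun a => congrArg Subtype.val (e.apply_symm_apply (f a))⟩

theorem exists_eq_exp_neg {a : WithZero (Multiplicative ℤ)} (ha0 : a ≠ 0) (ha : a ≤ 1) :
    ∃ r : ℕ, a = exp (-(r : ℤ)) := by
  rw [← exp_log ha0, ← exp_zero, exp_le_exp] at ha
  exact ⟨(-log a).toNat, by rw [Int.toNat_of_nonneg (by lia), neg_neg, exp_log ha0]⟩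

section Uniformizer

variable {L K : Type*} [CommRing L] [Field K] [Algebra L K]
  {v : Valuation K (WithZero (Multiplicative ℤ))} (hL : v.Integers L) {π : L}
  (hπ : v (algebraMap L K π) = exp (-1))

include hL hπ

theorem irreducible_of_valuation_eq_exp_neg_one : Irreducible π := by
  have hlt {x : L} (hx : ¬ IsUnit x) : v (algebraMap L K x) ≤ exp (-1) := by
    have h1 : v (algebraMap L K x) < exp 0 :=
      (hL.map_le_one x).lt_of_ne fun h => hx (hL.isUnit_of_one' h)
    exact lt_exp_iff_le_exp_sub_one.mp h1
  refine ⟨fun hu => ?_, fun {a b} hab => ?_⟩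
  · rw [hL.one_of_isUnit hu, ← exp_zero, exp_inj] at hπ
    lia
  · by_contra! h
    have hle := mul_le_mul' (hlt h.1) (hlt h.2)
    rw [← map_mul, ← map_mul, ← hab, hπ, ← exp_add, exp_le_exp] at hle
    lia

theorem isDiscreteValuationRing_of_integers [IsDomain L] : IsDiscreteValuationRing L := by
  refine IsDiscreteValuationRing.ofHasUnitMulPowIrreducibleFactorization
    ⟨π, irreducible_of_valuation_eq_exp_neg_one hL hπ, fun {x} hx => ?_⟩
  have hx0 : v (algebraMap L K x) ≠ 0 :=
    v.ne_zero_iff.mpr ((map_ne_zero_iff _ hL.hom_inj).mpr hx)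
  obtain ⟨r, hr⟩ := exists_eq_exp_neg hx0 (hL.map_le_one x)
  have heq : v (algebraMap L K (π ^ r)) = v (algebraMap L K x) := by
    rw [map_pow, map_pow, hπ, ← exp_nsmul, hr]
    simp
  exact ⟨r, associated_of_dvd_dvd (hL.dvd_of_le heq.ge) (hL.dvd_of_le heq.le)⟩

end Uniformizer

section Coordinates

variable {k O K L : Type*} [Field k] [CommRing O] [IsLocalRing O] [Algebra k O] [Field K]
  [CommRing L] [Algebra k K] [Algebra k L] [Algebra O K] [Algebra L K]
  [IsScalarTower k O K] [IsScalarTower k L K] {d : ℕ} {t : Fin (d + 1) → O} {s : Fin (d + 1) → L}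

theorem pow_dvd_of_mem_maximalIdeal_pow {B : Type*} [CommRing B] (f : O →+* B) {b₀ : B}
    (hm : ∀ i, b₀ ∣ f (t i)) (ht : Ideal.span (Set.range t) = maximalIdeal O) {r : ℕ} {a : O}
    (ha : a ∈ maximalIdeal O ^ r) : b₀ ^ r ∣ f a := by
  have hle : (maximalIdeal O).map f ≤ Ideal.span {b₀} := by
    rw [← ht, Ideal.map_span, Ideal.span_le]
    rintro _ ⟨_, ⟨i, rfl⟩, rfl⟩
    exact Ideal.mem_span_singleton.mpr (hm i)
  rw [← Ideal.mem_span_singleton, ← Ideal.span_singleton_pow]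
  exact Ideal.pow_right_mono hle r (Ideal.map_pow f _ r ▸ Ideal.mem_map_of_mem f ha)

variable {v : Valuation K (WithZero (Multiplicative ℤ))}

theorem exists_mem_maximalIdeal_pow_of_integers [IsFractionRing O K]
    (hv : IsOrderValuation O v) (hL : v.Integers L) (y : L) :
    ∃ (r : ℕ) (a b : O), a ∈ maximalIdeal O ^ r ∧ b ∈ maximalIdeal O ^ r ∧
      v (algebraMap O K b) = exp (-(r : ℤ)) ∧
      algebraMap O K a = algebraMap L K y * algebraMap O K b := by
  obtain ⟨a, b, hb, hab⟩ := IsFractionRing.div_surjective (A := O) (algebraMap L K y)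
  have hb0 : algebraMap O K b ≠ 0 := IsFractionRing.to_map_ne_zero_of_mem_nonZeroDivisors hb
  have hya : algebraMap O K a = algebraMap L K y * algebraMap O K b :=
    ((div_eq_iff hb0).mp hab)
  obtain ⟨r, hr⟩ := exists_eq_exp_neg (v.ne_zero_iff.mpr hb0) (hv.le_one b)
  refine ⟨r, a, b, (hv a r).mp ?_, (hv b r).mp hr.le, hr, hya⟩
  rw [hya, map_mul, hr]
  exact mul_le_of_le_one_left' (hL.map_le_one y)

theorem finrank_kaehlerDifferential_eq_card {ι : Type*} [Fintype ι] [IsFractionRing O K]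
    {t : ι → O} (ht : IsCoordinateSystem k t) :
    Module.finrank K (Ω[K⁄k]) = Fintype.card ι :=
  Module.finrank_eq_card_basis (Module.Basis.mk (linearIndependent_D_algebraMap
    ht.linearIndependent_D) (span_D_algebraMap ht.span_D).ge)

theorem linearIndependent_D_of_hom_inj [IsFractionRing O K] (ht : IsCoordinateSystem k t)
    (h0 : algebraMap O K (t 0) ≠ 0) (hinj : Function.Injective (algebraMap L K))
    (hs : ∀ i, algebraMap L K (s i) = blowupCoordinates (algebraMap O K ∘ t) i) :
    LinearIndependent L fun i => D k L (s i) := by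
  have hspan := span_D_blowupCoordinates h0 (span_D_algebraMap (B := K) ht.span_D)
  have hli : LinearIndependent K fun i => D k K (algebraMap L K (s i)) := by
    simp only [hs]
    exact linearIndependent_of_top_le_span_of_card_eq_finrank hspan.ge
      (finrank_kaehlerDifferential_eq_card ht).symm
  have : FaithfulSMul L K := (faithfulSMul_iff_algebraMap_injective L K).mpr hinj
  refine LinearIndependent.of_comp (KaehlerDifferential.map k k L K) ?_
  simpa only [Function.comp_def, KaehlerDifferential.map_D] using hli.restrict_scalars' L

variable [Algebra.FormallySmooth k O]

theorem exists_mem_subalgebraOfDMem_pow_mul_eq (ht : IsCoordinateSystem k t)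
    (hv : IsOrderValuation O v) (hL : v.Integers L)
    (hs : ∀ i, algebraMap L K (s i) = blowupCoordinates (algebraMap O K ∘ t) i)
    {N : Submodule L (Ω[L⁄k])} (hN : ∀ i, D k L (s i) ∈ N) {r : ℕ} {a : O}
    (ha : a ∈ maximalIdeal O ^ r) :
    ∃ b ∈ subalgebraOfDMem N, algebraMap O K a = algebraMap L K (s 0 ^ r * b) := by
  obtain ⟨ι, hι⟩ := exists_algHom_of_integers (k := k) hL hv.le_one
  have ht0 : ι (t 0) = s 0 := hL.hom_inj ((hι _).trans (hs 0).symm)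
  have htsucc (i : Fin d) : ι (t i.succ) = s 0 * s i.succ := hL.hom_inj <| by
    rw [map_mul, hι, hs, hs]
    exact eq_mul_blowupCoordinates (t := algebraMap O K ∘ t)
      (algebraMap_coordinate_ne_zero ht hv 0) i
  have hιN (a) : ι a ∈ subalgebraOfDMem N := by
    let : Algebra O L := ι.toRingHom.toAlgebra
    have : IsScalarTower k O L := IsScalarTower.of_algebraMap_eq fun c => (ι.commutes c).symm
    refine D_algebraMap_mem_of_span_D ht.span_D N (Fin.cases ?_ fun i => ?_) a
    · exact ht0 ▸ hN 0
    · exact htsucc i ▸ (subalgebraOfDMem N).mul_mem (hN 0) (hN i.succ)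
  obtain ⟨b, hb⟩ := pow_dvd_of_mem_maximalIdeal_pow
    (ι.codRestrict (subalgebraOfDMem N) hιN).toRingHom (b₀ := ⟨s 0, hN 0⟩)
    (Fin.cases ⟨1, Subtype.ext (by simpa using ht0)⟩
      fun i => ⟨⟨s i.succ, hN i.succ⟩, Subtype.ext (htsucc i)⟩) ht.span_eq ha
  exact ⟨b, b.2, (hι a).symm.trans (congrArg (algebraMap L K) (congrArg Subtype.val hb))⟩

theorem span_D_eq_top_of_integers [IsFractionRing O K]
    (ht : IsCoordinateSystem k t) (hv : IsOrderValuation O v) (hL : v.Integers L)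
    (hs : ∀ i, algebraMap L K (s i) = blowupCoordinates (algebraMap O K ∘ t) i) :
    Submodule.span L (Set.range fun i => D k L (s i)) = ⊤ := by
  rw [eq_top_iff, ← KaehlerDifferential.span_range_derivation, Submodule.span_le]
  rintro _ ⟨y, rfl⟩
  obtain ⟨r, a, b, ha, hb, hvb, hab⟩ := exists_mem_maximalIdeal_pow_of_integers hv hL y
  have hD (i) : D k L (s i) ∈ Submodule.span L (Set.range fun i => D k L (s i)) :=
    Submodule.subset_span ⟨i, rfl⟩
  obtain ⟨a', ha', haa'⟩ := exists_mem_subalgebraOfDMem_pow_mul_eq ht hv hL hs hD ha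
  obtain ⟨b', hb', hbb'⟩ := exists_mem_subalgebraOfDMem_pow_mul_eq ht hv hL hs hD hb
  have hs0 : v (algebraMap L K (s 0)) = exp (-1) := (hs 0).symm ▸ valuation_coordinate ht hv 0
  have hvb' : v (algebraMap L K b') = 1 := by
    rw [hbb', map_mul, map_mul, map_pow, map_pow, hs0, ← exp_nsmul, smul_neg, nsmul_one] at hvb
    exact mul_left_cancel₀ exp_ne_zero (hvb.trans (mul_one _).symm)
  have hya : y * b' = a' := by
    have := hL.hom_inj.isDomain (algebraMap L K)
    have hs0' : s 0 ≠ 0 := (irreducible_of_valuation_eq_exp_neg_one hL hs0).ne_zero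
    rw [haa', hbb', ← map_mul, hL.hom_inj.eq_iff, mul_left_comm] at hab
    exact (mul_left_cancel₀ (pow_ne_zero r hs0') hab).symm
  exact mem_subalgebraOfDMem_of_mul_mem (hL.isUnit_of_one' hvb') hb' (hya ▸ ha')

end Coordinates

end ExceptionalValuationRing

/-! ### Local rings and orders on varieties -/

section Localization

variable {A O K : Type*} [CommRing A] [CommRing O] [Field K] [Algebra A O] [Algebra A K]
  [Algebra O K] [IsScalarTower A O K] [IsFractionRing A K] (m : Ideal A) [m.IsPrime]
  [IsLocalization.AtPrime O m]

open IsLocalization (IsInteger)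

theorem isInteger_iff_exists_notMem_isInteger_smul (f : K) :
    IsInteger O f ↔ ∃ s ∉ m, IsInteger A (s • f) := by
  constructor
  · rintro ⟨r, rfl⟩
    obtain ⟨⟨a, s⟩, h⟩ := IsLocalization.surj m.primeCompl r
    refine ⟨s, s.2, a, ?_⟩
    rw [IsScalarTower.algebraMap_apply A O K, ← h, map_mul, Algebra.smul_def, mul_comm,
      ← IsScalarTower.algebraMap_apply]
  · rintro ⟨s, hs, a, h⟩
    have hs0 : algebraMap A K s ≠ 0 := by
      rw [Ne, FaithfulSMul.algebraMap_eq_zero_iff]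
      exact fun h0 => hs (h0 ▸ m.zero_mem)
    obtain ⟨r, hr⟩ : ∃ r, algebraMap A O s * r = algebraMap A O a :=
      ⟨_, IsLocalization.mk'_spec' O a (⟨s, hs⟩ : m.primeCompl)⟩
    refine ⟨r, mul_left_cancel₀ hs0 ?_⟩
    rw [← Algebra.smul_def s f, ← h, IsScalarTower.algebraMap_apply A O K, ← map_mul, hr,
      ← IsScalarTower.algebraMap_apply]

theorem isInteger_of_forall_height_eq_one [IsDomain A] [IsNoetherianRing A]
    [IsFractionRing O K] [IsIntegrallyClosed O] (f : K)
    (hf : ∀ p : Ideal A, p.IsPrime → p ≤ m → p.height = 1 → ∃ s ∉ p, IsInteger A (s • f)) :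
    IsInteger O f :=
  (isInteger_iff_exists_notMem_isInteger_smul m f).mpr <|
    exists_isInteger_smul_of_forall_height_eq_one m (fun _ hz =>
      (isInteger_iff_exists_notMem_isInteger_smul m _).mp
        (IsIntegrallyClosed.isIntegral_iff.mp (hz.tower_top (A := O)))) f hf

end Localization

theorem one_le_ordFrac_iff {R K : Type*} [CommRing R] [IsDomain R] [IsDiscreteValuationRing R]
    [Field K] [Algebra R K] [IsFractionRing R K] {f : K} (hf : f ≠ 0) :
    1 ≤ Ring.ordFrac R f ↔ IsLocalization.IsInteger R f := by
  have hv : (IsDiscreteValuationRing.maximalIdeal R).valuation K f ≠ 0 := by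
    rwa [Valuation.ne_zero_iff]
  rw [Ring.ordFrac_eq_valuation_inv, one_le_inv₀ (zero_lt_iff.mpr hv)]
  refine ⟨IsDiscreteValuationRing.exists_lift_of_le_one, ?_⟩
  rintro ⟨r, rfl⟩
  exact IsDedekindDomain.HeightOneSpectrum.valuation_le_one _ r

namespace Variety

variable {k : Type u} [Field k] (V : Variety k)

section Ord

theorem ord_mul {f g : V.K} (hf : f ≠ 0) (hg : g ≠ 0) (P : V.PrimeDivisor) :
    V.ord (f * g) P = V.ord f P + V.ord g P := Scheme.ord_mul hf hg

theorem ord_one (P : V.PrimeDivisor) : V.ord 1 P = 0 := by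
  simpa using V.ord_mul one_ne_zero one_ne_zero P

theorem ord_inv {f : V.K} (hf : f ≠ 0) (P : V.PrimeDivisor) : V.ord f⁻¹ P = -V.ord f P := by
  have h := V.ord_mul hf (inv_ne_zero hf) P
  rw [mul_inv_cancel₀ hf, ord_one] at h
  exact eq_neg_of_add_eq_zero_right h.symm

theorem ord_pow {f : V.K} (hf : f ≠ 0) (n : ℕ) (P : V.PrimeDivisor) :
    V.ord (f ^ n) P = n * V.ord f P := by
  induction n with
  | zero => simp [ord_one]
  | succ n ih =>
    rw [pow_succ, V.ord_mul (pow_ne_zero _ hf) hf, ih]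
    push_cast
    ring

theorem ord_zpow {f : V.K} (hf : f ≠ 0) (n : ℤ) (P : V.PrimeDivisor) :
    V.ord (f ^ n) P = n * V.ord f P := by
  obtain ⟨m, rfl | rfl⟩ := n.eq_nat_or_neg
  · simpa using V.ord_pow hf m P
  · rw [zpow_neg, V.ord_inv (zpow_ne_zero _ hf), zpow_natCast, V.ord_pow hf, neg_mul]

theorem ord_prod_zpow {ι : Type*} (s : Finset ι) {f : ι → V.K} (hf : ∀ i, f i ≠ 0) (q : ι → ℤ)
    (P : V.PrimeDivisor) : V.ord (∏ i ∈ s, f i ^ q i) P = ∑ i ∈ s, q i * V.ord (f i) P := by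
  classical
  induction s using Finset.induction_on with
  | empty => simp [ord_one]
  | insert a s ha ih =>
    rw [Finset.prod_insert ha, Finset.sum_insert ha, V.ord_mul (zpow_ne_zero _ (hf a))
      (Finset.prod_ne_zero_iff.mpr fun i _ => zpow_ne_zero _ (hf i)), ih, V.ord_zpow (hf a)]

theorem ord_nonneg_iff_isInteger [V.IsNormal] {f : V.K} (hf : f ≠ 0) (P : V.PrimeDivisor) :
    0 ≤ V.ord f P ↔ IsLocalization.IsInteger (V.X.presheaf.stalk P.1) f := by
  have := V.isDiscreteValuationRing_stalk P
  rw [← one_le_ordFrac_iff hf]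
  exact Scheme.le_ord_iff P.2 hf

theorem ord_algebraMap_irreducible [V.IsNormal] (P : V.PrimeDivisor) {ϖ : V.X.presheaf.stalk P.1}
    (hϖ : Irreducible ϖ) : V.ord (algebraMap _ V.K ϖ) P = 1 := by
  have := V.isDiscreteValuationRing_stalk P
  have h0 : algebraMap (V.X.presheaf.stalk P.1) V.K ϖ ≠ 0 := by
    simpa only [Ne, FaithfulSMul.algebraMap_eq_zero_iff] using hϖ.ne_zero
  exact (Scheme.ord_eq_iff P.2 h0).mpr (Ring.ordFrac_irreducible hϖ)

end Ord

section Topology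

instance instCompactSpace : CompactSpace V.X :=
  have := V.quasiCompact
  QuasiCompact.compactSpace_of_compactSpace V.str

instance instIsNoetherian : IsNoetherian V.X where

theorem genericPoint_specializes (y : V.X) : genericPoint V.X ⤳ y :=
  (genericPoint_spec V.X).specializes trivial

theorem genericPoint_mem (W : V.X.Opens) [Nonempty W] : genericPoint V.X ∈ W :=
  (V.genericPoint_specializes (Classical.arbitrary W).1).mem_open W.2 (Classical.arbitrary W).2

theorem isMax_iff_eq_genericPoint {y : V.X} : IsMax y ↔ y = genericPoint V.X := by
  constructor
  · intro h
    have hle : y ≤ genericPoint V.X :=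
      Scheme.le_iff_specializes.mpr (V.genericPoint_specializes y)
    exact (Specializes.antisymm (Scheme.le_iff_specializes.mp (h hle))
      (V.genericPoint_specializes y)).eq
  · rintro rfl z -
    exact Scheme.le_iff_specializes.mpr (V.genericPoint_specializes z)

theorem eq_of_specializes_primeDivisor (P : V.PrimeDivisor) {y : V.X} (hy : y ⤳ P.1)
    (hne : y ≠ genericPoint V.X) : y = P.1 := by
  by_contra hyP
  have hlt : P.1 < y := lt_of_le_not_ge (Scheme.le_iff_specializes.mpr hy)
    fun h => hyP (hy.antisymm (Scheme.le_iff_specializes.mp h)).eq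
  have hle := Order.coheight_add_one_le hlt
  rw [P.2] at hle
  have hy0 : Order.coheight y = 0 := by
    simpa using (ENat.add_le_add_iff_right (by decide : (1 : ℕ∞) ≠ ⊤)).mp
      (hle.trans (zero_add 1).ge)
  exact hne (V.isMax_iff_eq_genericPoint.mp (Order.coheight_eq_zero.mp hy0))

theorem finite_setOf_ord_ne_zero {f : V.K} (hf : f ≠ 0) :
    {P : V.PrimeDivisor | V.ord f P ≠ 0}.Finite := by
  obtain ⟨U, _, f', hU, rfl, hf'⟩ := exists_isUnit_germ_eq V.X f hf
  obtain ⟨S, hSf, hSc, hSi, hS⟩ :=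
    TopologicalSpace.NoetherianSpace.exists_finite_set_isClosed_irreducible U.isOpen.isClosed_compl
  -- A prime divisor outside `U` is the generic point of one of the components of the complement.
  refine Set.Finite.of_finite_image (f := fun P : V.PrimeDivisor => closure {P.1})
    (hSf.subset ?_) ?_
  · rintro _ ⟨P, hP, rfl⟩
    have hPU : P.1 ∈ (U : Set V.X)ᶜ := fun h => hP (Scheme.ord_of_isUnit hf' h)
    rw [hS] at hPU
    obtain ⟨T, hT, hPT⟩ := hPU
    obtain ⟨y, hy⟩ := QuasiSober.sober (hSi T hT) (hSc T hT)
    have hyU : y ∈ (U : Set V.X)ᶜ := hS ▸ ⟨T, hT, hy.mem⟩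
    have hyP : y = P.1 := V.eq_of_specializes_primeDivisor P (hy.specializes hPT)
      fun h => hyU (h ▸ V.genericPoint_mem U)
    simpa only [← hyP, hy.def] using hT
  · exact fun P _ Q _ h => Subtype.ext (inseparable_iff_closure_eq.mpr h).eq

theorem exists_primeDivisor_specializes (x : V.X)
    (hx : ¬ IsField (V.X.presheaf.stalk x)) : ∃ P : V.PrimeDivisor, P.1 ⤳ x := by
  have hdim := ringKrullDim_stalk_eq_coheight x
  have hfin : Order.coheight x < ⊤ := by
    have := ringKrullDim_lt_top (R := V.X.presheaf.stalk x)
    rwa [hdim, ← WithBot.coe_top, WithBot.coe_lt_coe] at this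
  have hpos : 1 ≤ Order.coheight x := by
    rw [Order.one_le_iff_ne_zero]
    rintro h
    rw [h] at hdim
    have : Ring.KrullDimLE 0 (V.X.presheaf.stalk x) := by
      rw [Ring.krullDimLE_iff, hdim]; rfl
    exact hx Ring.KrullDimLE.isField_of_isDomain
  obtain h | h := hpos.eq_or_lt
  · exact ⟨⟨x, h.symm⟩, specializes_rfl⟩
  · obtain ⟨y, hxy, hy⟩ := (Order.coe_lt_coheight_iff (n := 1) hfin).mp h
    exact ⟨⟨y, hy⟩, Scheme.le_iff_specializes.mp hxy.le⟩

end Topology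

section Affine

variable {V} {W : V.X.Opens} (hW : IsAffineOpen W)

theorem exists_specializes_of_le_primeIdealOf {x : V.X} (hx : x ∈ W) (p : Ideal Γ(V.X, W))
    [hp : p.IsPrime] (hpx : p ≤ (hW.primeIdealOf ⟨x, hx⟩).asIdeal) :
    ∃ (y : V.X) (hy : y ∈ W), y ⤳ x ∧ (hW.primeIdealOf ⟨y, hy⟩).asIdeal = p := by
  let q : PrimeSpectrum Γ(V.X, W) := ⟨p, hp⟩
  have hqW : hW.fromSpec q ∈ W := by
    have : hW.fromSpec q ∈ Set.range hW.fromSpec := ⟨q, rfl⟩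
    rwa [hW.range_fromSpec] at this
  refine ⟨_, hqW, ?_, ?_⟩
  · have hq : q ⤳ hW.primeIdealOf ⟨x, hx⟩ := (PrimeSpectrum.le_iff_specializes _ _).mp hpx
    simpa only [hW.fromSpec_primeIdealOf] using hq.map hW.fromSpec.continuous
  · exact congrArg PrimeSpectrum.asIdeal
      (hW.fromSpec.isOpenEmbedding.injective (hW.fromSpec_primeIdealOf ⟨_, hqW⟩))

theorem coheight_eq_height_primeIdealOf {y : V.X} (hy : y ∈ W) :
    Order.coheight y = (hW.primeIdealOf ⟨y, hy⟩).asIdeal.height := by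
  have := hW.isLocalization_stalk ⟨y, hy⟩
  let _ := V.X.presheaf.algebra_section_stalk (⟨y, hy⟩ : W)
  have h := IsLocalization.AtPrime.ringKrullDim_eq_height (hW.primeIdealOf ⟨y, hy⟩).asIdeal
    (V.X.presheaf.stalk y)
  rw [ringKrullDim_stalk_eq_coheight] at h
  exact_mod_cast h

theorem isInteger_stalk_iff [Nonempty W] {y : V.X} (hy : y ∈ W) (f : V.K) :
    IsLocalization.IsInteger (V.X.presheaf.stalk y) f ↔
      ∃ s ∉ (hW.primeIdealOf ⟨y, hy⟩).asIdeal, IsLocalization.IsInteger Γ(V.X, W) (s • f) := by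
  have := functionField_isFractionRing_of_isAffineOpen V.X W hW
  have := hW.isLocalization_stalk ⟨y, hy⟩
  let _ := V.X.presheaf.algebra_section_stalk (⟨y, hy⟩ : W)
  have := functionField_isScalarTower V.X W ⟨y, hy⟩
  exact isInteger_iff_exists_notMem_isInteger_smul _ f

end Affine

theorem isInteger_stalk_of_ord_nonneg [V.IsNormal] (x : V.X) (f : V.K)
    (hf : ∀ P : V.PrimeDivisor, P.1 ⤳ x → 0 ≤ V.ord f P) :
    IsLocalization.IsInteger (V.X.presheaf.stalk x) f := by
  by_cases hf0 : f = 0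
  · exact hf0 ▸ IsLocalization.isInteger_zero
  obtain ⟨W, hW, hx, -⟩ := exists_isAffineOpen_mem_and_subset (x := x) (U := ⊤) trivial
  have : Nonempty W := ⟨⟨x, hx⟩⟩
  have := functionField_isFractionRing_of_isAffineOpen V.X W hW
  have := hW.isLocalization_stalk ⟨x, hx⟩
  let _ := V.X.presheaf.algebra_section_stalk (⟨x, hx⟩ : W)
  have := functionField_isScalarTower V.X W ⟨x, hx⟩
  have : IsNoetherianRing Γ(V.X, W) := IsLocallyNoetherian.component_noetherian ⟨W, hW⟩
  have := IsNormal.isIntegrallyClosed (V := V) x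
  refine isInteger_of_forall_height_eq_one (hW.primeIdealOf ⟨x, hx⟩).asIdeal f
    fun p hp hpx hp1 => ?_
  obtain ⟨y, hy, hyx, rfl⟩ := exists_specializes_of_le_primeIdealOf hW hx p hpx
  have hy1 : Order.coheight y = 1 := (coheight_eq_height_primeIdealOf hW hy).trans hp1
  exact (isInteger_stalk_iff hW hy f).mp
    ((V.ord_nonneg_iff_isInteger hf0 ⟨y, hy1⟩).mp (hf ⟨y, hy1⟩ hyx))

section Scalars

instance instIsScalarTowerStalk (x : V.X) : IsScalarTower k (V.X.presheaf.stalk x) V.K :=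
  IsScalarTower.of_algebraMap_eq fun c =>
    have : Nonempty (⊤ : V.X.Opens) := ⟨⟨x, trivial⟩⟩
    (Scheme.algebraMap_germ_eq_germToFunctionField (X := V.X) (U := ⊤) (x := x) trivial
      (V.constants c)).symm

/-- The ring homomorphism from `k` to the functions on an open set. -/
def sectionConstants (W : V.X.Opens) : k →+* Γ(V.X, W) :=
  (V.X.presheaf.map (homOfLE le_top).op).hom.comp V.constants

theorem germ_sectionConstants {W : V.X.Opens} {x : V.X} (hx : x ∈ W) (c : k) :
    V.X.presheaf.germ W x hx (V.sectionConstants W c) = algebraMap k (V.X.presheaf.stalk x) c :=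
  V.X.presheaf.germ_res_apply (homOfLE le_top) x hx (V.constants c)

theorem sectionConstants_eq (W : V.X.Opens) : V.sectionConstants W =
    ((Scheme.ΓSpecIso (CommRingCat.of k)).inv ≫ V.str.appLE ⊤ W le_top).hom := by
  rw [sectionConstants, constants, ← CommRingCat.hom_comp, Category.assoc]
  rfl

theorem finiteType_sectionConstants {W : V.X.Opens} (hW : IsAffineOpen W) :
    (V.sectionConstants W).FiniteType := by
  have := V.locallyOfFiniteType
  rw [sectionConstants_eq, CommRingCat.hom_comp]
  exact (V.str.finiteType_appLE (isAffineOpen_top _) hW le_top).comp <|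
    RingHom.FiniteType.of_surjective _
      (Scheme.ΓSpecIso (CommRingCat.of k)).symm.commRingCatIsoToRingEquiv.surjective

theorem essFiniteType_stalk (x : V.X) : Algebra.EssFiniteType k (V.X.presheaf.stalk x) := by
  obtain ⟨W, hW, hx, -⟩ := exists_isAffineOpen_mem_and_subset (x := x) (U := ⊤) trivial
  have := hW.isLocalization_stalk ⟨x, hx⟩
  let _ := V.X.presheaf.algebra_section_stalk (⟨x, hx⟩ : W)
  let _ : Algebra k Γ(V.X, W) := (V.sectionConstants W).toAlgebra
  have : Algebra.FiniteType k Γ(V.X, W) := V.finiteType_sectionConstants hW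
  have : IsScalarTower k Γ(V.X, W) (V.X.presheaf.stalk x) :=
    IsScalarTower.of_algebraMap_eq fun c => (V.germ_sectionConstants hx c).symm
  have : Algebra.EssFiniteType Γ(V.X, W) (V.X.presheaf.stalk x) :=
    Algebra.EssFiniteType.of_isLocalization _ (hW.primeIdealOf ⟨x, hx⟩).asIdeal.primeCompl
  exact Algebra.EssFiniteType.comp k Γ(V.X, W) _

theorem specMap_algebraMap_stalk (x : V.X) :
    Spec.map (CommRingCat.ofHom (algebraMap k (V.X.presheaf.stalk x))) =
      V.X.fromSpecStalk x ≫ V.str := by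
  have h : CommRingCat.ofHom (algebraMap k (V.X.presheaf.stalk x)) =
      (Scheme.ΓSpecIso (CommRingCat.of k)).inv ≫ V.str.appTop ≫ V.X.presheaf.germ ⊤ x trivial := rfl
  rw [h, Spec.map_comp, Spec.map_comp, ← Scheme.fromSpecStalk_toSpecΓ, Category.assoc,
    Category.assoc, ← Scheme.toSpecΓ_naturality_assoc, ← SpecMap_ΓSpecIso_hom, ← Spec.map_comp,
    Iso.inv_hom_id, Spec.map_id, Category.comp_id]

theorem algebraMap_residueField_surjective_of_isClosed [IsAlgClosed k] {x : V.X}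
    (hx : IsClosed {x}) : Function.Surjective
      (algebraMap k (IsLocalRing.ResidueField (V.X.presheaf.stalk x))) := by
  have := V.locallyOfFiniteType
  have h : CommRingCat.ofHom (algebraMap k (V.X.presheaf.stalk x)) ≫ V.X.residue x =
      (residueFieldIsoBase V.str x hx).inv := by
    apply Spec.map_injective
    rw [SpecMap_residueFieldIsoBase_inv, Spec.map_comp, specMap_algebraMap_stalk,
      Scheme.fromSpecResidueField, Category.assoc]
  have hsurj := (residueFieldIsoBase V.str x hx).symm.commRingCatIsoToRingEquiv.surjective
  intro y
  obtain ⟨c, hc⟩ := hsurj y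
  exact ⟨c, (ConcreteCategory.congr_hom h c).trans hc⟩

theorem formallySmooth_stalk {x : V.X} (hx : V.IsSmoothAt x) :
    Algebra.FormallySmooth k (V.X.presheaf.stalk x) := by
  obtain ⟨U, hxU, hU⟩ := hx
  have := V.locallyOfFiniteType
  have : LocallyOfFinitePresentation V.str := inferInstance
  have hmem : x ∈ V.str.smoothLocus := by
    have hpre := Scheme.Hom.preimage_smoothLocus_eq U.ι V.str
    rw [Scheme.Hom.smoothLocus_eq_top (U.ι ≫ V.str)] at hpre
    exact hpre.ge (show (⟨x, hxU⟩ : U) ∈ (⊤ : Scheme.Opens U) from trivial)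
  have hcomp : algebraMap k (V.X.presheaf.stalk x) =
      (V.str.stalkMap x).hom.comp (StructureSheaf.toStalk k (V.str x)).hom := by
    ext c
    exact (Scheme.Hom.germ_stalkMap_apply V.str ⊤ x trivial _).symm
  rw [← RingHom.formallySmooth_algebraMap, hcomp]
  refine RingHom.FormallySmooth.comp ?_ (V.str.mem_smoothLocus.mp hmem)
  let p : PrimeSpectrum k := V.str x
  let _ := (StructureSheaf.toStalk k p).hom.toAlgebra
  have := StructureSheaf.IsLocalization.to_stalk k p
  exact RingHom.formallySmooth_algebraMap.mpr
    (Algebra.FormallySmooth.of_isLocalization (R := k)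
      (Rₘ := (Spec.structureSheaf k).presheaf.stalk p) p.asIdeal.primeCompl)

end Scalars

end Variety

/-! ### Affine varieties and divisors over a variety -/

section SpecHom

variable {X : Scheme.{u}} {U : X.Opens} (hU : IsAffineOpen U) {R : CommRingCat.{u}}
  (φ : Γ(X, U) ⟶ R)

theorem specMap_fromSpec_comp {k : CommRingCat.{u}} (g : X ⟶ Spec k) :
    (Spec.map φ ≫ hU.fromSpec) ≫ g =
      Spec.map ((Scheme.ΓSpecIso k).inv ≫ g.appLE ⊤ U le_top ≫ φ) := by
  rw [Category.assoc, ← IsAffineOpen.SpecMap_appLE_fromSpec g (isAffineOpen_top _) hU le_top,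
    IsAffineOpen.fromSpec_top, Scheme.isoSpec_Spec_inv, ← Spec.map_comp, ← Spec.map_comp,
    Category.assoc]

theorem specMap_fromSpec_apply {y : X} (hy : y ∈ U) (p : PrimeSpectrum R)
    (h : ∀ a, φ a ∈ p.asIdeal ↔ a ∈ (hU.primeIdealOf ⟨y, hy⟩).asIdeal) :
    (Spec.map φ ≫ hU.fromSpec) p = y := by
  have hcomap : Spec.map φ p = hU.primeIdealOf ⟨y, hy⟩ := PrimeSpectrum.ext (Ideal.ext h)
  exact (congrArg hU.fromSpec hcomap).trans (hU.fromSpec_primeIdealOf ⟨y, hy⟩)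

theorem specMap_fromSpec_stalkMap (p : Spec R) (hp : (Spec.map φ ≫ hU.fromSpec) p ∈ U)
    (a : Γ(X, U)) :
    (Spec.map φ ≫ hU.fromSpec).stalkMap p (X.presheaf.germ U _ hp a) =
      (Spec R).presheaf.germ ⊤ p trivial ((Scheme.ΓSpecIso R).inv (φ a)) := by
  have htop : (Spec.map φ ≫ hU.fromSpec) ⁻¹ᵁ U = ⊤ := by
    rw [Scheme.Hom.comp_preimage, hU.fromSpec_preimage_self]; rfl
  have happ : (Spec.map φ ≫ hU.fromSpec).appLE U ⊤ htop.ge = φ ≫ (Scheme.ΓSpecIso R).inv := by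
    rw [Scheme.Hom.comp_appLE, hU.fromSpec_app_self, Scheme.ΓSpecIso_inv_naturality,
      Category.assoc]
    rw [Scheme.Hom.appTop, ← Scheme.Hom.appLE_eq_app]
    exact congrArg ((Scheme.ΓSpecIso Γ(X, U)).inv ≫ ·) (Scheme.Hom.map_appLE (Spec.map φ)
      (show ⊤ ≤ Spec.map φ ⁻¹ᵁ hU.fromSpec ⁻¹ᵁ U from htop.ge)
      (eqToHom hU.fromSpec_preimage_self).op)
  rw [Scheme.Hom.germ_stalkMap_apply]
  refine ((Spec R).presheaf.germ_res_apply (homOfLE htop.ge) p trivial _).symm.trans ?_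
  exact congrArg _ (ConcreteCategory.congr_hom happ a)

end SpecHom

namespace Variety

variable {k : Type u} [Field k] (V : Variety k)

section Affine

variable (C : Type u) [CommRing C] [IsDomain C] [Algebra k C] [Algebra.FiniteType k C]

/-- The affine variety of a finitely generated domain. -/
def affine : Variety k where
  X := Spec (CommRingCat.of C)
  str := Spec.map (CommRingCat.ofHom (algebraMap k C))
  isIntegral := inferInstance
  isSeparated := inferInstance
  locallyOfFiniteType := by
    rw [HasRingHomProperty.Spec_iff (P := @LocallyOfFiniteType)]
    exact RingHom.finiteType_algebraMap.mpr inferInstance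
  quasiCompact := inferInstance

/-- A point of an affine variety, given by a prime ideal. -/
def affinePoint (p : PrimeSpectrum C) : (affine (k := k) C).X := p

instance instAlgebraStalkAffine (p : PrimeSpectrum C) :
    Algebra C ((affine (k := k) C).X.presheaf.stalk (affinePoint C p)) :=
  (StructureSheaf.toStalk C p).hom.toAlgebra

instance instIsLocalizationStalkAffine (p : PrimeSpectrum C) :
    IsLocalization.AtPrime ((affine (k := k) C).X.presheaf.stalk (affinePoint C p)) p.asIdeal :=
  StructureSheaf.IsLocalization.to_stalk C p

theorem germ_top_ΓSpecIso_inv (p : PrimeSpectrum C) (c : C) :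
    (affine (k := k) C).X.presheaf.germ ⊤ (affinePoint C p) trivial
      ((Scheme.ΓSpecIso (CommRingCat.of C)).inv c) =
    algebraMap C ((affine (k := k) C).X.presheaf.stalk (affinePoint C p)) c :=
  rfl

theorem affine_constants (c : k) : (affine (k := k) C).constants c =
    (Scheme.ΓSpecIso (CommRingCat.of C)).inv (algebraMap k C c) :=
  (ConcreteCategory.congr_hom
    (Scheme.ΓSpecIso_inv_naturality (CommRingCat.ofHom (algebraMap k C))) c).symm

instance instIsScalarTowerStalkAffine (p : PrimeSpectrum C) :
    IsScalarTower k C ((affine (k := k) C).X.presheaf.stalk (affinePoint C p)) :=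
  IsScalarTower.of_algebraMap_eq fun c => by
    rw [← germ_top_ΓSpecIso_inv, ← affine_constants]
    rfl

instance instIsNormalAffine [IsIntegrallyClosed C] : (affine (k := k) C).IsNormal where
  isIntegrallyClosed p := by
    let q : PrimeSpectrum C := p
    exact isIntegrallyClosed_of_isLocalization
      ((affine (k := k) C).X.presheaf.stalk (affinePoint C q))
      q.asIdeal.primeCompl q.asIdeal.primeCompl_le_nonZeroDivisors

theorem coheight_affinePoint (p : PrimeSpectrum C) [IsDiscreteValuationRing
    ((affine (k := k) C).X.presheaf.stalk (affinePoint C p))] :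
    Order.coheight (affinePoint (k := k) C p) = 1 := by
  have hdim := ringKrullDim_stalk_eq_coheight (affinePoint (k := k) C p)
  rw [IsDiscreteValuationRing.ringKrullDim_eq_one] at hdim
  exact_mod_cast hdim.symm

/-- The generic point of an affine variety. -/
def affineGeneric : PrimeSpectrum C := genericPoint (Spec (CommRingCat.of C))

theorem affineGeneric_asIdeal : (affineGeneric C).asIdeal = ⊥ := by
  rw [affineGeneric, genericPoint_eq_bot_of_affine (CommRingCat.of C)]
  rfl

instance instAlgebraAffineK : Algebra C (affine (k := k) C).K :=
  instAlgebraStalkAffine C (affineGeneric C)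

instance instIsFractionRingAffineK : IsFractionRing C (affine (k := k) C).K := by
  have hloc := instIsLocalizationStalkAffine (k := k) C (affineGeneric C)
  have hcompl : (affineGeneric C).asIdeal.primeCompl = nonZeroDivisors C := by
    ext a
    rw [Ideal.mem_primeCompl_iff, affineGeneric_asIdeal, Ideal.mem_bot,
      mem_nonZeroDivisors_iff_ne_zero]
  rwa [IsLocalization.AtPrime, hcompl] at hloc

instance instIsScalarTowerAffineK (p : PrimeSpectrum C) :
    IsScalarTower C ((affine (k := k) C).X.presheaf.stalk (affinePoint C p))
      (affine (k := k) C).K :=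
  IsScalarTower.of_algebraMap_eq fun c =>
    (ConcreteCategory.congr_hom (StructureSheaf.toStalk_stalkSpecializes
      (R := C) ((affine (k := k) C).genericPoint_specializes p)) c).symm

end Affine

section Morphism

variable {V} {C : Type u} [CommRing C] [IsDomain C] [Algebra k C] [Algebra.FiniteType k C]
  {W : V.X.Opens} (hW : IsAffineOpen W) (φ : Γ(V.X, W) →+* C)

/-- The morphism from an affine variety given by a ring homomorphism. -/
def affineHom : (affine (k := k) C).X ⟶ V.X :=
  Spec.map (CommRingCat.ofHom φ) ≫ hW.fromSpec

theorem affineHom_comp_str (hφ : ∀ c, φ (V.sectionConstants W c) = algebraMap k C c) :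
    affineHom hW φ ≫ V.str = (affine (k := k) C).str := by
  refine (specMap_fromSpec_comp hW (CommRingCat.ofHom φ) V.str).trans ?_
  change _ = Spec.map _
  congr 1
  ext c
  rw [CommRingCat.hom_ofHom, ← hφ, sectionConstants_eq]
  rfl

theorem affineHom_eq {y : V.X} (hy : y ∈ W) (p : PrimeSpectrum C)
    (h : ∀ a, φ a ∈ p.asIdeal ↔ a ∈ (hW.primeIdealOf ⟨y, hy⟩).asIdeal) :
    affineHom hW φ (affinePoint C p) = y :=
  specMap_fromSpec_apply hW (CommRingCat.ofHom φ) hy p h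

theorem affineHom_stalkMap (p : PrimeSpectrum C) (hp : affineHom hW φ (affinePoint C p) ∈ W)
    (a : Γ(V.X, W)) :
    (affineHom hW φ).stalkMap (affinePoint C p) (V.X.presheaf.germ W _ hp a) =
      algebraMap C ((affine (k := k) C).X.presheaf.stalk (affinePoint C p)) (φ a) :=
  specMap_fromSpec_stalkMap hW (CommRingCat.ofHom φ) p hp a

theorem affineHom_genericPoint [Nonempty W] (hφ : Function.Injective φ) :
    affineHom (k := k) hW φ (genericPoint (affine (k := k) C).X) = genericPoint V.X := by
  refine affineHom_eq hW φ (V.genericPoint_mem W) (affineGeneric C) fun a => ?_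
  have hbot : (hW.primeIdealOf ⟨genericPoint V.X, V.genericPoint_mem W⟩).asIdeal = ⊥ := by
    rw [hW.primeIdealOf_genericPoint, genericPoint_eq_bot_of_affine]
    rfl
  rw [hbot, affineGeneric_asIdeal, Ideal.mem_bot, Ideal.mem_bot, map_eq_zero_iff φ hφ]

end Morphism

theorem bijective_stalkSpecializes_of_eq {X : Scheme.{u}} {x y : X} (h : x = y) :
    Function.Bijective (X.presheaf.stalkSpecializes (specializes_of_eq h)).hom := by
  subst h
  simpa using Function.bijective_id

section Chart

variable {V} {W : V.X.Opens} [Nonempty W] (hW : IsAffineOpen W) (C : Subalgebra k V.K)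
  (hWC : ∀ a, V.X.germToFunctionField W a ∈ C)

/-- The inclusion of the functions on `W` into `C`. -/
def toChart : Γ(V.X, W) →+* C := (V.X.germToFunctionField W).hom.codRestrict C hWC

theorem toChart_injective : Function.Injective (toChart C hWC) := fun _ _ h =>
  Scheme.germToFunctionField_injective V.X W (congrArg Subtype.val h)

theorem toChart_sectionConstants (c : k) :
    toChart C hWC (V.sectionConstants W c) = algebraMap k C c :=
  Subtype.ext (V.germ_sectionConstants _ c)

variable [Algebra.FiniteType k C]

/-- Pullback of rational functions along the morphism of a chart. -/
def chartPullback : V.K →+* (affine (k := k) C).K :=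
  (V.X.presheaf.stalkSpecializes
      (specializes_of_eq (affineHom_genericPoint hW _ (toChart_injective C hWC))) ≫
    (affineHom hW (toChart C hWC)).stalkMap (genericPoint (affine (k := k) C).X)).hom

theorem chartPullback_germ (a : Γ(V.X, W)) :
    chartPullback hW C hWC (V.X.germToFunctionField W a) =
      algebraMap C (affine (k := k) C).K (toChart C hWC a) := by
  have hg := affineHom_genericPoint (k := k) hW _ (toChart_injective C hWC)
  have hmem : affineHom (k := k) hW (toChart C hWC) (genericPoint (affine (k := k) C).X) ∈ W :=
    hg.symm ▸ V.genericPoint_mem W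
  refine Eq.trans ?_ (affineHom_stalkMap hW (toChart C hWC) (affineGeneric C) hmem a)
  refine congrArg ((affineHom hW (toChart C hWC)).stalkMap
    (genericPoint (affine (k := k) C).X)) ?_
  exact V.X.presheaf.germ_stalkSpecializes_apply _ (specializes_of_eq hg) _

theorem chartPullback_coe (c : C) :
    chartPullback hW C hWC (c : V.K) = algebraMap C (affine (k := k) C).K c := by
  have := functionField_isFractionRing_of_isAffineOpen V.X W hW
  obtain ⟨a, b, hb, hab⟩ := IsFractionRing.div_surjective (A := Γ(V.X, W)) (c : V.K)
  have hb0 : algebraMap Γ(V.X, W) V.K b ≠ 0 :=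
    IsFractionRing.to_map_ne_zero_of_mem_nonZeroDivisors hb
  have hK : (c : V.K) * algebraMap Γ(V.X, W) V.K b = algebraMap Γ(V.X, W) V.K a := by
    rw [← hab, div_mul_cancel₀ _ hb0]
  have hC : c * toChart C hWC b = toChart C hWC a := Subtype.ext hK
  refine mul_right_cancel₀ ((map_ne_zero (chartPullback hW C hWC)).mpr hb0) ?_
  calc chartPullback hW C hWC c * chartPullback hW C hWC (algebraMap Γ(V.X, W) V.K b)
      = chartPullback hW C hWC (algebraMap Γ(V.X, W) V.K a) := by rw [← map_mul, hK]
    _ = algebraMap C (affine (k := k) C).K (c * toChart C hWC b) := by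
      rw [hC]
      exact chartPullback_germ hW C hWC a
    _ = _ := by
      rw [map_mul]
      exact congrArg _ (chartPullback_germ hW C hWC b).symm

theorem chartPullback_bijective : Function.Bijective (chartPullback hW C hWC) := by
  refine ⟨(chartPullback hW C hWC).injective, fun y => ?_⟩
  obtain ⟨a, b, -, rfl⟩ := IsFractionRing.div_surjective (A := C) y
  exact ⟨a / b, by rw [map_div₀, chartPullback_coe, chartPullback_coe]⟩

/-- The prime divisor on a chart given by a prime ideal. -/
def chartDivisor [IsIntegrallyClosed C] (p : PrimeSpectrum C)
    (hp : Order.coheight (affinePoint (k := k) C p) = 1) : V.DivisorOver where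
  Y := affine C
  isNormal := inferInstance
  f := affineHom hW (toChart C hWC)
  comp_str := affineHom_comp_str hW _ (toChart_sectionConstants C hWC)
  map_genericPoint := affineHom_genericPoint hW _ (toChart_injective C hWC)
  bijective := by
    have hbij := chartPullback_bijective hW C hWC
    rw [chartPullback, CommRingCat.hom_comp, RingHom.coe_comp] at hbij
    exact (Function.Bijective.of_comp_iff _ (bijective_stalkSpecializes_of_eq
      (affineHom_genericPoint hW _ (toChart_injective C hWC)))).mp hbij
  E := ⟨affinePoint C p, hp⟩

end Chart

end Variety

section Determinant

variable {R M N ι : Type*} [CommRing R] [AddCommGroup M] [Module R M] [AddCommGroup N] [Module R N]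
  [Fintype ι] [DecidableEq ι]

theorem alternatingMap_apply_eq_det_smul (f : M [⋀^ι]→ₗ[R] N) (A : Matrix ι ι R) {s t : ι → M}
    (h : ∀ i, t i = ∑ j, A i j • s j) : f t = A.det • f s := by
  have heq : f.compLinearMap (Fintype.linearCombination R s) =
      (LinearMap.toSpanSingleton R N (f s)).compAlternatingMap Matrix.detRowAlternating := by
    refine Module.Basis.ext_alternating (Pi.basisFun R ι) fun σ hσ => ?_
    have hperm : (fun i => Pi.basisFun R ι (σ i)) =
        Pi.basisFun R ι ∘ Equiv.ofBijective σ (Finite.injective_iff_bijective.mp hσ) := rfl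
    have hdet : Matrix.detRowAlternating (R := R) (Pi.basisFun R ι) = 1 := by
      refine (congrArg Matrix.det ?_).trans (Matrix.det_one (n := ι))
      ext i j
      simp [Matrix.one_apply, Pi.single_apply, eq_comm]
    rw [hperm, AlternatingMap.map_perm, AlternatingMap.map_perm,
      LinearMap.compAlternatingMap_apply, hdet, LinearMap.toSpanSingleton_apply, one_smul,
      AlternatingMap.compLinearMap_apply]
    congr 2
    ext i
    simp [Fintype.linearCombination_apply, Pi.single_apply]
  have ht : t = fun i => Fintype.linearCombination R s (A i) :=
    funext fun i => (h i).trans (Fintype.linearCombination_apply R s (A i)).symm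
  rw [ht]
  exact congrArg (· A) heq

open KaehlerDifferential (D) in
theorem ιMulti_D_eq_pow_smul_of_eq_mul {k B : Type*} [CommRing k] [CommRing B] [Algebra k B] {d : ℕ}
    {s t : Fin (d + 1) → B} (h0 : t 0 = s 0) (h : ∀ i : Fin d, t i.succ = s 0 * s i.succ) :
    exteriorPower.ιMulti B (d + 1) (fun i => D k B (t i)) =
      s 0 ^ d • exteriorPower.ιMulti B (d + 1) fun i => D k B (s i) := by
  let A : Matrix (Fin (d + 1)) (Fin (d + 1)) B :=
    Fin.cons (Pi.single 0 1) fun i => Fin.cons (s i.succ) (Pi.single i (s 0))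
  have hdet : A.det = s 0 ^ d := by
    have hsub : A.submatrix Fin.succ Fin.succ = Matrix.diagonal fun _ => s 0 := by
      ext i j
      change Pi.single (M := fun _ => B) i (s 0) j = _
      simp only [Pi.single_apply, Matrix.diagonal_apply, eq_comm]
    rw [Matrix.det_succ_row_zero, Fin.sum_univ_succ]
    simp [A, hsub]
  rw [← hdet]
  refine alternatingMap_apply_eq_det_smul _ A fun i => ?_
  rw [Fin.sum_univ_succ]
  refine Fin.cases ?_ (fun i => ?_) i
  · simp [A, h0]
  · rw [h, Derivation.leibniz, add_comm]
    simp [A, Pi.single_apply]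

end Determinant

theorem IsAffineModel.integers_of_isLocalization {k K Γ L : Type*} [Field k] [Field K] [Algebra k K]
    [LinearOrderedCommGroupWithZero Γ] {v : Valuation K Γ} {C : Subalgebra k K}
    (hC : IsAffineModel v C) [CommRing L] [Algebra C L] [Algebra L K] [IsScalarTower C L K]
    [IsLocalization.AtPrime L (center v fun c : C => hC.valuation_le_one c c.2).asIdeal] :
    v.Integers L := by
  let p := center v fun c : C => hC.valuation_le_one c c.2
  have hcoe (c : C) : algebraMap L K (algebraMap C L c) = c :=
    (IsScalarTower.algebraMap_apply C L K c).symm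
  have := hC.isFractionRing
  have : IsFractionRing L K :=
    IsFractionRing.isFractionRing_of_isDomain_of_isLocalization p.asIdeal.primeCompl L K
  refine ⟨IsFractionRing.injective L K, fun l => ?_, fun y hy => ?_⟩
  · obtain ⟨⟨c, s⟩, hcs⟩ := IsLocalization.surj p.asIdeal.primeCompl l
    have hval := congrArg (fun a => v (algebraMap L K a)) hcs
    simp only [map_mul, hcoe] at hval
    have hvs : v (s : C) = 1 := valuation_eq_one_of_notMem_center s.2
    rw [hvs, mul_one] at hval
    exact hval ▸ hC.valuation_le_one c c.2
  · obtain ⟨c, hc, s, hs, hvs, hys⟩ := hC.exists_mul_eq y hy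
    have hsp : (⟨s, hs⟩ : C) ∉ p.asIdeal := fun h => (mem_center.mp h).ne hvs
    have hmul := congrArg (algebraMap L K)
      (IsLocalization.mk'_spec L (⟨c, hc⟩ : C) (⟨⟨s, hs⟩, hsp⟩ : p.asIdeal.primeCompl))
    rw [map_mul, hcoe, hcoe] at hmul
    exact ⟨_, mul_right_cancel₀ (v.ne_zero_iff.mp (hvs ▸ one_ne_zero)) (hmul.trans hys.symm)⟩

theorem exists_valuation_eq_exp_neg_one {k O K L ι : Type*} [Field k] [CommRing O] [IsLocalRing O]
    [Algebra k O] [Algebra.FormallySmooth k O] [Field K] [Algebra O K] [CommRing L] [Algebra L K]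
    {v : Valuation K (WithZero (Multiplicative ℤ))} {t : ι → O} (ht : IsCoordinateSystem k t)
    (hv : IsOrderValuation O v) (hL : v.Integers L) (i : ι) :
    ∃ π : L, v (algebraMap L K π) = WithZero.exp (-1) := by
  obtain ⟨π, hπ⟩ := hL.exists_of_le_one (hv.le_one (t i))
  exact ⟨π, hπ.symm ▸ valuation_coordinate ht hv i⟩

namespace Variety

variable {k : Type u} [Field k] {V : Variety k}

theorem algebraMap_stalk_ne_zero {x : V.X} {a : V.X.presheaf.stalk x} (ha : a ≠ 0) :
    algebraMap _ V.K a ≠ 0 :=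
  (map_ne_zero_iff _ (IsFractionRing.injective _ V.K)).mpr ha

section ExceptionalDivisor

variable [V.IsNormal] {P : V.PrimeDivisor} {O K : Type*} [CommRing O] [IsLocalRing O] [Algebra k O]
  [Algebra.FormallySmooth k O] [Field K] [Algebra O K] [Algebra (V.X.presheaf.stalk P.1) K]
  {v : Valuation K (WithZero (Multiplicative ℤ))} {d : ℕ} {t : Fin (d + 1) → O}
  (ht : IsCoordinateSystem k t) (hv : IsOrderValuation O v)
  (hP : v.Integers (V.X.presheaf.stalk P.1)) {φ : K →+* V.K}
  (hφ : ∀ l : V.X.presheaf.stalk P.1, φ (algebraMap _ K l) = algebraMap _ V.K l)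

include ht hv hP hφ

theorem natCast_le_ord_of_mem_maximalIdeal_pow {r : ℕ} {a : O} (ha : algebraMap O K a ≠ 0)
    (har : a ∈ IsLocalRing.maximalIdeal O ^ r) : (r : ℤ) ≤ V.ord (φ (algebraMap O K a)) P := by
  obtain ⟨π, hπ⟩ := exists_valuation_eq_exp_neg_one ht hv hP 0
  have hirr : Irreducible π := irreducible_of_valuation_eq_exp_neg_one hP hπ
  obtain ⟨l, hl⟩ := hP.exists_of_le_one (hv.le_one a)
  have hdvd : π ^ r ∣ l := hP.dvd_of_le <| by
    rw [hl, map_pow, map_pow, hπ, ← WithZero.exp_nsmul, smul_neg, nsmul_one]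
    exact (hv a r).mpr har
  obtain ⟨b, rfl⟩ := hdvd
  have hπ0 := algebraMap_stalk_ne_zero hirr.ne_zero
  have hb0 : algebraMap _ V.K b ≠ 0 := algebraMap_stalk_ne_zero <| by
    rintro rfl
    exact ha (by rw [← hl, mul_zero, map_zero])
  rw [← hl, hφ, map_mul, map_pow, ord_mul _ (pow_ne_zero _ hπ0) hb0, ord_pow _ hπ0,
    V.ord_algebraMap_irreducible P hirr, mul_one]
  exact le_add_of_nonneg_right ((V.ord_nonneg_iff_isInteger hb0 P).mpr ⟨b, rfl⟩)

theorem hasFormOrd_coordinates [Algebra k K] [IsScalarTower k O K]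
    [IsFractionRing O K] [IsScalarTower k (V.X.presheaf.stalk P.1) K] :
    V.HasFormOrd 1 (fun i => φ (algebraMap O K (t i))) P d := by
  choose s hs using fun i => hP.exists_of_le_one (valuation_blowupCoordinates_le_one ht hv i)
  have hs0 : v (algebraMap _ K (s 0)) = WithZero.exp (-1) :=
    (hs 0).symm ▸ valuation_coordinate ht hv 0
  have hirr : Irreducible (s 0) := irreducible_of_valuation_eq_exp_neg_one hP hs0
  have hs0K : algebraMap _ V.K (s 0) ≠ 0 := algebraMap_stalk_ne_zero hirr.ne_zero
  have ht0 := algebraMap_coordinate_ne_zero ht hv 0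
  refine ⟨s, algebraMap _ V.K (s 0) ^ d, linearIndependent_D_of_hom_inj ht ht0 hP.hom_inj hs,
    span_D_eq_top_of_integers ht hv hP hs, pow_ne_zero _ hs0K, ?_, ?_⟩
  · rw [one_smul]
    refine ιMulti_D_eq_pow_smul_of_eq_mul (s := fun i => algebraMap _ V.K (s i)) ?_ fun i => ?_
    · exact (congrArg φ (hs 0).symm).trans (hφ (s 0))
    · rw [← hφ, ← hφ, ← map_mul, hs, hs]
      exact congrArg φ (eq_mul_blowupCoordinates (t := algebraMap O K ∘ t) ht0 i)
  · rw [ord_pow _ hs0K, V.ord_algebraMap_irreducible P hirr, mul_one]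

end ExceptionalDivisor

section Blowup

variable {x : V.X} {v : Valuation V.K (WithZero (Multiplicative ℤ))} {W : V.X.Opens}
  (hW : IsAffineOpen W)

theorem exists_algebra_stalk_affinePoint [Nonempty W] (C : Subalgebra k V.K)
    (hWC : ∀ a, V.X.germToFunctionField W a ∈ C) [Algebra.FiniteType k C] (p : PrimeSpectrum C) :
    ∃ (_ : Algebra ((affine (k := k) C).X.presheaf.stalk (affinePoint C p)) V.K)
      (_ : IsScalarTower C ((affine (k := k) C).X.presheaf.stalk (affinePoint C p)) V.K)
      (_ : IsScalarTower k ((affine (k := k) C).X.presheaf.stalk (affinePoint C p)) V.K),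
      ∀ l : (affine (k := k) C).X.presheaf.stalk (affinePoint C p),
        chartPullback hW C hWC (algebraMap _ V.K l) = algebraMap _ (affine (k := k) C).K l := by
  let L := (affine (k := k) C).X.presheaf.stalk (affinePoint C p)
  let e := RingEquiv.ofBijective _ (chartPullback_bijective hW C hWC)
  let _ : Algebra L V.K := (e.symm.toRingHom.comp (algebraMap L (affine (k := k) C).K)).toAlgebra
  have he (l : L) : chartPullback hW C hWC (algebraMap L V.K l) =
      algebraMap L (affine (k := k) C).K l := e.apply_symm_apply _
  have hcoe (c : C) : (c : V.K) = algebraMap L V.K (algebraMap C L c) :=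
    (chartPullback hW C hWC).injective <| by
      rw [he, chartPullback_coe, ← IsScalarTower.algebraMap_apply]
  refine ⟨_, .of_algebraMap_eq hcoe, .of_algebraMap_eq fun c => ?_, he⟩
  exact (hcoe (algebraMap k C c)).trans
    (congrArg _ (IsScalarTower.algebraMap_apply k C L c).symm)

theorem germToFunctionField_eq_algebraMap_germ [Nonempty W] (hxW : x ∈ W) (a : Γ(V.X, W)) :
    V.X.germToFunctionField W a = algebraMap _ V.K (V.X.presheaf.germ W x hxW a) :=
  (Scheme.algebraMap_germ_eq_germToFunctionField V.X hxW a).symm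

include hW in
theorem exists_isAffineModel_germToFunctionField_mem [Nonempty W]
    [Algebra.FormallySmooth k (V.X.presheaf.stalk x)] {d : ℕ}
    {t : Fin (d + 1) → V.X.presheaf.stalk x} (ht : IsCoordinateSystem k t)
    (hv : IsOrderValuation (V.X.presheaf.stalk x) v) (hxW : x ∈ W) :
    ∃ C : Subalgebra k V.K, (∀ a, V.X.germToFunctionField W a ∈ C) ∧ IsAffineModel v C := by
  have : Algebra.EssFiniteType k V.K := V.essFiniteType_stalk (genericPoint V.X)
  have ht0 := algebraMap_coordinate_ne_zero ht hv 0
  obtain ⟨C, hC⟩ := exists_isAffineModel (v := v)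
    (span_D_blowupCoordinates ht0 (span_D_algebraMap (B := V.K) ht.span_D)) ht0
    (hv.lt_one_iff.mpr (ht.mem_maximalIdeal 0))
    fun _ hQ => valuation_aeval_blowupCoordinates_eq_one ht hv hQ
  let _ : Algebra k Γ(V.X, W) := (V.sectionConstants W).toAlgebra
  have : Algebra.FiniteType k Γ(V.X, W) := V.finiteType_sectionConstants hW
  let g : Γ(V.X, W) →ₐ[k] V.K :=
    { (V.X.germToFunctionField W).hom with commutes' := fun c => V.germ_sectionConstants _ c }
  have hg : g.range.FG := Algebra.map_top g ▸ Subalgebra.FG.map g Algebra.FiniteType.out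
  obtain ⟨C', hgC', hC'⟩ := hC.exists_le_of_fg hg (by
    rintro _ ⟨a, rfl⟩
    exact (germToFunctionField_eq_algebraMap_germ hxW a).symm ▸ hv.le_one _)
  exact ⟨C', fun a => hgC' ⟨a, rfl⟩, hC'⟩

theorem affineHom_center_eq [Nonempty W] {C : Subalgebra k V.K} [Algebra.FiniteType k C]
    (hv : IsOrderValuation (V.X.presheaf.stalk x) v) (hxW : x ∈ W)
    (hWC : ∀ a, V.X.germToFunctionField W a ∈ C) (hvC : ∀ c : C, v (algebraMap C V.K c) ≤ 1) :
    affineHom (k := k) hW (toChart C hWC) (affinePoint C (center v hvC)) = x := by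
  refine affineHom_eq hW _ hxW _ fun a => ?_
  have := hW.isLocalization_stalk ⟨x, hxW⟩
  let _ := V.X.presheaf.algebra_section_stalk (⟨x, hxW⟩ : W)
  rw [mem_center]
  change v (V.X.germToFunctionField W a) < 1 ↔ _
  rw [germToFunctionField_eq_algebraMap_germ hxW, hv.lt_one_iff]
  exact IsLocalization.AtPrime.to_map_mem_maximal_iff (V.X.presheaf.stalk x)
    (hW.primeIdealOf ⟨x, hxW⟩).asIdeal a

end Blowup

theorem exists_blowup_divisor {x : V.X} [Algebra.FormallySmooth k (V.X.presheaf.stalk x)] {d : ℕ}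
    {t : Fin (d + 1) → V.X.presheaf.stalk x} (ht : IsCoordinateSystem k t) :
    ∃ B : V.DivisorOver, B.centerPoint = x ∧
      (∀ (r : ℕ) (a : V.X.presheaf.stalk x), a ≠ 0 →
        a ∈ IsLocalRing.maximalIdeal (V.X.presheaf.stalk x) ^ r →
        (r : ℤ) ≤ B.Y.ord (B.pullback (algebraMap _ V.K a)) B.E) ∧
      B.Y.HasFormOrd 1 (fun i => B.pullback (algebraMap _ V.K (t i))) B.E d := by
  obtain ⟨v, hv⟩ := exists_isOrderValuation V.K ht.mul_notMem_pow
  obtain ⟨W, hW, hxW, -⟩ := exists_isAffineOpen_mem_and_subset (x := x) (U := ⊤) trivial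
  have : Nonempty W := ⟨⟨x, hxW⟩⟩
  obtain ⟨C, hWC, hC⟩ := exists_isAffineModel_germToFunctionField_mem hW ht hv hxW
  have : Algebra.FiniteType k C := C.fg_iff_finiteType.mp hC.fg
  have := hC.isIntegrallyClosed
  let p := center v fun c : C => hC.valuation_le_one c c.2
  obtain ⟨_, _, hk, hpullback⟩ := exists_algebra_stalk_affinePoint hW C hWC p
  let Y := affine (k := k) C
  let L := Y.X.presheaf.stalk (affinePoint C p)
  have : IsScalarTower k L V.K := hk
  have hL : v.Integers L := hC.integers_of_isLocalization
  obtain ⟨π, hπ⟩ := exists_valuation_eq_exp_neg_one ht hv hL 0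
  have : IsDiscreteValuationRing L := isDiscreteValuationRing_of_integers hL hπ
  let E : Y.PrimeDivisor := ⟨affinePoint C p, coheight_affinePoint C p⟩
  have : Algebra.EssFiniteType k V.K := V.essFiniteType_stalk (genericPoint V.X)
  exact ⟨chartDivisor hW C hWC p E.2, affineHom_center_eq hW hv hxW hWC _,
    fun r a ha => natCast_le_ord_of_mem_maximalIdeal_pow (P := E) ht hv hL hpullback
      (algebraMap_stalk_ne_zero ha),
    hasFormOrd_coordinates (P := E) ht hv hL hpullback⟩

end Variety

/-! ### Pullback of divisors and forms -/

section KaehlerForms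

variable (k A B : Type*) [CommRing k] [CommRing A] [CommRing B] [Algebra k A] [Algebra k B]
  [Algebra A B] [IsScalarTower k A B] (n : ℕ)

/-- The pullback of differential forms of degree `n` along an algebra map `A → B`. -/
def kaehlerFormMap : ⋀[A]^n (Ω[A⁄k]) →ₗ[A] ⋀[B]^n (Ω[B⁄k]) :=
  exteriorPower.alternatingMapLinearEquiv <| AlternatingMap.compLinearMap
    { (exteriorPower.ιMulti B n).toMultilinearMap.restrictScalars A with
      map_eq_zero_of_eq' := (exteriorPower.ιMulti B n).map_eq_zero_of_eq }
    (KaehlerDifferential.map k k A B)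

variable {A n}

theorem kaehlerFormMap_ιMulti_D (s : Fin n → A) :
    kaehlerFormMap k A B n (exteriorPower.ιMulti A n fun i => KaehlerDifferential.D k A (s i)) =
      exteriorPower.ιMulti B n fun i => KaehlerDifferential.D k B (algebraMap A B (s i)) := by
  rw [kaehlerFormMap, exteriorPower.alternatingMapLinearEquiv_apply_ιMulti]
  change exteriorPower.ιMulti B n _ = _
  simp only [KaehlerDifferential.map_D]

end KaehlerForms

namespace Variety

variable {k : Type u} [Field k] {V : Variety k}

section Principal

/-- The divisor of a nonzero rational function. -/
def principal {f : V.K} (hf : f ≠ 0) : V.RDiv :=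
  Finsupp.ofSupportFinite (fun P => (V.ord f P : ℝ)) <|
    (V.finite_setOf_ord_ne_zero hf).subset fun _ => Int.cast_ne_zero.mp

variable {f : V.K} (hf : f ≠ 0)

theorem principal_apply (P : V.PrimeDivisor) : principal hf P = (V.ord f P : ℝ) := rfl

theorem isPrincipal_principal : V.IsPrincipal (principal hf) :=
  ⟨f, hf, fun _ => rfl⟩

theorem IsPrincipal.isCartier {D : V.RDiv} (h : V.IsPrincipal D) : V.IsCartier D := fun _ =>
  let ⟨f, hf, hD⟩ := h
  ⟨⊤, trivial, f, hf, fun P _ => hD P⟩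

theorem IsRCartier.add_smul_principal {D : V.RDiv} (hD : V.IsRCartier D) (r : ℝ) :
    V.IsRCartier (D + r • principal hf) :=
  add_mem hD (Submodule.smul_mem _ _ (Submodule.subset_span (isPrincipal_principal hf).isCartier))

theorem rLinEquiv_add_smul_principal (D : V.RDiv) (r : ℝ) :
    V.RLinEquiv (D + r • principal hf) D := by
  rw [RLinEquiv, add_sub_cancel_left]
  exact Submodule.smul_mem _ _ (Submodule.subset_span (isPrincipal_principal hf))

theorem nonneg_add_inv_smul_principal [V.IsNormal] {D : V.RDiv} {r : ℝ} (hr : 0 < r)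
    (hfD : f ∈ V.sections (r • D)) : 0 ≤ D + r⁻¹ • principal hf := by
  intro P
  have hfloor : (0 : ℝ) ≤ V.ord f P + ⌊(r • D) P⌋ := by exact_mod_cast hfD.resolve_left hf P
  have hle : 0 ≤ r * D P + V.ord f P := by
    have := Int.floor_le ((r • D) P)
    rw [Finsupp.smul_apply, smul_eq_mul] at this hfloor
    linarith
  calc 0 ≤ r⁻¹ * (r * D P + V.ord f P) := mul_nonneg (inv_nonneg.mpr hr.le) hle
    _ = D P + r⁻¹ * V.ord f P := by rw [mul_add, inv_mul_cancel_left₀ hr.ne']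

end Principal

section LocalEquations

theorem exists_ord_eq_sub (x : V.X) {f : V.K} (hf : f ≠ 0) :
    ∃ a b : V.X.presheaf.stalk x, a ≠ 0 ∧ b ≠ 0 ∧
      ∀ P, V.ord f P = V.ord (algebraMap _ V.K a) P - V.ord (algebraMap _ V.K b) P := by
  obtain ⟨a, b, hb, rfl⟩ := IsFractionRing.div_surjective (A := V.X.presheaf.stalk x) f
  have ha : a ≠ 0 := by
    rintro rfl
    exact hf (by rw [map_zero, zero_div])
  have hb : b ≠ 0 := nonZeroDivisors.ne_zero hb
  refine ⟨a, b, ha, hb, fun P => ?_⟩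
  rw [div_eq_mul_inv, V.ord_mul (algebraMap_stalk_ne_zero ha)
    (inv_ne_zero (algebraMap_stalk_ne_zero hb)), V.ord_inv (algebraMap_stalk_ne_zero hb),
    sub_eq_add_neg]

theorem IsRCartier.exists_eq_sum {D : V.RDiv} (hD : V.IsRCartier D) (x : V.X) :
    ∃ (U : V.X.Opens) (N : ℕ) (r : Fin N → ℝ) (h : Fin N → V.X.presheaf.stalk x), x ∈ U ∧
      (∀ i, h i ≠ 0) ∧ ∀ P : V.PrimeDivisor, P.1 ∈ U →
        D P = ∑ i, r i * (V.ord (algebraMap _ V.K (h i)) P : ℝ) := by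
  obtain ⟨N, c, G, rfl⟩ := Submodule.mem_span_set'.mp hD
  choose U hU f hf hfP using fun i => (G i).2 x
  choose a b ha hb hab using fun i => exists_ord_eq_sub x (hf i)
  refine ⟨⟨⋂ i, U i, isOpen_iInter_of_finite fun i => (U i).2⟩, N + N,
    Fin.append c (-c), Fin.append a b, Set.mem_iInter.mpr hU,
    Fin.addCases (fun i => by rw [Fin.append_left]; exact ha i)
      (fun i => by rw [Fin.append_right]; exact hb i), fun P hP => ?_⟩
  rw [Fin.sum_univ_add, Finsupp.finsetSum_apply]
  simp only [Fin.append_left, Fin.append_right, ← Finset.sum_add_distrib]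
  refine Finset.sum_congr rfl fun i _ => ?_
  rw [Finsupp.smul_apply, smul_eq_mul, hfP i P (Set.mem_iInter.mp hP i), hab, Pi.neg_apply]
  push_cast
  ring

theorem algebraMap_stalkSpecializes {x y : V.X} (h : x ⤳ y) (a : V.X.presheaf.stalk y) :
    algebraMap _ V.K (V.X.presheaf.stalkSpecializes h a) = algebraMap _ V.K a :=
  ConcreteCategory.congr_hom (V.X.presheaf.stalkSpecializes_comp (V.genericPoint_specializes x) h) a

end LocalEquations

namespace DivisorOver

variable {B : V.DivisorOver}

theorem pullback_algebraMap_stalk (a : V.X.presheaf.stalk B.centerPoint) :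
    B.pullback (algebraMap _ V.K a) = algebraMap _ B.Y.K ((B.f.stalkMap B.E.1).hom a) := by
  have hcomp := Scheme.Hom.stalkSpecializes_stalkMap_apply B.f _ _
    (B.Y.genericPoint_specializes B.E.1) a
  refine Eq.trans ?_ hcomp
  refine congrArg (B.f.stalkMap (genericPoint B.Y.X)) ?_
  exact ConcreteCategory.congr_hom (V.X.presheaf.stalkSpecializes_comp _ _) a

theorem ord_pullback_nonneg {a : V.X.presheaf.stalk B.centerPoint} (ha : a ≠ 0) :
    0 ≤ B.Y.ord (B.pullback (algebraMap _ V.K a)) B.E := by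
  have := B.isNormal
  refine (B.Y.ord_nonneg_iff_isInteger ?_ B.E).mpr ⟨_, (pullback_algebraMap_stalk a).symm⟩
  exact (map_ne_zero _).mpr (algebraMap_stalk_ne_zero ha)

theorem pullback_algebraMap (c : k) :
    B.pullback (algebraMap k V.K c) = algebraMap k B.Y.K c := by
  have hconst : B.f.appTop (V.constants c) = B.Y.constants c := by
    simp only [constants, ← B.comp_str, Scheme.Hom.comp_appTop]
    rfl
  have hgerm : algebraMap k B.Y.K c = B.Y.X.presheaf.germ ⊤ _ trivial (B.Y.constants c) := rfl
  rw [hgerm, ← hconst]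
  refine Eq.trans ?_
    (Scheme.Hom.germ_stalkMap_apply B.f ⊤ (genericPoint B.Y.X) trivial (V.constants c))
  refine congrArg (B.f.stalkMap (genericPoint B.Y.X)) ?_
  exact V.X.presheaf.germ_stalkSpecializes_apply _ (specializes_of_eq B.map_genericPoint) _

theorem pullback_smul_wedge {n : ℕ} {s t : Fin n → V.K} {g h : V.K}
    (hgh : g • V.wedge s = h • V.wedge t) :
    B.pullback g • B.Y.wedge (fun i => B.pullback (s i)) =
      B.pullback h • B.Y.wedge fun i => B.pullback (t i) := by
  let _ : Algebra V.K B.Y.K := B.pullback.toAlgebra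
  have : IsScalarTower k V.K B.Y.K :=
    IsScalarTower.of_algebraMap_eq fun c => (pullback_algebraMap c).symm
  have hmap := congrArg (kaehlerFormMap k V.K B.Y.K n) hgh
  rwa [wedge, wedge, map_smul, map_smul, kaehlerFormMap_ιMulti_D, kaehlerFormMap_ιMulti_D,
    ← algebraMap_smul B.Y.K g, ← algebraMap_smul B.Y.K h] at hmap

section HasPullbackCoeff

variable {D D' : V.RDiv} {c c' : ℝ}

theorem hasPullbackCoeff_principal {f : V.K} (hf : f ≠ 0) :
    B.HasPullbackCoeff (principal hf) (B.Y.ord (B.pullback f) B.E) :=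
  ⟨⊤, 1, fun _ => 1, fun _ => f, trivial, fun _ => hf, fun P _ => by simp [principal_apply],
    by simp⟩

theorem HasPullbackCoeff.smul (h : B.HasPullbackCoeff D c) (a : ℝ) :
    B.HasPullbackCoeff (a • D) (a * c) := by
  obtain ⟨U, N, r, f, hU, hf, hD, rfl⟩ := h
  refine ⟨U, N, fun i => a * r i, f, hU, hf, fun P hP => ?_, ?_⟩
  · simp only [Finsupp.smul_apply, hD P hP, smul_eq_mul, Finset.mul_sum, mul_assoc]
  · simp only [Finset.mul_sum, mul_assoc]

theorem HasPullbackCoeff.add (h : B.HasPullbackCoeff D c) (h' : B.HasPullbackCoeff D' c') :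
    B.HasPullbackCoeff (D + D') (c + c') := by
  obtain ⟨U, N, r, f, hU, hf, hD, rfl⟩ := h
  obtain ⟨U', N', r', f', hU', hf', hD', rfl⟩ := h'
  refine ⟨U ⊓ U', N + N', Fin.append r r', Fin.append f f', ⟨hU, hU'⟩,
    Fin.addCases (fun i => by rw [Fin.append_left]; exact hf i)
      (fun i => by rw [Fin.append_right]; exact hf' i), fun P hP => ?_, ?_⟩
  · rw [Finsupp.add_apply, hD P hP.1, hD' P hP.2, Fin.sum_univ_add]
    simp
  · rw [Fin.sum_univ_add]
    simp

theorem HasPullbackCoeff.nonneg [V.IsNormal] (h : B.HasPullbackCoeff D c)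
    (hD : ∀ P : V.PrimeDivisor, P.1 ⤳ B.centerPoint → 0 ≤ D P) : 0 ≤ c := by
  obtain ⟨U, N, r, f, hU, hf, hDP, rfl⟩ := h
  let S : Set V.PrimeDivisor := {P | P.1 ⤳ B.centerPoint ∧ ∃ i, V.ord (f i) P ≠ 0}
  have : Finite S := ((Set.finite_iUnion fun i => V.finite_setOf_ord_ne_zero (hf i)).subset
    fun _ hP => Set.mem_iUnion.mpr hP.2 : S.Finite)
  refine sum_mul_nonneg_of_forall_int (fun (P : S) i => V.ord (f i) P) _ (fun q hq => ?_) r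
    fun P => hDP P.1 (P.2.1.mem_open U.2 hU) ▸ hD _ P.2.1
  have hf0 : ∏ i, f i ^ q i ≠ 0 := Finset.prod_ne_zero_iff.mpr fun i _ => zpow_ne_zero _ (hf i)
  have hint : IsLocalization.IsInteger (V.X.presheaf.stalk B.centerPoint) (∏ i, f i ^ q i) := by
    refine V.isInteger_stalk_of_ord_nonneg _ _ fun P hP => ?_
    rw [V.ord_prod_zpow _ hf]
    by_cases hPS : P ∈ S
    · exact hq ⟨P, hPS⟩
    · refine (Finset.sum_eq_zero fun i _ => ?_).ge
      rw [not_ne_iff.mp fun hi => hPS ⟨hP, i, hi⟩, mul_zero]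
  obtain ⟨a, ha⟩ := hint
  have hord := ord_pullback_nonneg (B := B) (a := a) fun ha0 => hf0 (by rw [← ha, ha0, map_zero])
  rw [ha, map_prod] at hord
  simp only [map_zpow₀] at hord
  rwa [B.Y.ord_prod_zpow _ fun i => (map_ne_zero _).mpr (hf i)] at hord

theorem HasPullbackCoeff.passesThrough [V.IsNormal] (h : B.HasPullbackCoeff D c) (hc : c ≠ 0) :
    V.PassesThrough D B.centerPoint := by
  by_contra hD
  have hD0 (P : V.PrimeDivisor) (hP : P.1 ⤳ B.centerPoint) : D P = 0 := by
    by_contra h0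
    exact hD ⟨P, h0, specializes_iff_mem_closure.mp hP⟩
  have hnonneg : 0 ≤ c := h.nonneg fun P hP => (hD0 P hP).ge
  have hnonpos : 0 ≤ -1 * c := (h.smul (-1)).nonneg fun P hP => by simp [hD0 P hP]
  exact hc (by linarith)

end HasPullbackCoeff

end DivisorOver

theorem IsRCartier.exists_hasPullbackCoeff {D : V.RDiv} (hD : V.IsRCartier D)
    (B : V.DivisorOver) : ∃ c, B.HasPullbackCoeff D c :=
  let ⟨U, N, r, h, hU, hh, hDP⟩ := hD.exists_eq_sum B.centerPoint
  ⟨_, U, N, r, fun i => algebraMap _ V.K (h i), hU, fun i => algebraMap_stalk_ne_zero (hh i), hDP,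
    rfl⟩

section Forms

variable {n : ℕ}

theorem RationalForm.exists_eq_smul_wedge (ω : V.RationalForm n) {τ : Fin n → V.K}
    (hτ : Submodule.span V.K (Set.range fun i => KaehlerDifferential.D k V.K (τ i)) = ⊤) :
    ∃ h : V.K, h ≠ 0 ∧ ω.g • V.wedge ω.t = h • V.wedge τ := by
  choose A hA using fun i => (Submodule.mem_span_range_iff_exists_fun V.K).mp
    (hτ ▸ Submodule.mem_top : KaehlerDifferential.D k V.K (ω.t i) ∈ _)
  have hω : V.wedge ω.t = (Matrix.of A).det • V.wedge τ :=
    alternatingMap_apply_eq_det_smul _ (Matrix.of A) fun i => (hA i).symm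
  refine ⟨ω.g * (Matrix.of A).det, fun h0 => ω.ne_zero ?_, by rw [hω, smul_smul]⟩
  rw [hω, smul_smul, h0, zero_smul]

theorem HasFormOrd.of_eq_smul {g f : V.K} {t τ : Fin n → V.K} {P : V.PrimeDivisor} {m : ℤ}
    (h : V.HasFormOrd 1 τ P m) (hf : f ≠ 0) (hgf : g • V.wedge t = f • V.wedge τ) :
    V.HasFormOrd g t P (V.ord f P + m) := by
  obtain ⟨s, h, hli, hspan, hh, hτ, rfl⟩ := h
  refine ⟨s, f * h, hli, hspan, mul_ne_zero hf hh, ?_, V.ord_mul hf hh P⟩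
  rw [hgf, mul_smul, ← hτ, one_smul]

theorem HasFormOrd.ord_le [V.IsNormal] {g f : V.K} {t : Fin n → V.K} {P : V.PrimeDivisor} {m : ℤ}
    (h : V.HasFormOrd g t P m) {τ : Fin n → V.X.presheaf.stalk P.1} (hf : f ≠ 0)
    (hg : g • V.wedge t ≠ 0)
    (hgf : g • V.wedge t = f • V.wedge fun i => algebraMap _ V.K (τ i)) : V.ord f P ≤ m := by
  obtain ⟨s, h, -, hspan, hh, hs, rfl⟩ := h
  choose A hA using fun i => (Submodule.mem_span_range_iff_exists_fun _).mp
    (hspan ▸ Submodule.mem_top : KaehlerDifferential.D k (V.X.presheaf.stalk P.1) (τ i) ∈ _)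
  let a := (Matrix.of A).det
  have hτ : V.wedge (fun i => algebraMap _ V.K (τ i)) =
      algebraMap _ V.K a • V.wedge fun i => algebraMap _ V.K (s i) := by
    have hmap := congrArg (kaehlerFormMap k _ V.K n) <| alternatingMap_apply_eq_det_smul
      (exteriorPower.ιMulti _ n) (Matrix.of A) fun i => (hA i).symm
    rwa [map_smul, kaehlerFormMap_ιMulti_D, kaehlerFormMap_ιMulti_D,
      ← algebraMap_smul V.K] at hmap
  rw [hgf, hτ, smul_smul] at hs hg
  have hfa : f * algebraMap _ V.K a = h := smul_left_injective V.K (right_ne_zero_of_smul hg) hs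
  have ha0 : algebraMap _ V.K a ≠ 0 := right_ne_zero_of_mul (hfa ▸ hh)
  rw [← hfa, V.ord_mul hf ha0]
  exact le_add_of_nonneg_right ((V.ord_nonneg_iff_isInteger ha0 P).mpr ⟨a, rfl⟩)

theorem IsDivOfForm.exists_hasFormOrd_le [V.IsNormal] {ω : V.RationalForm n} {C Δ : V.RDiv}
    (hC : V.IsDivOfForm ω C) (hΔ : 0 ≤ Δ) {B : V.DivisorOver}
    {t : Fin n → V.X.presheaf.stalk B.centerPoint}
    (ht : Submodule.span (V.X.presheaf.stalk B.centerPoint)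
      (Set.range fun i => KaehlerDifferential.D k (V.X.presheaf.stalk B.centerPoint) (t i)) = ⊤)
    {e : ℤ} (hform : B.Y.HasFormOrd 1 (fun i => B.pullback (algebraMap _ V.K (t i))) B.E e)
    {c : ℝ} (hc : B.HasPullbackCoeff (C + Δ) c) :
    ∃ m : ℤ, B.Y.HasFormOrd (B.pullback ω.g) (fun i => B.pullback (ω.t i)) B.E m ∧ m ≤ e + c := by
  obtain ⟨h, hh, hω⟩ := ω.exists_eq_smul_wedge (span_D_algebraMap (B := V.K) ht)
  refine ⟨_, hform.of_eq_smul ((map_ne_zero _).mpr hh) (DivisorOver.pullback_smul_wedge hω), ?_⟩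
  have hsub := hc.add ((DivisorOver.hasPullbackCoeff_principal hh).smul (-1))
  -- `C + Δ - div h` is effective near the center of `E`, since `div h ≤ C` there.
  have heff := hsub.nonneg fun P hP => by
    obtain ⟨m, hm, hCP⟩ := hC P
    have hle : V.ord h P ≤ m := by
      refine hm.ord_le (τ := fun i => V.X.presheaf.stalkSpecializes hP (t i)) hh ω.ne_zero ?_
      simpa only [algebraMap_stalkSpecializes] using hω
    have hle' : (V.ord h P : ℝ) ≤ m := by exact_mod_cast hle
    have hΔP : 0 ≤ Δ P := hΔ P
    simp only [Finsupp.add_apply, Finsupp.smul_apply, principal_apply, smul_eq_mul]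
    linarith
  push_cast
  linarith

theorem IsDivOfForm.finrank_kaehlerDifferential_eq {ω : V.RationalForm n} {C : V.RDiv}
    (hC : V.IsDivOfForm ω C) (P : V.PrimeDivisor) : Module.finrank V.K (Ω[V.K⁄k]) = n := by
  obtain ⟨m, ⟨s, h, hli, hspan, -⟩, -⟩ := hC P
  have := (Module.finrank_eq_card_basis (Module.Basis.mk (linearIndependent_D_algebraMap (B := V.K)
    hli) (span_D_algebraMap hspan).ge))
  rwa [Fintype.card_fin] at this

end Forms

end Variety

/-! ### Sections vanishing to high order -/

theorem exists_choose_lt_of_lt_limsup {h : ℕ → ℕ} {n : ℕ} (W : ℕ)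
    (hlim : (((n : ℝ) ^ n : ℝ) : EReal) < Filter.limsup (fun m : ℕ =>
      (((n.factorial : ℝ) * (h m : ℝ) / (m : ℝ) ^ n : ℝ) : EReal)) Filter.atTop) :
    ∃ M : ℕ, 0 < M ∧ (n + (M * n + W)).choose (M * n + W) < h M := by
  obtain ⟨c, hnc, hc⟩ := EReal.lt_iff_exists_real_btwn.mp hlim
  have hfreq := Filter.frequently_lt_of_lt_limsup (by isBoundedDefault) hc
  have htend : Filter.Tendsto (fun M : ℕ => ((n : ℝ) + ((n : ℝ) + W) / (M : ℝ)) ^ n) Filter.atTop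
      (nhds ((n : ℝ) ^ n)) := by
    simpa only [add_zero] using
      ((tendsto_const_div_atTop_nhds_zero_nat ((n : ℝ) + W)).const_add (n : ℝ)).pow n
  have hev := htend.eventually_lt_const (EReal.coe_lt_coe_iff.mp hnc)
  obtain ⟨M, hhM, hMc, hM0⟩ :=
    (hfreq.and_eventually (hev.and (Filter.eventually_gt_atTop 0))).exists
  have hM : (0 : ℝ) < M := Nat.cast_pos.mpr hM0
  have hlt : ((n + (M * n + W) : ℕ) : ℝ) ^ n < n.factorial * h M := by
    have := hMc.trans (EReal.coe_lt_coe_iff.mp hhM)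
    rw [lt_div_iff₀ (pow_pos hM n), ← mul_pow, add_mul, div_mul_cancel₀ _ hM.ne'] at this
    refine lt_of_eq_of_lt ?_ this
    push_cast
    ring
  refine ⟨M, hM0, ?_⟩
  rw [← Nat.choose_symm_add, ← Nat.cast_lt (α := ℝ)]
  refine (Nat.choose_le_pow_div (α := ℝ) n _).trans_lt ?_
  rw [div_lt_iff₀' (Nat.cast_pos.mpr n.factorial_pos)]
  exact hlt

namespace Variety

variable {k : Type u} [Field k] {V : Variety k} {x : V.X}

section Volume

theorem algebraMap_functionField_surjective_of_isField
    (hk : Function.Surjective (algebraMap k (IsLocalRing.ResidueField (V.X.presheaf.stalk x))))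
    (hx : IsField (V.X.presheaf.stalk x)) : Function.Surjective (algebraMap k V.K) := by
  have hsurj : Function.Surjective (algebraMap k (V.X.presheaf.stalk x)) := fun a => by
    have hmem := sub_algebraMap_residueAlgHom_mem_maximalIdeal hk a
    rw [IsLocalRing.isField_iff_maximalIdeal_eq.mp hx, Ideal.mem_bot, sub_eq_zero] at hmem
    exact ⟨_, hmem.symm⟩
  rw [IsScalarTower.algebraMap_eq k (V.X.presheaf.stalk x) V.K]
  exact (IsFractionRing.surjective_iff_isField.mpr hx).comp hsurj

theorem vol_le_of_algebraMap_surjective [V.IsNormal]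
    (hk : Function.Surjective (algebraMap k V.K)) (n : ℕ) (D : V.RDiv) :
    V.vol n D ≤ (((n : ℝ) ^ n : ℝ) : EReal) := by
  have : Module.Finite k V.K := Module.Finite.of_surjective (Algebra.linearMap k V.K) hk
  have hrank (S : Submodule k V.K) : Module.finrank k S ≤ 1 :=
    (Submodule.finrank_le S).trans <| finrank_le_one (1 : V.K) fun f =>
      (hk f).imp fun c hc => by rw [Algebra.smul_def, mul_one, hc]
  refine Filter.limsup_le_of_le (by isBoundedDefault) ?_
  filter_upwards [Filter.eventually_ge_atTop 1] with m hm
  rw [EReal.coe_le_coe_iff]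
  calc (n.factorial : ℝ) * (Module.finrank k (V.sections ((m : ℝ) • D)) : ℝ) / (m : ℝ) ^ n
      ≤ (n.factorial : ℝ) * (Module.finrank k (V.sections ((m : ℝ) • D)) : ℝ) :=
        div_le_self (by positivity) (one_le_pow₀ (Nat.one_le_cast.mpr hm))
    _ ≤ n.factorial :=
        mul_le_of_le_one_right (Nat.cast_nonneg _) (Nat.cast_le_one.mpr (hrank _))
    _ ≤ (n : ℝ) ^ n := by exact_mod_cast n.factorial_le_pow

end Volume

section SectionsAtPoint

theorem isInteger_mul_of_mem_sections [V.IsNormal] {D : V.RDiv} {f g : V.K} (hf : f ∈ V.sections D)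
    (hg : g ≠ 0) (hD : ∀ P : V.PrimeDivisor, P.1 ⤳ x → ⌊D P⌋ ≤ V.ord g P) :
    IsLocalization.IsInteger (V.X.presheaf.stalk x) (g * f) := by
  by_cases hf0 : f = 0
  · rw [hf0, mul_zero]
    exact IsLocalization.isInteger_zero
  refine V.isInteger_stalk_of_ord_nonneg _ _ fun P hP => ?_
  rw [V.ord_mul hg hf0]
  linarith [hD P hP, hf.resolve_left hf0 P]

theorem exists_linearMap_algebraMap_eq (S : Submodule k V.K) {g : V.K}
    (hg : ∀ f ∈ S, IsLocalization.IsInteger (V.X.presheaf.stalk x) (g * f)) :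
    ∃ φ : S →ₗ[k] V.X.presheaf.stalk x, ∀ f, algebraMap _ V.K (φ f) = g * f := by
  let ψ := (IsScalarTower.toAlgHom k (V.X.presheaf.stalk x) V.K).toLinearMap
  have hψ : Function.Injective ψ := IsFractionRing.injective (V.X.presheaf.stalk x) V.K
  let μ := (LinearMap.mulLeft k g ∘ₗ S.subtype).codRestrict (LinearMap.range ψ) fun f => hg f f.2
  exact ⟨(LinearEquiv.ofInjective ψ hψ).symm.toLinearMap ∘ₗ μ, fun f =>
    congrArg Subtype.val ((LinearEquiv.ofInjective ψ hψ).apply_symm_apply (μ f))⟩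

/-- Near the center `D = ∑ rᵢ div hᵢ` with regular `hᵢ`, and `g = ∏ hᵢ ^ ⌈M rᵢ⌉` clears the
denominators of the sections of `⌊M D⌋`; rounding up costs at most `W = ∑ ord_E hᵢ`,
whatever `M` is. -/
theorem IsRCartier.exists_hasPullbackCoeff_and_isInteger [V.IsNormal] {D : V.RDiv}
    (hD : V.IsRCartier D) (B : V.DivisorOver) :
    ∃ (c : ℝ) (W : ℕ), B.HasPullbackCoeff D c ∧ ∀ M : ℕ, ∃ g : V.K, g ≠ 0 ∧
      (∀ f ∈ V.sections ((M : ℝ) • D),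
        IsLocalization.IsInteger (V.X.presheaf.stalk B.centerPoint) (g * f)) ∧
      (B.Y.ord (B.pullback g) B.E : ℝ) ≤ M * c + W := by
  obtain ⟨U, N, r, a, hU, ha, hDP⟩ := hD.exists_eq_sum B.centerPoint
  let h (i : Fin N) : V.K := algebraMap _ V.K (a i)
  have hh (i) : h i ≠ 0 := algebraMap_stalk_ne_zero (ha i)
  let w (i : Fin N) : ℤ := B.Y.ord (B.pullback (h i)) B.E
  have hw (i) : 0 ≤ w i := DivisorOver.ord_pullback_nonneg (ha i)
  obtain ⟨W, hW⟩ := Int.eq_ofNat_of_zero_le (Fintype.sum_nonneg hw)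
  refine ⟨_, W, ⟨U, N, r, h, hU, hh, hDP, rfl⟩, fun M => ?_⟩
  have hg : ∏ i, h i ^ ⌈M * r i⌉ ≠ 0 := Finset.prod_ne_zero_iff.mpr fun i _ => zpow_ne_zero _ (hh i)
  refine ⟨_, hg, fun f hf => isInteger_mul_of_mem_sections hf hg fun P hP => ?_, ?_⟩
  · have hord (i) : 0 ≤ V.ord (h i) P := (V.ord_nonneg_iff_isInteger (hh i) P).mpr
      ⟨V.X.presheaf.stalkSpecializes hP (a i), algebraMap_stalkSpecializes hP (a i)⟩
    rw [V.ord_prod_zpow _ hh, ← Int.cast_le (R := ℝ)]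
    refine (Int.floor_le _).trans ?_
    rw [Finsupp.smul_apply, hDP P (hP.mem_open U.2 hU), smul_eq_mul, Finset.mul_sum]
    push_cast
    refine Finset.sum_le_sum fun i _ => ?_
    rw [← mul_assoc]
    exact mul_le_mul_of_nonneg_right (Int.le_ceil _) (Int.cast_nonneg (hord i))
  · have hWsum : (W : ℝ) = ∑ i, (w i : ℝ) := by exact_mod_cast hW.symm
    simp only [map_prod, map_zpow₀]
    rw [B.Y.ord_prod_zpow _ fun i => (map_ne_zero _).mpr (hh i), hWsum, Finset.mul_sum,
      ← Finset.sum_add_distrib]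
    push_cast
    refine Finset.sum_le_sum fun i _ => ?_
    calc (⌈M * r i⌉ * w i : ℝ) ≤ (M * r i + 1) * w i :=
          mul_le_mul_of_nonneg_right (Int.ceil_lt_add_one _).le (Int.cast_nonneg (hw i))
      _ = M * (r i * w i) + w i := by ring

theorem exists_rLinEquiv_lt_hasPullbackCoeff [V.IsNormal] {B : V.DivisorOver} {n : ℕ}
    {t : Fin n → V.X.presheaf.stalk B.centerPoint} (ht : IsCoordinateSystem k t)
    (hord : ∀ (r : ℕ) (a : V.X.presheaf.stalk B.centerPoint), a ≠ 0 →
      a ∈ IsLocalRing.maximalIdeal (V.X.presheaf.stalk B.centerPoint) ^ r →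
      (r : ℤ) ≤ B.Y.ord (B.pullback (algebraMap _ V.K a)) B.E)
    {D : V.RDiv} (hD : V.IsRCartier D) (hvol : (((n : ℝ) ^ n : ℝ) : EReal) < V.vol n D) :
    ∃ Θ : V.RDiv, 0 ≤ Θ ∧ V.IsRCartier Θ ∧ V.RLinEquiv Θ D ∧
      ∃ c : ℝ, B.HasPullbackCoeff Θ c ∧ n < c := by
  obtain ⟨c, W, hc, hgM⟩ := hD.exists_hasPullbackCoeff_and_isInteger B
  obtain ⟨M, hM, hfinrank⟩ := exists_choose_lt_of_lt_limsup W hvol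
  obtain ⟨g, hg, hreg, hgord⟩ := hgM M
  obtain ⟨φ, hφ⟩ := exists_linearMap_algebraMap_eq _ hreg
  obtain ⟨⟨f, hfD⟩, hf, hfpow⟩ := exists_ne_zero_mem_maximalIdeal_pow ht.residue_surjective
    ht.span_eq φ (r := M * n + W) (by rwa [Fintype.card_fin])
  have hf0 : f ≠ 0 := fun h => hf (Subtype.ext h)
  have hφf : φ ⟨f, hfD⟩ ≠ 0 := fun h => by
    have := hφ ⟨f, hfD⟩
    rw [h, map_zero] at this
    exact mul_ne_zero hg hf0 this.symm
  have hvanish := hord _ _ hφf hfpow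
  rw [hφ, map_mul, B.Y.ord_mul ((map_ne_zero _).mpr hg) ((map_ne_zero _).mpr hf0)] at hvanish
  have hM0 : (0 : ℝ) < M := Nat.cast_pos.mpr hM
  refine ⟨D + (M : ℝ)⁻¹ • principal hf0, nonneg_add_inv_smul_principal hf0 hM0 hfD,
    hD.add_smul_principal hf0 _, rLinEquiv_add_smul_principal hf0 D _, _,
    hc.add ((DivisorOver.hasPullbackCoeff_principal hf0).smul _), ?_⟩
  have hlt : M * n < M * c + B.Y.ord (B.pullback f) B.E := by
    have : ((M * n + W + 1 : ℕ) : ℝ) ≤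
        B.Y.ord (B.pullback g) B.E + B.Y.ord (B.pullback f) B.E := by exact_mod_cast hvanish
    push_cast at this
    linarith
  calc (n : ℝ) = (M : ℝ)⁻¹ * (M * n) := (inv_mul_cancel_left₀ hM0.ne' _).symm
    _ < (M : ℝ)⁻¹ * (M * c + B.Y.ord (B.pullback f) B.E) :=
        mul_lt_mul_of_pos_left hlt (inv_pos.mpr hM0)
    _ = c + (M : ℝ)⁻¹ * B.Y.ord (B.pullback f) B.E := by
        rw [mul_add, inv_mul_cancel_left₀ hM0.ne']

end SectionsAtPoint

end Variety

end BirGeom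

end

theorem mainTheorem9_general {k : Type u} [Field k] (X : Variety k) [X.IsNormal] {n : ℕ}
    (_hdim : topologicalKrullDim X.X = n) {ω : X.RationalForm n} {C Δ : X.RDiv} (hΔ : 0 ≤ Δ)
    (hC : X.IsDivOfForm ω C) (hCΔ : X.IsRCartier (C + Δ)) {D : X.RDiv}
    (hD : X.IsRCartier D) (hvol : (((n : ℝ) ^ n : ℝ) : EReal) < X.vol n D) {x : X.X}
    (hk : Function.Surjective (algebraMap k (IsLocalRing.ResidueField (X.X.presheaf.stalk x))))
    (hsm : X.IsSmoothAt x) :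
    ∃ Θ : X.RDiv, 0 ≤ Θ ∧ X.IsRCartier Θ ∧ X.RLinEquiv Θ D ∧ X.PassesThrough Θ x ∧
      ¬ X.IsKltAt n (Δ + Θ) x := by
  have := X.formallySmooth_stalk hsm
  have := X.essFiniteType_stalk x
  obtain ⟨e, t, ht⟩ := exists_isCoordinateSystem hk
  have hfield : ¬ IsField (X.X.presheaf.stalk x) := fun hx => hvol.not_ge <|
    Variety.vol_le_of_algebraMap_surjective
      (Variety.algebraMap_functionField_surjective_of_isField hk hx) n D
  obtain ⟨P, -⟩ := X.exists_primeDivisor_specializes x hfield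
  obtain rfl : e = n := by
    rw [← hC.finrank_kaehlerDifferential_eq P, finrank_kaehlerDifferential_eq_card ht,
      Fintype.card_fin]
  obtain _ | d := e
  · have hspan := ht.span_eq
    rw [Set.range_eq_empty, Ideal.span_empty, eq_comm] at hspan
    exact absurd (IsLocalRing.isField_iff_maximalIdeal_eq.mpr hspan) hfield
  obtain ⟨B, rfl, hord, hform⟩ := Variety.exists_blowup_divisor ht
  obtain ⟨Θ, hΘ0, hΘ, hΘD, c, hc, hnc⟩ :=
    Variety.exists_rLinEquiv_lt_hasPullbackCoeff ht hord hD hvol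
  have hc0 : c ≠ 0 := ((Nat.cast_nonneg _).trans_lt hnc).ne'
  refine ⟨Θ, hΘ0, hΘ, hΘD, hc.passesThrough hc0, fun hklt => ?_⟩
  obtain ⟨c', hc'⟩ := hCΔ.exists_hasPullbackCoeff B
  obtain ⟨m, hm, hmc⟩ := hC.exists_hasFormOrd_le hΔ ht.span_D hform hc'
  have hdisc : B.HasDiscrepancy (d + 1) (Δ + Θ) (m - (c' + c)) :=
    ⟨ω, C, m, _, hC, hm, add_assoc C Δ Θ ▸ hc'.add hc, rfl⟩
  have := hklt B _ (subset_closure rfl) hdisc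
  push_cast at hnc hmc
  linarith

theorem mainTheorem9 {k : Type u} [Field k] [IsAlgClosed k]
    (X : Variety k) [X.IsNormal] (hproj : X.IsProjective)
    (n : ℕ) (hdim : topologicalKrullDim X.X = n)
    (Δ : X.RDiv) (hΔ : X.IsLogPair n Δ)
    (D : X.RDiv) (hD : X.IsRCartier D)
    (hvol : (((n : ℝ) ^ n : ℝ) : EReal) < X.vol n D)
    (x : X.X) (hx : IsClosed {x}) (hsm : X.IsSmoothAt x) :
    ∃ Θ : X.RDiv, 0 ≤ Θ ∧ X.IsRCartier Θ ∧ X.RLinEquiv Θ D ∧ X.PassesThrough Θ x ∧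
      ¬ X.IsKltAt n (Δ + Θ) x :=
  let ⟨hΔ01, _, _, hC, hCΔ⟩ := hΔ
  mainTheorem9_general X hdim (fun P => (hΔ01 P).1) hC hCΔ hD hvol
    (X.algebraMap_residueField_surjective_of_isClosed hx) hsm
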